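/- **Lemma (Reduction to stopping MDPs).** Let $\mathcal M=(S,s_0,A,\delta)$ be a finite Markov decision process and let $\Phi=(F,r)$ be a weighted-reachability objective: $F\subseteq S$ is a set of absorbing target states, $r\colon F\to\mathbb Q\setminus\{0\}$, and the value $\Phi(\rho)$ of an infinite path $\rho$ is the reward of its first visited target, or $0$ if no target is visited. The outcomes of $\Phi$ are the numbers $r(s)$, $s\in F$, together with $0$, listed increasingly as $o_1<\dots<o_k$. Strategies may depend on the history and may randomize, and $\mathbb P^\sigma_{\mathcal M}$ is the law of the infinite path under the strategy $\sigma$. The prospect induced by $\sigma$ is $(\vec o,\vec p)$ with $p_i=\mathbb P^\sigma_{\mathcal M}[\Phi=o_i]$, and $\mathsf{CPT\text{-}val}(\mathcal M,\Phi)=\sup_\sigma \mathsf{cpt}(\text{prospect induced by }\sigma)$, where, for an increasing continuous utility function $u$ and increasing continuous weighting functions $w^+,w^-\colon[0,1]\to[0,1]$, $$\mathsf{cpt}(\vec o,\vec p)=\sum_{o_i>0}u(o_i)\Bigl(w^+\bigl(\textstyle\sum_{m\ge i}p_m\bigr)-w^+\bigl(\sum_{m>i}p_m\bigr)\Bigr)+\sum_{o_i<0}u(o_i)\Bigl(w^-\bigl(\textstyle\sum_{m\le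 i}p_m\bigr)-w^-\bigl(\sum_{m<i}p_m\bigr)\Bigr).$$ Regard actions of different states as different. Let $(T_1,B_1),\dots,(T_n,B_n)$ be the maximal end components of $\mathcal M$ within $S\setminus F$. The MEC quotient $\widehat{\mathcal M}$ has as states the states of $\mathcal M$ outside $\bigcup_i T_i$, one state $\widehat s_i$ for each component, and a new state $\mathsf z$. The states outside the components keep their actions; the actions of $\widehat s_i$ are the actions of the states in $T_i$ that are not in $B_i$, and an action $\mathsf{stay}$, which leads to $\mathsf z$ with probability $1$; the only action of $\mathsf z$ is $\mathsf{stay}$, which stays in $\mathsf z$. The original actions keep their transition probabilities, where the probabilities of all successors in $T_j$ are added up to give the probability of moving to $\widehat s_j$. The initial state is $s_0$, or $\widehat s_i$ if $s_0\in T_i$. The targets and their rewards are unchanged. Then: 1. $\widehat{\mathcal M}$ is stopping: $\mathsf z$ is absorbing and not a target, and $\mathbb P^{\widehat\sigma}_{\widehat{\mathcal M}}[\text{a state of }F\cup\{\mathsf z\}\text{ is reached}]=1$ for every strategy $\widehat\sigma$. 2. The set of prospects that $\mathcal M$ induces under all (history-dependent, randomized) strategies equals the set of prospects that $\widehat{\mathcal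 M}$ induces under all such strategies. 3. $\mathsf{CPT\text{-}val}(\mathcal M,\Phi)=\mathsf{CPT\text{-}val}(\widehat{\mathcal M},\Phi)$ for all $u,w^+,w^-$. The same equality holds for the value defined directly as $\sup_\sigma$ of the expression above with $\mathbb P^\sigma[\Phi\ge o]$, $\mathbb P^\sigma[\Phi>o]$, $\mathbb P^\sigma[\Phi\le o]$, $\mathbb P^\sigma[\Phi<o]$ in place of the sums of the $p_m$. 4. There is an algorithm that, for every $(\mathcal M,\Phi)$ with rational transition probabilities, constructs $(\widehat{\mathcal M},\Phi)$ together with its sink $\mathsf z$ from $(\mathcal M,\Phi)$ in time polynomial in the bit size of the input. MDPs are given explicitly, with transition probabilities and rewards as fractions of integers in binary (the probabilities not necessarily in lowest terms), and time is the bit cost. -/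

import Mathlib

open MeasureTheory ProbabilityTheory
open scoped ENNReal

namespace CPTMDP

universe u v

/-! ## Markov decision processes, strategies and the induced path measure -/

/-- A Markov decision process with state space `S` and actions `A`. The transition function is
partial: `δ s a` is only meaningful for `a ∈ avail s`, and the other values are never used. -/
structure MDP (S : Type u) (A : Type v) where
  init : S
  avail : S → Set A
  avail_nonempty : ∀ s, (avail s).Nonempty
  δ : S → A → PMF S

/-- One step of a path: the current state and the action chosen in it. -/
@[ext]
structure Step (S : Type u) (A : Type v) where
  state : S
  act : A

instance {S : Type u} {A : Type v} : MeasurableSpace (Step S A) := ⊤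

instance {S : Type u} {A : Type v} : DiscreteMeasurableSpace (Step S A) :=
  ⟨fun _ => trivial⟩

instance {S : Type u} {A : Type v} [Finite S] [Finite A] : Finite (Step S A) :=
  Finite.of_injective (fun x : Step S A => (x.state, x.act)) (by
    rintro ⟨s, a⟩ ⟨t, b⟩ h
    simpa using h)

/-- A history-dependent randomized strategy. The history `s₀ a₀ s₁ a₁ … sₙ` is given by the list
of the steps `(s₀, a₀), …, (sₙ₋₁, aₙ₋₁)` in chronological order and the current state `sₙ`; the
strategy returns a distribution over the actions that are available in `sₙ`. -/
structure Strategy {S : Type u} {A : Type v} (M : MDP S A) where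
  choose : List (Step S A) → S → PMF A
  support_subset : ∀ h s, (choose h s).support ⊆ M.avail s

namespace MDP

variable {S : Type u} {A : Type v}

/-- The law of the next step (successor state, then action) after the steps `h` and the last
step `x`. -/
noncomputable def nextStep (M : MDP S A) (σ : Strategy M) (h : List (Step S A)) (x : Step S A) :
    PMF (Step S A) :=
  (M.δ x.state x.act).bind fun s => (σ.choose h s).map fun a => Step.mk s a

/-- The law of the step at time `n + 1`, given the steps at the times `0, …, n`. -/
noncomputable def stepKernel [Finite S] [Finite A] (M : MDP S A) (σ : Strategy M) (n : ℕ) :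
    Kernel ((i : Finset.Iic n) → Step S A) (Step S A) :=
  Kernel.ofFunOfCountable fun x =>
    (M.nextStep σ (List.ofFn fun i : Fin (n + 1) => x ⟨i, Finset.mem_Iic.2 (by omega)⟩)
      (x ⟨n, Finset.mem_Iic.2 le_rfl⟩)).toMeasure

instance [Finite S] [Finite A] (M : MDP S A) (σ : Strategy M) (n : ℕ) :
    IsMarkovKernel (M.stepKernel σ n) :=
  ⟨fun _ => PMF.toMeasure.isProbabilityMeasure _⟩

/-- The law of the first step: the initial state and the action chosen in it. -/
noncomputable def firstStep (M : MDP S A) (σ : Strategy M) : Measure (Step S A) :=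
  ((σ.choose [] M.init).map fun a => Step.mk M.init a).toMeasure

/-- The probability measure on infinite paths that is induced by the strategy `σ`. -/
noncomputable def pathMeasure [Finite S] [Finite A] (M : MDP S A) (σ : Strategy M) :
    Measure (ℕ → Step S A) :=
  Kernel.trajMeasure (X := fun _ => Step S A) (M.firstStep σ) (M.stepKernel σ)

/-! ## End components -/

/-- `(T, B)` is an end component. To make actions unique, `B` consists of pairs of a state and an
action that is available in it. -/
structure IsEC (M : MDP S A) (T : Set S) (B : Set (S × A)) : Prop where
  states_nonempty : T.Nonempty
  acts_nonempty : B.Nonempty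
  acts_subset : ∀ x ∈ B, x.1 ∈ T ∧ x.2 ∈ M.avail x.1
  closed : ∀ x ∈ B, (M.δ x.1 x.2).support ⊆ T
  connected : ∀ s ∈ T, ∀ t ∈ T,
    Relation.TransGen (fun x y => ∃ a, (x, a) ∈ B ∧ y ∈ (M.δ x a).support) s t

/-- The maximal end components `(T, B)` of `M` within the set `U` of states. -/
@[ext]
structure MEC (M : MDP S A) (U : Set S) where
  T : Set S
  B : Set (S × A)
  isEC : M.IsEC T B
  subset : T ⊆ U
  maximal : ∀ T' B', M.IsEC T' B' → T' ⊆ U → T ⊆ T' → B ⊆ B' → T' = T ∧ B' = B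

instance [Finite S] [Finite A] (M : MDP S A) (U : Set S) : Finite (M.MEC U) :=
  Finite.of_injective (fun C : M.MEC U => (C.T, C.B)) fun C D h => by
    simp only [Prod.mk.injEq] at h
    exact MEC.ext h.1 h.2

/-- Distinct maximal end components are disjoint. -/
theorem MEC.eq_of_mem {M : MDP S A} {U : Set S} (C D : M.MEC U) {s : S} (hC : s ∈ C.T)
    (hD : s ∈ D.T) : C = D := by
  have mono : ∀ {B B' : Set (S × A)}, B ⊆ B' → ∀ {x y : S},
      Relation.TransGen (fun x y => ∃ a, (x, a) ∈ B ∧ y ∈ (M.δ x a).support) x y →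
      Relation.TransGen (fun x y => ∃ a, (x, a) ∈ B' ∧ y ∈ (M.δ x a).support) x y := by
    intro B B' h x y hxy
    refine Relation.TransGen.mono ?_ x y hxy
    rintro x y ⟨a, ha, hy⟩
    exact ⟨a, h ha, hy⟩
  have key : M.IsEC (C.T ∪ D.T) (C.B ∪ D.B) := by
    refine ⟨⟨s, Or.inl hC⟩, C.isEC.acts_nonempty.mono Set.subset_union_left, ?_, ?_, ?_⟩
    · rintro x (hx | hx)
      · exact ⟨Or.inl (C.isEC.acts_subset x hx).1, (C.isEC.acts_subset x hx).2⟩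
      · exact ⟨Or.inr (D.isEC.acts_subset x hx).1, (D.isEC.acts_subset x hx).2⟩
    · rintro x (hx | hx)
      · exact (C.isEC.closed x hx).trans Set.subset_union_left
      · exact (D.isEC.closed x hx).trans Set.subset_union_right
    · intro x hx y hy
      have h1 : Relation.TransGen
          (fun x y => ∃ a, (x, a) ∈ C.B ∪ D.B ∧ y ∈ (M.δ x a).support) x s := by
        rcases hx with hx | hx
        · exact mono Set.subset_union_left (C.isEC.connected x hx s hC)
        · exact mono Set.subset_union_right (D.isEC.connected x hx s hD)
      have h2 : Relation.TransGen
          (fun x y => ∃ a, (x, a) ∈ C.B ∪ D.B ∧ y ∈ (M.δ x a).support) s y := by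
        rcases hy with hy | hy
        · exact mono Set.subset_union_left (C.isEC.connected s hC y hy)
        · exact mono Set.subset_union_right (D.isEC.connected s hD y hy)
      exact h1.trans h2
  have hU : C.T ∪ D.T ⊆ U := Set.union_subset C.subset D.subset
  have h1 := C.maximal _ _ key hU Set.subset_union_left Set.subset_union_left
  have h2 := D.maximal _ _ key hU Set.subset_union_right Set.subset_union_right
  exact MEC.ext (h1.1.symm.trans h2.1) (h1.2.symm.trans h2.2)

end MDP

/-! ## Weighted reachability objectives -/

/-- A weighted reachability objective: absorbing target states `F` with nonzero rational rewards.
Only the values of `r` on `F` matter. -/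
structure WRObjective {S : Type u} {A : Type v} (M : MDP S A) where
  F : Set S
  r : S → ℚ
  absorbing : ∀ s ∈ F, ∀ a ∈ M.avail s, M.δ s a s = 1
  reward_ne_zero : ∀ s ∈ F, r s ≠ 0

namespace WRObjective

variable {S : Type u} {A : Type v} {M : MDP S A}

open Classical in
/-- The value of a path: the reward of the first visited target, or `0` if there is none. -/
noncomputable def payoff (Φ : WRObjective M) (ρ : ℕ → Step S A) : ℝ :=
  if h : ∃ i, (ρ i).state ∈ Φ.F then (Φ.r (ρ (Nat.find h)).state : ℝ) else 0

/-- The finite set of outcomes: all rewards of targets, and `0`. -/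
noncomputable def outcomes [Finite S] (Φ : WRObjective M) : Finset ℝ :=
  (((Set.toFinite Φ.F).image fun s => (Φ.r s : ℝ)).insert 0).toFinset

end WRObjective

/-! ## Cumulative prospect theory -/

/-- A prospect: a vector of `k` outcomes and a vector of `k` probabilities. -/
structure Prospect where
  k : ℕ
  o : Fin k → ℝ
  p : Fin k → ℝ

/-- A utility function and two probability weighting functions on `[0, 1]`. -/
structure CPTParams where
  util : ℝ → ℝ
  wPos : ℝ → ℝ
  wNeg : ℝ → ℝ
  util_mono : Monotone util
  util_cont : Continuous util
  wPos_mapsTo : Set.MapsTo wPos (Set.Icc 0 1) (Set.Icc 0 1)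
  wPos_mono : MonotoneOn wPos (Set.Icc 0 1)
  wPos_cont : ContinuousOn wPos (Set.Icc 0 1)
  wNeg_mapsTo : Set.MapsTo wNeg (Set.Icc 0 1) (Set.Icc 0 1)
  wNeg_mono : MonotoneOn wNeg (Set.Icc 0 1)
  wNeg_cont : ContinuousOn wNeg (Set.Icc 0 1)

namespace Prospect

/-- The probability of an outcome above the `i`-th one (outcomes are ordered increasingly). -/
noncomputable def gainRank (x : Prospect) (i : Fin x.k) : ℝ := ∑ m ∈ Finset.Ioi i, x.p m

/-- The probability of an outcome below the `i`-th one (outcomes are ordered increasingly). -/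
noncomputable def lossRank (x : Prospect) (i : Fin x.k) : ℝ := ∑ m ∈ Finset.Iio i, x.p m

/-- The decision weight of the `i`-th outcome. -/
noncomputable def decisionWeight (c : CPTParams) (x : Prospect) (i : Fin x.k) : ℝ :=
  if 0 < x.o i then c.wPos (x.p i + x.gainRank i) - c.wPos (x.gainRank i)
  else if x.o i < 0 then c.wNeg (x.p i + x.lossRank i) - c.wNeg (x.lossRank i)
  else 0

/-- The CPT-function. -/
noncomputable def cpt (c : CPTParams) (x : Prospect) : ℝ :=
  ∑ i, c.util (x.o i) * decisionWeight c x i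

end Prospect

namespace MDP

variable {S : Type u} {A : Type v} [Finite S] [Finite A]

/-- The prospect induced by the strategy `σ`: the increasing vector of all outcomes, each with the
probability of obtaining it. -/
noncomputable def prospect (M : MDP S A) (Φ : WRObjective M) (σ : Strategy M) : Prospect where
  k := Φ.outcomes.card
  o := Φ.outcomes.orderEmbOfFin rfl
  p := fun i => (M.pathMeasure σ).real {ρ | Φ.payoff ρ = Φ.outcomes.orderEmbOfFin rfl i}

/-- The CPT-value: the supremum over all strategies of the CPT-value of the distribution of `Φ`,
written out with cumulative probabilities. -/
noncomputable def cptVal (M : MDP S A) (Φ : WRObjective M) (c : CPTParams) : EReal :=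
  ⨆ σ : Strategy M,
    (((∑ o ∈ Φ.outcomes with 0 < o, c.util o *
        (c.wPos ((M.pathMeasure σ).real {ρ | o ≤ Φ.payoff ρ}) -
          c.wPos ((M.pathMeasure σ).real {ρ | o < Φ.payoff ρ}))) +
      ∑ o ∈ Φ.outcomes with o < 0, c.util o *
        (c.wNeg ((M.pathMeasure σ).real {ρ | Φ.payoff ρ ≤ o}) -
          c.wNeg ((M.pathMeasure σ).real {ρ | Φ.payoff ρ < o})) : ℝ) : EReal)

/-- The CPT-value: the supremum over all strategies of the CPT-function of the induced prospect. -/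
noncomputable def cptValProspect (M : MDP S A) (Φ : WRObjective M) (c : CPTParams) : EReal :=
  ⨆ σ : Strategy M, ((Prospect.cpt c (M.prospect Φ σ) : ℝ) : EReal)

/-- `M` is stopping with sink `z`: the state `z` is absorbing and not a target (so that its reward
is zero), and under every strategy a target or `z` is reached almost surely. -/
structure IsStopping (M : MDP S A) (Φ : WRObjective M) (z : S) : Prop where
  sink_not_target : z ∉ Φ.F
  sink_absorbing : ∀ a ∈ M.avail z, M.δ z a z = 1
  reaches : ∀ σ : Strategy M, M.pathMeasure σ {ρ | ∃ i, (ρ i).state ∈ Φ.F ∪ {z}} = 1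

end MDP

/-! ## The MEC quotient -/

/-- The states of the MEC quotient: the states outside of all maximal end components within `U`,
one state for each of these components, and the sink. -/
inductive QState {S : Type u} {A : Type v} (M : MDP S A) (U : Set S) : Type (max u v)
  | orig (s : S) (hs : ∀ C : M.MEC U, s ∉ C.T)
  | collapsed (C : M.MEC U)
  | sink

instance {S : Type u} {A : Type v} [Finite S] [Finite A] (M : MDP S A) (U : Set S) :
    Finite (QState M U) :=
  Finite.of_injective
    (fun q : QState M U => (match q with
      | .orig s _ => some (Sum.inl s)
      | .collapsed C => some (Sum.inr C)
      | .sink => none : Option (S ⊕ M.MEC U)))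
    (by
      intro q q' h
      cases q <;> cases q' <;> simp_all)

/-- The actions of the MEC quotient: the original actions, made unique by pairing them with their
state, and the action `stay`. -/
abbrev QAction (S : Type u) (A : Type v) : Type (max u v) := Option (S × A)

/-- The action `stay`. -/
abbrev QAction.stay {S : Type u} {A : Type v} : QAction S A := none

namespace MDP

variable {S : Type u} {A : Type v}

open Classical in
/-- The state of the quotient that represents the state `s`. -/
noncomputable def proj (M : MDP S A) (U : Set S) (s : S) : QState M U :=
  if h : ∃ C : M.MEC U, s ∈ C.T then .collapsed h.choose
  else .orig s fun C hC => h ⟨C, hC⟩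

theorem proj_eq_collapsed_iff (M : MDP S A) (U : Set S) (s : S) (C : M.MEC U) :
    M.proj U s = .collapsed C ↔ s ∈ C.T := by
  unfold proj
  split_ifs with h
  · constructor
    · intro e
      have e' : h.choose = C := by simpa using e
      exact e' ▸ h.choose_spec
    · intro hs
      rw [MEC.eq_of_mem h.choose C h.choose_spec hs]
  · constructor
    · intro e
      cases e
    · intro hs
      exact (h ⟨C, hs⟩).elim

theorem proj_of_notMem (M : MDP S A) (U : Set S) (s : S) (hs : ∀ C : M.MEC U, s ∉ C.T) :
    M.proj U s = .orig s hs := by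
  unfold proj
  rw [dif_neg]
  rintro ⟨C, hC⟩
  exact hs C hC

/-- The MEC quotient with respect to the maximal end components within `U`. An original action
leads from the representative of its state to the representatives of its successors, with the
probabilities of successors in one component added up; `stay` leads to the sink. -/
noncomputable def mecQuotient (M : MDP S A) (U : Set S) : MDP (QState M U) (QAction S A) where
  init := M.proj U M.init
  avail := fun
    | .orig s _ => {x | ∃ a ∈ M.avail s, x = some (s, a)}
    | .collapsed C => {x | ∃ s ∈ C.T, ∃ a ∈ M.avail s, (s, a) ∉ C.B ∧ x = some (s, a)} ∪
        {QAction.stay}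
    | .sink => {QAction.stay}
  avail_nonempty := fun
    | .orig s _ => let ⟨a, ha⟩ := M.avail_nonempty s; ⟨some (s, a), a, ha, rfl⟩
    | .collapsed _ => ⟨QAction.stay, Or.inr rfl⟩
    | .sink => ⟨QAction.stay, rfl⟩
  δ := fun _ x => match x with
    | some (s, a) => (M.δ s a).map (M.proj U)
    | none => PMF.pure .sink

end MDP

/-- The objective on the MEC quotient (of the components without targets): the targets and their
rewards are unchanged. -/
def WRObjective.quotient {S : Type u} {A : Type v} {M : MDP S A} (Φ : WRObjective M) :
    WRObjective (M.mecQuotient Φ.Fᶜ) where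
  F := {q | ∃ s hs, q = .orig s hs ∧ s ∈ Φ.F}
  r := fun
    | .orig s _ => Φ.r s
    | .collapsed _ => 0
    | .sink => 0
  absorbing := by
    rintro q ⟨s, hs, rfl, hF⟩ x ⟨a, ha, rfl⟩
    have h1 : M.δ s a = PMF.pure s := by
      have h := (PMF.apply_eq_one_iff _ _).1 (Φ.absorbing s hF a ha)
      ext t
      by_cases ht : t = s
      · subst ht
        simp [Φ.absorbing t hF a ha]
      · have : t ∉ (M.δ s a).support := by simp [h, ht]
        simpa [PMF.mem_support_iff, ht] using this
    show ((M.δ s a).map (M.proj Φ.Fᶜ)) _ = 1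
    rw [h1, PMF.pure_map, M.proj_of_notMem _ s hs]
    simp
  reward_ne_zero := by
    rintro q ⟨s, hs, rfl, hF⟩
    exact Φ.reward_ne_zero s hF

/-! ## Polynomial time

Data are binary trees whose leaves are natural numbers in binary. Programs are built from basic
operations on trees and numbers by pairing, composition, branching and unbounded loops. The cost is
logarithmic (bit) cost: each basic operation costs at least the total bit size of its input and its
output, so that, up to polynomials, the cost of a run is the running time of a Turing machine. -/

/-- Binary trees with natural numbers at the leaves. -/
inductive Data : Type
  | num (n : ℕ)
  | pair (a b : Data)

namespace Data

/-- The size of data, where a number counts by the length of its binary expansion. -/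
def size : Data → ℕ
  | num n => n.size + 1
  | pair a b => a.size + b.size + 1

/-- The list with the given entries, as nested pairs ended by the number `0`. -/
def list : List Data → Data
  | [] => num 0
  | a :: l => pair a (list l)

/-- An integer, as its sign and its absolute value. -/
def ofInt (k : ℤ) : Data := pair (num (if k < 0 then 1 else 0)) (num k.natAbs)

/-- A rational number, as numerator and denominator. -/
def ofRat (q : ℚ) : Data := pair (ofInt q.num) (num q.den)

end Data

/-- The basic operations. Subtraction is truncated and division is rounded down. -/
inductive Op : Type
  | id
  | const (n : ℕ)
  | fst
  | snd
  | add
  | sub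
  | mul
  | div

/-- The result of a basic operation; it is the number `0` if the input has the wrong form. -/
def Op.apply : Op → Data → Data
  | .id, x => x
  | .const n, _ => .num n
  | .fst, .pair a _ => a
  | .snd, .pair _ b => b
  | .add, .pair (.num m) (.num n) => .num (m + n)
  | .sub, .pair (.num m) (.num n) => .num (m - n)
  | .mul, .pair (.num m) (.num n) => .num (m * n)
  | .div, .pair (.num m) (.num n) => .num (m / n)
  | _, _ => .num 0

/-- Programs. -/
inductive Prog : Type
  | op (f : Op)
  | pair (p q : Prog)
  | comp (p q : Prog)
  | ite (c p q : Prog)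
  | loop (c p : Prog)

/-- `p.Runs x y t`: on input `x`, the program `p` halts with output `y` at cost `t`.
`comp p q` first runs `p`, then `q` on its output; `ite c p q` runs `q` if the output of `c` is the
number `0`, and `p` otherwise; `loop c p` repeats `p` until the output of `c` is the number `0`. -/
inductive Prog.Runs : Prog → Data → Data → ℕ → Prop
  | op (f : Op) (x : Data) : Runs (.op f) x (f.apply x) (x.size + (f.apply x).size + 1)
  | pair {p q : Prog} {x y z : Data} {t t' : ℕ} :
      Runs p x y t → Runs q x z t' → Runs (.pair p q) x (.pair y z) (t + t' + 1)
  | comp {p q : Prog} {x y z : Data} {t t' : ℕ} :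
      Runs p x y t → Runs q y z t' → Runs (.comp p q) x z (t + t' + 1)
  | ite_true {c p q : Prog} {x b y : Data} {t t' : ℕ} :
      Runs c x b t → b ≠ .num 0 → Runs p x y t' → Runs (.ite c p q) x y (t + t' + 1)
  | ite_false {c p q : Prog} {x y : Data} {t t' : ℕ} :
      Runs c x (.num 0) t → Runs q x y t' → Runs (.ite c p q) x y (t + t' + 1)
  | loop_done {c p : Prog} {x : Data} {t : ℕ} :
      Runs c x (.num 0) t → Runs (.loop c p) x x (t + 1)
  | loop_step {c p : Prog} {x b y z : Data} {t t' t'' : ℕ} :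
      Runs c x b t → b ≠ .num 0 → Runs p x y t' → Runs (.loop c p) y z t'' →
      Runs (.loop c p) x z (t + t' + t'' + 1)

/-! ## Encodings of rational Markov decision processes -/

section Encoding

variable {S : Type u} {A : Type v} {n m : ℕ}

open Classical in
/-- The explicit encoding of an MDP and an objective, for an enumeration `eS` of the states, an
enumeration `eA` of the actions, and fractions `frac` for the transition probabilities: the number
of states, the number of actions, the initial state, for each state and each action the list of the
transition probabilities as (numerator, denominator) (or `0`, if the action is not available), and
for each state its reward (or `0`, if it is not a target). -/
noncomputable def encode (eS : S ≃ Fin n) (eA : A ≃ Fin m) (M : MDP S A) (Φ : WRObjective M)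
    (frac : S → A → S → ℕ × ℕ) : Data :=
  .list [.num n, .num m, .num (eS M.init),
    .list (List.ofFn fun i : Fin n => .list (List.ofFn fun j : Fin m =>
      if eA.symm j ∈ M.avail (eS.symm i) then
        .list (List.ofFn fun k : Fin n =>
          let f := frac (eS.symm i) (eA.symm j) (eS.symm k)
          .pair (.num f.1) (.num f.2))
      else .num 0)),
    .list (List.ofFn fun i : Fin n =>
      if eS.symm i ∈ Φ.F then Data.ofRat (Φ.r (eS.symm i)) else .num 0)]

/-- `d` encodes `(M, Φ)`. The transition probabilities are rational numbers, given by fractions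
(not necessarily in lowest terms). -/
def IsEncoding (eS : S ≃ Fin n) (eA : A ≃ Fin m) (M : MDP S A) (Φ : WRObjective M) (d : Data) :
    Prop :=
  ∃ frac : S → A → S → ℕ × ℕ,
    (∀ s, ∀ a ∈ M.avail s, ∀ t, 0 < (frac s a t).2 ∧
      (M.δ s a t).toReal = ((frac s a t).1 : ℝ) / ((frac s a t).2 : ℝ)) ∧
    d = encode eS eA M Φ frac

end Encoding

end CPTMDP

open CPTMDP

/-! The law of the payoff is determined by the limit masses of the targets. No strategy is
translated history by history; instead both MDPs are shown to achieve the same vectors of target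
masses, described by one linear system.

Strategies are replaced by flows, that is, sequences of step distributions that obey the transition
probabilities. Every strategy yields a flow, and every flow comes from a strategy that looks only at
the time and the current state (`isFlow_marginal`, `IsFlow.exists_strategy`). The mass in an
absorbing set converges to the probability of reaching it (`tendsto_mass`).

The quotient has no trap: a minimal set of its states that can be kept forever while avoiding the
targets and the sink would pull back to an end component of the MDP that uses an action outside of
all maximal ones (`mecQuotient_no_trap`). By finiteness there is then a potential that drops by a
fixed amount in expectation with every action taken before a target or the sink
(`exists_potential`). Hence the quotient is stopping. Pulled back to the MDP, the potential drops at
the exits, the actions of non-targets that lie in no maximal end component, so exits are taken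
finitely often in expectation.

The link between the two sides is the vector `X` of expected exit counts. The limit mass of a class
is its initial mass plus its net inflow through exits. This number is zero for a non-target outside
of the components and nonnegative for a component, which is what `IsExitFlow` demands. Flows on
either side produce such an `X` with the right target masses.

Conversely, `X` is realized on both sides by `Potential.exists_flow`. In the quotient, the balance
of a component is the expected number of uses of `stay`. In the MDP, mass enters and leaves a
component at different states. The component is irreducible under the uniform policy on its own
actions, so a circulation routes the mass (`exists_circulation`); the balance is stopped at a root
and then stays in the component forever. Prescribed counts become action probabilities by
normalization. The visits that result are the minimal solution of the balance equations and may be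
fewer than prescribed, but they agree wherever the potential drops (`hasSum_visits`), and this
decides the target masses.

The algorithm repeatedly removes pairs with a successor from which the pair's state can no longer be
reached. What survives are the pairs of the maximal end components, and reachability by them is
equality of classes (`mem_prune_iterate`, `reach_prune_iterate`). Polynomial cost follows from
closure properties of polynomial-time functions, mainly from folds whose accumulators stay
polynomially small (`foldl_of_prefix`). -/

namespace CPTMDP

universe u v

set_option linter.unusedSectionVars false

/-! ## Step distributions of the path measure -/

namespace MDP

/-- The transition probability as a real number. -/
noncomputable def pr {S : Type u} {A : Type v} (M : MDP S A) (s : S) (a : A) (t : S) : ℝ :=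
  (M.δ s a t).toReal

section Pr

variable {S : Type u} {A : Type v} (M : MDP S A)

theorem pr_nonneg (s : S) (a : A) (t : S) : 0 ≤ M.pr s a t := ENNReal.toReal_nonneg

theorem pr_pos_iff (s : S) (a : A) (t : S) : 0 < M.pr s a t ↔ t ∈ (M.δ s a).support := by
  rw [pr, ENNReal.toReal_pos_iff, PMF.mem_support_iff, pos_iff_ne_zero]
  exact and_iff_left ((PMF.apply_lt_top _ _))

theorem pr_eq_zero_iff (s : S) (a : A) (t : S) : M.pr s a t = 0 ↔ t ∉ (M.δ s a).support := by
  rw [← pr_pos_iff, not_lt]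
  exact ⟨fun h => h.le, fun h => le_antisymm h (M.pr_nonneg s a t)⟩

end Pr

end MDP

theorem sum_toReal_pmf {X : Type*} [Fintype X] (p : PMF X) : ∑ t, (p t).toReal = 1 := by
  rw [← ENNReal.toReal_sum fun t _ => PMF.apply_ne_top p t, ← tsum_fintype (L := .unconditional X),
    p.tsum_coe, ENNReal.toReal_one]

namespace MDP

variable {S : Type u} {A : Type v} [Fintype S] [Fintype A] (M : MDP S A) (σ : Strategy M)

theorem sum_pr (s : S) (a : A) : ∑ t, M.pr s a t = 1 := sum_toReal_pmf _

instance : IsProbabilityMeasure (M.firstStep σ) := PMF.toMeasure.isProbabilityMeasure _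

instance : IsProbabilityMeasure (M.pathMeasure σ) := by
  unfold pathMeasure
  infer_instance

theorem nextStep_apply (h : List (Step S A)) (x : Step S A) (s : S) (a : A) :
    (M.nextStep σ h x ⟨s, a⟩).toReal = M.pr x.state x.act s * (σ.choose h s a).toReal := by
  classical
  rw [nextStep, PMF.bind_apply, tsum_eq_single s, ENNReal.toReal_mul, PMF.map_apply,
    tsum_eq_single a]
  · simp [pr]
  · intro b hb
    simp [Ne.symm hb]
  · intro t ht
    simp [PMF.map_apply, Ne.symm ht]

theorem map_firstStep_apply (s : S) (a : A) [Decidable (s = M.init)] :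
    (M.firstStep σ).real {⟨s, a⟩} = if s = M.init then (σ.choose [] s a).toReal else 0 := by
  classical
  rw [measureReal_def, firstStep, PMF.toMeasure_apply_singleton _ _ (MeasurableSet.of_discrete), PMF.map_apply]
  split_ifs with h
  · subst h
    rw [tsum_eq_single a]
    · simp
    · intro b hb
      simp [Ne.symm hb]
  · simp [h]

theorem pathMeasure_map_zero : (M.pathMeasure σ).map (fun ρ => ρ 0) = M.firstStep σ := by
  have e : (fun ρ : ℕ → Step S A => ρ 0) =
      (MeasurableEquiv.piUnique fun _ : Finset.Iic 0 => Step S A) ∘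
        (Preorder.frestrictLe (π := fun _ : ℕ => Step S A) 0) := by
    funext ρ
    rfl
  have hu : Measurable (MeasurableEquiv.piUnique fun _ : Finset.Iic 0 => Step S A) :=
    MeasurableEquiv.measurable _
  rw [e, ← Measure.map_map hu (by fun_prop), pathMeasure, Kernel.trajMeasure,
    Measure.map_comp _ _ (by fun_prop), Kernel.traj_map_frestrictLe]
  rw [Kernel.partialTraj_self, Measure.id_comp]
  rw [Measure.map_map hu (by fun_prop)]
  convert Measure.map_id
  ext x <;> rfl

/-- The Markov property for the pair of the steps at times `n` and `n + 1`, if the law of the next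
step depends only on the current step. -/
theorem pathMeasure_two_steps (n : ℕ) (y : Step S A) (V : Set (Step S A)) (c : ℝ)
    (hc : ∀ h : List (Step S A), h.length = n + 1 → ((M.nextStep σ h y).toMeasure).real V = c) :
    (M.pathMeasure σ).real {ρ | ρ n = y ∧ ρ (n + 1) ∈ V} =
      (M.pathMeasure σ).real {ρ | ρ n = y} * c := by
  classical
  have key := Kernel.map_frestrictLe_trajMeasure_compProd_eq_map_trajMeasure
    (X := fun _ => Step S A) (μ₀ := M.firstStep σ) (κ := M.stepKernel σ) (a := n)
  have h1 := congrArg (fun m => m ({h | h ⟨n, Finset.mem_Iic.2 le_rfl⟩ = y} ×ˢ V)) key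
  have hV : MeasurableSet V := trivial
  have hY : MeasurableSet {h : (i : Finset.Iic n) → Step S A |
      h ⟨n, Finset.mem_Iic.2 le_rfl⟩ = y} :=
    (measurable_pi_apply (X := fun _ : Finset.Iic n => Step S A) _)
      (show MeasurableSet ({y} : Set (Step S A)) from trivial)
  beta_reduce at h1
  rw [Measure.compProd_apply_prod hY hV, Measure.map_apply (by fun_prop) (hY.prod hV)] at h1
  have h2 : ∀ h ∈ {h : (i : Finset.Iic n) → Step S A | h ⟨n, Finset.mem_Iic.2 le_rfl⟩ = y},
      M.stepKernel σ n h V = ENNReal.ofReal c := by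
    intro h hh
    rw [← hc (List.ofFn fun i : Fin (n + 1) => h ⟨i, Finset.mem_Iic.2 (by omega)⟩) (by simp),
      ofReal_measureReal, ← show h ⟨n, Finset.mem_Iic.2 le_rfl⟩ = y from hh]
    rfl
  rw [setLIntegral_congr_fun hY h2, setLIntegral_const, Measure.map_apply (by fun_prop) hY] at h1
  -- Any history of length `n + 1` exhibits `c` as a probability; a constant one is at hand.
  have hc0 : 0 ≤ c := by
    rw [← hc (List.replicate (n + 1) y) (by simp)]
    exact measureReal_nonneg
  have h3 := congrArg ENNReal.toReal h1
  rw [ENNReal.toReal_mul, ENNReal.toReal_ofReal hc0] at h3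
  rw [mul_comm]
  exact h3.symm

end MDP

theorem measureReal_eq_sum_fiber {Ω X : Type*} [MeasurableSpace Ω] [Fintype X] (μ : Measure Ω)
    [IsFiniteMeasure μ] (f : Ω → X) (hf : ∀ x, MeasurableSet {ω | f ω = x}) {E : Set Ω}
    (hE : MeasurableSet E) : μ.real E = ∑ x, μ.real {ω | f ω = x ∧ ω ∈ E} := by
  have h : E = ⋃ x ∈ (Finset.univ : Finset X), {ω | f ω = x ∧ ω ∈ E} := by
    ext ω
    simp
  conv_lhs => rw [h]
  refine measureReal_biUnion_finset ?_ fun x _ => (hf x).inter hE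
  intro x _ y _ hxy
  refine Set.disjoint_left.2 ?_
  rintro ω ⟨h1, _⟩ ⟨h2, _⟩
  exact hxy (h1.symm.trans h2)

theorem pmf_toMeasure_real {X : Type*} [Fintype X] [MeasurableSpace X] [DiscreteMeasurableSpace X]
    (p : PMF X) (V : Set X) [DecidablePred (· ∈ V)] :
    p.toMeasure.real V = ∑ x, if x ∈ V then (p x).toReal else 0 := by
  rw [measureReal_eq_sum_fiber p.toMeasure id (fun _ => MeasurableSet.of_discrete)
    (MeasurableSet.of_discrete (s := V))]
  refine Finset.sum_congr rfl fun x _ => ?_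
  split_ifs with h
  · have : {ω | id ω = x ∧ ω ∈ V} = {x} := by
      ext ω
      constructor
      · exact fun h => h.1
      · rintro rfl
        exact ⟨rfl, h⟩
    rw [this, measureReal_def, PMF.toMeasure_apply_singleton _ _ (MeasurableSet.of_discrete)]
  · have : {ω | id ω = x ∧ ω ∈ V} = ∅ := by
      ext ω
      simp only [id, Set.mem_ofPred_eq, Set.mem_empty_iff_false, iff_false, not_and]
      rintro rfl
      exact h
    rw [this, measureReal_empty]

theorem sum_step {S : Type*} {A : Type*} [Fintype S] [Fintype A] [Fintype (Step S A)]
    (f : Step S A → ℝ) : ∑ y, f y = ∑ s, ∑ a, f ⟨s, a⟩ := by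
  rw [← Fintype.sum_prod_type']
  exact Fintype.sum_equiv ⟨fun y => (y.state, y.act), fun p => ⟨p.1, p.2⟩, fun _ => rfl,
    fun _ => rfl⟩ _ _ fun _ => rfl

/-! ### Flows: the step distributions of strategies -/

namespace MDP

variable {S : Type u} {A : Type v} [Fintype S] [Fintype A]

/-- A sequence of distributions of steps that obeys the transition probabilities. -/
structure IsFlow (M : MDP S A) (x : ℕ → S → A → ℝ) : Prop where
  nonneg : ∀ n s a, 0 ≤ x n s a
  avail : ∀ n s a, a ∉ M.avail s → x n s a = 0
  zero : ∀ s, s ≠ M.init → ∑ a, x 0 s a = 0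
  init : ∑ a, x 0 M.init a = 1
  succ : ∀ n s, ∑ a, x (n + 1) s a = ∑ t, ∑ b, x n t b * M.pr t b s

/-- The probability of the step `(s, a)` at time `n`. -/
noncomputable def marginal (M : MDP S A) (σ : Strategy M) (n : ℕ) (s : S) (a : A) : ℝ :=
  (M.pathMeasure σ).real {ρ | ρ n = ⟨s, a⟩}

variable (M : MDP S A) (σ : Strategy M)

theorem measurableSet_step (n : ℕ) (V : Set (Step S A)) :
    MeasurableSet {ρ : ℕ → Step S A | ρ n ∈ V} :=
  (measurable_pi_apply (X := fun _ : ℕ => Step S A) n) (show MeasurableSet V from trivial)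

theorem sum_marginal (n : ℕ) (s : S) :
    ∑ a, M.marginal σ n s a = (M.pathMeasure σ).real {ρ | (ρ n).state = s} := by
  classical
  refine Eq.trans ?_ (measureReal_eq_sum_fiber (M.pathMeasure σ) (fun ρ => (ρ n).act)
    (fun a => measurableSet_step n {y | y.act = a})
    (E := {ρ | (ρ n).state = s}) (measurableSet_step n {y | y.state = s})).symm
  refine Finset.sum_congr rfl fun a _ => ?_
  unfold marginal
  congr 1
  ext ρ
  simp only [Set.mem_ofPred_eq, Step.ext_iff]
  exact and_comm

theorem choose_eq_zero {h : List (Step S A)} {s : S} {a : A} (ha : a ∉ M.avail s) :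
    (σ.choose h s a).toReal = 0 := by
  have : a ∉ (σ.choose h s).support := fun h' => ha (σ.support_subset h s h')
  rw [PMF.mem_support_iff, not_not] at this
  rw [this, ENNReal.toReal_zero]

theorem marginal_zero (s : S) (a : A) [Decidable (s = M.init)] :
    M.marginal σ 0 s a = if s = M.init then (σ.choose [] s a).toReal else 0 := by
  rw [← map_firstStep_apply, ← pathMeasure_map_zero, measureReal_def, Measure.map_apply
    (measurable_pi_apply (X := fun _ : ℕ => Step S A) 0) trivial]
  rfl

/-- A sum over the current step computes the probability of an event of the next step. -/
theorem pathMeasure_next (n : ℕ) (V : Set (Step S A)) (c : S → A → ℝ)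
    (hc : ∀ h : List (Step S A), h.length = n + 1 → ∀ t b,
      ((M.nextStep σ h ⟨t, b⟩).toMeasure).real V = c t b) :
    (M.pathMeasure σ).real {ρ | ρ (n + 1) ∈ V} = ∑ t, ∑ b, M.marginal σ n t b * c t b := by
  classical
  have : Fintype (Step S A) := Fintype.ofFinite _
  rw [measureReal_eq_sum_fiber (M.pathMeasure σ) (fun ρ => ρ n)
    (fun a => measurableSet_step n {a}) (measurableSet_step (n + 1) V), sum_step]
  refine Finset.sum_congr rfl fun t _ => Finset.sum_congr rfl fun b _ => ?_
  exact M.pathMeasure_two_steps σ n ⟨t, b⟩ V (c t b) fun h hh => hc h hh t b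

theorem nextStep_state (h : List (Step S A)) (y : Step S A) (s : S) :
    ((M.nextStep σ h y).toMeasure).real {x | x.state = s} = M.pr y.state y.act s := by
  classical
  have : Fintype (Step S A) := Fintype.ofFinite _
  rw [pmf_toMeasure_real, sum_step, Finset.sum_eq_single s]
  · simp only [Set.mem_ofPred_eq, if_true, nextStep_apply, ← Finset.mul_sum, sum_toReal_pmf,
      mul_one]
  · intro t _ ht
    simp [ht]
  · simp

theorem isFlow_marginal : M.IsFlow (M.marginal σ) where
  nonneg n s a := measureReal_nonneg
  avail n s a ha := by
    classical
    cases n with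
    | zero => simp [marginal_zero, M.choose_eq_zero σ ha]
    | succ n =>
      have := M.pathMeasure_next σ n {⟨s, a⟩} (fun _ _ => 0) (by
        intro h _ t b
        rw [measureReal_def, PMF.toMeasure_apply_singleton _ _ (MeasurableSet.of_discrete),
          nextStep_apply, M.choose_eq_zero σ ha, mul_zero])
      simp only [mul_zero, Finset.sum_const_zero] at this
      exact this
  zero s hs := by
    classical
    simp [marginal_zero, hs]
  init := by
    classical
    simp [marginal_zero, sum_toReal_pmf]
  succ n s := by
    rw [sum_marginal]
    exact M.pathMeasure_next σ n {x | x.state = s} _ fun h _ t b => M.nextStep_state σ h _ s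

/-- Every flow is the sequence of the step distributions of a strategy. -/
theorem IsFlow.exists_strategy {M : MDP S A} {x : ℕ → S → A → ℝ} (hx : M.IsFlow x) :
    ∃ σ : Strategy M, M.marginal σ = x := by
  classical
  -- Conditioning on the current state splits the flow into a mass and a distribution of actions. At
  -- states without mass any available action serves.
  have key : ∀ n s, ∃ p : PMF A, p.support ⊆ M.avail s ∧
      ∀ a, x n s a = (∑ b, x n s b) * (p a).toReal := by
    intro n s
    have h0 : 0 ≤ ∑ b, x n s b := Finset.sum_nonneg fun b _ => hx.nonneg n s b
    rcases h0.eq_or_lt with h | h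
    · obtain ⟨a, ha⟩ := M.avail_nonempty s
      refine ⟨PMF.pure a, by simpa using ha, fun b => ?_⟩
      rw [← h, zero_mul]
      exact (Finset.sum_eq_zero_iff_of_nonneg fun b _ => hx.nonneg n s b).1 h.symm b
        (Finset.mem_univ b)
    · refine ⟨PMF.ofFintype (fun a => ENNReal.ofReal (x n s a / ∑ b, x n s b)) ?_, ?_, ?_⟩
      · rw [← ENNReal.ofReal_sum_of_nonneg fun b _ => div_nonneg (hx.nonneg n s b) h0,
          ← Finset.sum_div, div_self h.ne', ENNReal.ofReal_one]
      · intro a ha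
        by_contra hn
        apply ha
        simp [hx.avail n s a hn]
      · intro a
        rw [PMF.ofFintype_apply, ENNReal.toReal_ofReal (div_nonneg (hx.nonneg n s a) h0)]
        field_simp
  choose p hp hpx using key
  -- The history enters only through its length, which is the time.
  let σ : Strategy M := ⟨fun h s => p h.length s, fun h s => hp h.length s⟩
  refine ⟨σ, ?_⟩
  funext n
  induction n with
  | zero =>
    funext s a
    rw [marginal_zero]
    split_ifs with h
    · subst h
      rw [hpx 0 M.init a, hx.init, one_mul]
      rfl
    · rw [hpx 0 s a, hx.zero s h, zero_mul]
  | succ n ih =>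
    funext s a
    have := M.pathMeasure_next σ n {⟨s, a⟩} (fun t b => M.pr t b s * (p (n + 1) s a).toReal) (by
      intro h hh t b
      rw [measureReal_def, PMF.toMeasure_apply_singleton _ _ (MeasurableSet.of_discrete),
        nextStep_apply]
      simp only [σ, hh])
    rw [hpx (n + 1) s a, hx.succ, ← ih, Finset.sum_mul]
    refine this.trans ?_
    simp only [Finset.sum_mul, mul_assoc]

/-! ## Reachability of absorbing states -/

/-- The probability of being in the state `s` at time `n`. -/
noncomputable def mass (x : ℕ → S → A → ℝ) (n : ℕ) (s : S) : ℝ := ∑ a, x n s a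

/-- Absorption is assumed for available actions only. Steps with unavailable actions have
probability zero, and there are countably many times and finitely many steps, so the exceptional
paths form a null set. -/
theorem ae_absorbing (F : Set S) (hF : ∀ s ∈ F, ∀ a ∈ M.avail s, M.δ s a s = 1) :
    ∀ᵐ ρ ∂(M.pathMeasure σ), ∀ n, (ρ n).state ∈ F → (ρ (n + 1)).state = (ρ n).state := by
  classical
  have : Fintype (Step S A) := Fintype.ofFinite _
  rw [ae_all_iff]
  intro n
  have h : ∀ y : Step S A, ∀ᵐ ρ ∂(M.pathMeasure σ),
      ¬ (ρ n = y ∧ (ρ (n + 1)) ∈ {x : Step S A | y.state ∈ F ∧ x.state ≠ y.state}) := by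
    intro y
    rw [ae_iff]
    simp only [not_not]
    rw [← measureReal_eq_zero_iff]
    by_cases hy : y.state ∈ F ∧ y.act ∈ M.avail y.state
    · rw [M.pathMeasure_two_steps σ n y _ 0, mul_zero]
      intro h _
      rw [pmf_toMeasure_real, sum_step]
      refine Finset.sum_eq_zero fun s _ => Finset.sum_eq_zero fun a _ => ?_
      split_ifs with hs
      · have h1 := (PMF.apply_eq_one_iff _ _).1 (hF _ hy.1 _ hy.2)
        rw [nextStep_apply, (M.pr_eq_zero_iff _ _ _).2, zero_mul]
        rw [h1]
        exact hs.2
      · rfl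
    · rw [not_and_or] at hy
      rcases hy with hy | hy
      · simp [hy]
      · have h1 := (M.isFlow_marginal σ).avail n y.state y.act hy
        refine le_antisymm ?_ measureReal_nonneg
        rw [← h1]
        exact measureReal_mono fun ρ hρ => hρ.1
  filter_upwards [ae_all_iff.2 h] with ρ hρ hn
  by_contra hne
  exact hρ (ρ n) ⟨rfl, hn, hne⟩

open Filter Topology in
/-- The probability of reaching a set of absorbing states is the limit of the probabilities of
being in it. -/
theorem tendsto_mass (F : Set S) (hF : ∀ s ∈ F, ∀ a ∈ M.avail s, M.δ s a s = 1)
    [DecidablePred (· ∈ F)] :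
    Tendsto (fun n => ∑ s with s ∈ F, mass (M.marginal σ) n s) atTop
      (𝓝 ((M.pathMeasure σ).real {ρ | ∃ n, (ρ n).state ∈ F})) := by
  have e : {ρ : ℕ → Step S A | ∃ n, (ρ n).state ∈ F} =
      ⋃ n, {ρ : ℕ → Step S A | ∃ i ≤ n, (ρ i).state ∈ F} := by
    ext ρ
    simp only [Set.mem_ofPred_eq, Set.mem_iUnion]
    exact ⟨fun ⟨n, h⟩ => ⟨n, n, le_rfl, h⟩, fun ⟨_, i, _, h⟩ => ⟨i, h⟩⟩
  have h1 : Tendsto (fun n => (M.pathMeasure σ).real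
      {ρ : ℕ → Step S A | ∃ i ≤ n, (ρ i).state ∈ F}) atTop
      (𝓝 ((M.pathMeasure σ).real {ρ | ∃ n, (ρ n).state ∈ F})) := by
    rw [e]
    refine (ENNReal.tendsto_toReal (measure_ne_top _ _)).comp
      (tendsto_measure_iUnion_atTop ?_)
    intro m n hmn ρ ⟨i, hi, h⟩
    exact ⟨i, hi.trans hmn, h⟩
  refine h1.congr fun n => ?_
  -- Almost every path that has visited `F` by time `n` is still there at time `n`.
  have h2 : (M.pathMeasure σ).real {ρ : ℕ → Step S A | ∃ i ≤ n, (ρ i).state ∈ F} =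
      (M.pathMeasure σ).real {ρ : ℕ → Step S A | (ρ n).state ∈ F} := by
    refine measureReal_congr ?_
    filter_upwards [M.ae_absorbing σ F hF] with ρ hρ
    refine propext ⟨?_, fun h => ⟨n, le_rfl, h⟩⟩
    rintro ⟨i, hi, h⟩
    have : ∀ j, (ρ (i + j)).state ∈ F := by
      intro j
      induction j with
      | zero => exact h
      | succ j ih =>
        rw [← add_assoc, hρ _ ih]
        exact ih
    have := this (n - i)
    rwa [Nat.add_sub_cancel' hi] at this
  rw [h2, Finset.sum_filter]
  refine (measureReal_eq_sum_fiber (M.pathMeasure σ) (fun ρ => (ρ n).state)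
    (fun s => measurableSet_step n {y | y.state = s}) (E := {ρ | (ρ n).state ∈ F})
    (measurableSet_step n {y | y.state ∈ F})).trans ?_
  refine Finset.sum_congr rfl fun s _ => ?_
  split_ifs with hs
  · rw [mass, sum_marginal]
    congr 1
    ext ρ
    simp only [Set.mem_ofPred_eq]
    constructor
    · exact fun h => h.1
    · rintro rfl
      exact ⟨rfl, hs⟩
  · have : {ρ : ℕ → Step S A | (ρ n).state = s ∧ ρ ∈ {ρ : ℕ → Step S A | (ρ n).state ∈ F}} = ∅ := by
      ext ρ
      simp only [Set.mem_ofPred_eq, Set.mem_empty_iff_false, iff_false, not_and]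
      rintro rfl
      exact hs
    rw [this, measureReal_empty]

/-- Almost every path remains in the first target it visits, so a later visit to a target with
reward `o` is a visit to the same one. The outcome `0` differs: it means that no target is ever
visited, because rewards are nonzero. -/
theorem exists_payoff_iff {M : MDP S A} (Φ : WRObjective M) (σ : Strategy M) (o : ℝ) (ho : o ≠ 0) :
    ∀ᵐ ρ ∂(M.pathMeasure σ), Φ.payoff ρ = o ↔
      ∃ n, (ρ n).state ∈ {s | s ∈ Φ.F ∧ (Φ.r s : ℝ) = o} := by
  classical
  filter_upwards [M.ae_absorbing σ Φ.F Φ.absorbing] with ρ hρ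
  unfold WRObjective.payoff
  split_ifs with h
  · constructor
    · exact fun e => ⟨Nat.find h, Nat.find_spec h, e⟩
    · rintro ⟨n, hn, hr⟩
      have : ∀ j, (ρ (Nat.find h + j)).state = (ρ (Nat.find h)).state := by
        intro j
        induction j with
        | zero => rfl
        | succ j ih =>
          rw [← add_assoc, hρ _ (by rw [ih]; exact Nat.find_spec h), ih]
      have e := this (n - Nat.find h)
      rw [Nat.add_sub_cancel' (Nat.find_min' h hn)] at e
      rw [← e]
      exact hr
  · constructor
    · exact fun e => (ho e.symm).elim
    · rintro ⟨n, hn, _⟩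
      exact (h ⟨n, hn⟩).elim

theorem payoff_eq_zero_iff {M : MDP S A} (Φ : WRObjective M) (ρ : ℕ → Step S A) :
    Φ.payoff ρ = 0 ↔ ¬ ∃ n, (ρ n).state ∈ Φ.F := by
  classical
  unfold WRObjective.payoff
  split_ifs with h
  · simp only [h, not_true, iff_false]
    exact_mod_cast Φ.reward_ne_zero _ (Nat.find_spec h)
  · simp [h]

theorem measurableSet_reach (F : Set S) :
    MeasurableSet {ρ : ℕ → Step S A | ∃ n, (ρ n).state ∈ F} := by
  rw [Set.ofPred_exists]
  exact MeasurableSet.iUnion fun n => measurableSet_step n {y | y.state ∈ F}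

theorem payoff_mem_outcomes {M : MDP S A} (Φ : WRObjective M) (ρ : ℕ → Step S A) :
    Φ.payoff ρ ∈ Φ.outcomes := by
  classical
  unfold WRObjective.payoff WRObjective.outcomes
  rw [Set.Finite.mem_toFinset]
  split_ifs with h
  · exact Or.inr ⟨_, Nat.find_spec h, rfl⟩
  · exact Or.inl rfl

end MDP

/-! ## Expected visits -/

open Filter Topology

/-- The expected numbers of visits `∑ n, v Pⁿ` are the minimal nonnegative solution of
`y = v + y P`. They agree with every solution `y` in the states in which a potential drops. -/
theorem hasSum_visits {ι : Type*} [Fintype ι] {P : ι → ι → ℝ} (hP : ∀ t s, 0 ≤ P t s)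
    {v y f g : ι → ℝ} (hv : ∀ s, 0 ≤ v s) (hy : ∀ s, 0 ≤ y s)
    (hyP : ∀ s, y s = v s + ∑ t, y t * P t s) (hg : ∀ s, 0 ≤ g s)
    (hf : ∀ t, ∑ s, P t s * f s ≤ f t - g t) {l : ℕ → ι → ℝ} (hl0 : ∀ s, l 0 s = v s)
    (hl : ∀ n s, l (n + 1) s = ∑ t, l n t * P t s) :
    (∀ s, Summable fun n => l n s) ∧ ∀ s, 0 < g s → HasSum (fun n => l n s) (y s) := by
  have hln : ∀ n s, 0 ≤ l n s := by
    intro n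
    induction n with
    | zero => exact fun s => (hv s).trans_eq (hl0 s).symm
    | succ n ih =>
      intro s
      rw [hl]
      exact Finset.sum_nonneg fun t _ => mul_nonneg (ih t) (hP t s)
  have hS : ∀ N s, ∑ n ∈ Finset.range (N + 1), l n s =
      v s + ∑ t, (∑ n ∈ Finset.range N, l n t) * P t s := by
    intro N s
    rw [Finset.sum_range_succ', hl0, add_comm]
    simp only [hl, Finset.sum_mul]
    rw [Finset.sum_comm]
  -- Induction on the horizon: the partial sums satisfy the equation of `y` with the previous
  -- partial sums on the right. This is the minimality of the visit counts.
  have hle : ∀ N s, ∑ n ∈ Finset.range N, l n s ≤ y s := by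
    intro N
    induction N with
    | zero => simpa using hy
    | succ N ih =>
      intro s
      rw [hS, hyP s]
      exact add_le_add le_rfl
        (Finset.sum_le_sum fun t _ => mul_le_mul_of_nonneg_right (ih t) (hP t s))
  have hsum : ∀ s, Summable fun n => l n s := fun s =>
    summable_of_sum_range_le (fun n => hln n s) (fun N => hle N s)
  refine ⟨hsum, ?_⟩
  set y' : ι → ℝ := fun s => ∑' n, l n s with hy'
  have hy'le : ∀ s, y' s ≤ y s := fun s =>
    Real.tsum_le_of_sum_range_le (fun n => hln n s) (fun N => hle N s)
  have ht : ∀ s, Tendsto (fun N => ∑ n ∈ Finset.range N, l n s) atTop (𝓝 (y' s)) :=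
    fun s => (hsum s).hasSum.tendsto_sum_nat
  have hy'P : ∀ s, y' s = v s + ∑ t, y' t * P t s := by
    intro s
    refine tendsto_nhds_unique ((tendsto_add_atTop_iff_nat 1).2 (ht s)) ?_
    simp only [hS]
    exact tendsto_const_nhds.add (tendsto_finsetSum _ fun t _ => (ht t).mul_const _)
  -- The excess of `y` over the minimal solution is an invariant vector of `P`, that is, mass
  -- circulating without a source.
  have hz : ∀ s, y s - y' s = ∑ t, (y t - y' t) * P t s := by
    intro s
    rw [hyP s, hy'P s]
    simp only [sub_mul, Finset.sum_sub_distrib]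
    ring
  -- Pairing the invariant excess with the potential: one application of `P` leaves the pairing
  -- unchanged but loses the excess weighted by `g`. So the excess vanishes where `g` is positive.
  have h1 : ∑ s, (y s - y' s) * f s ≤ ∑ s, (y s - y' s) * (f s - g s) := by
    calc ∑ s, (y s - y' s) * f s = ∑ s, ∑ t, (y t - y' t) * P t s * f s := by
          refine Finset.sum_congr rfl fun s _ => ?_
          rw [hz s, Finset.sum_mul]
      _ = ∑ t, (y t - y' t) * ∑ s, P t s * f s := by
          rw [Finset.sum_comm]
          simp only [Finset.mul_sum, mul_assoc]
      _ ≤ _ := Finset.sum_le_sum fun t _ =>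
          mul_le_mul_of_nonneg_left (hf t) (sub_nonneg.2 (hy'le t))
  have h2 : ∑ s, (y s - y' s) * g s ≤ 0 := by
    simp only [mul_sub, Finset.sum_sub_distrib] at h1 ⊢
    linarith
  have h3 := (Finset.sum_eq_zero_iff_of_nonneg fun s _ =>
    mul_nonneg (sub_nonneg.2 (hy'le s)) (hg s)).1
    (le_antisymm h2 (Finset.sum_nonneg fun s _ => mul_nonneg (sub_nonneg.2 (hy'le s)) (hg s)))
  intro s hs
  have h4 := (mul_eq_zero.1 (h3 s (Finset.mem_univ s))).resolve_right hs.ne'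
  rw [sub_eq_zero.1 h4]
  exact (hsum s).hasSum

/-! ### Potentials and the limits of class masses along a flow -/

namespace MDP

variable {S : Type u} {A : Type v} [Fintype S] [Fintype A]

/-- A potential that vanishes on the absorbing set `K`, does not increase in expectation, and
drops by `η` in expectation for the actions in `E`. -/
structure Potential (M : MDP S A) (K : Set S) (E : S → A → Prop) (f : S → ℝ) (η : ℝ) : Prop where
  pos : 0 < η
  nonneg : ∀ s, 0 ≤ f s
  zero : ∀ s ∈ K, f s = 0
  absorbing : ∀ s ∈ K, ∀ a ∈ M.avail s, M.δ s a s = 1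
  le : ∀ s ∉ K, ∀ a ∈ M.avail s, ∑ t, M.pr s a t * f t ≤ f s
  drop : ∀ s ∉ K, ∀ a ∈ M.avail s, E s a → ∑ t, M.pr s a t * f t ≤ f s - η
  avoid : ∀ s ∉ K, ∀ a ∈ M.avail s, ¬ E s a → ∀ t ∈ K, M.pr s a t = 0

theorem pr_of_absorbing [DecidableEq S] {M : MDP S A} {s : S} {a : A} (h : M.δ s a s = 1) (t : S) :
    M.pr s a t = if t = s then 1 else 0 := by
  split_ifs with hts
  · rw [hts, pr, h, ENNReal.toReal_one]
  · rw [pr_eq_zero_iff, (PMF.apply_eq_one_iff _ _).1 h]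
    exact hts

theorem IsFlow.mass_zero [DecidableEq S] {M : MDP S A} {x : ℕ → S → A → ℝ} (hx : M.IsFlow x)
    (s : S) : mass x 0 s = if s = M.init then 1 else 0 := by
  split_ifs with h
  · rw [h]
    exact hx.init
  · exact hx.zero s h

theorem IsFlow.mass_nonneg {M : MDP S A} {x : ℕ → S → A → ℝ} (hx : M.IsFlow x) (n : ℕ)
    (s : S) : 0 ≤ mass x n s :=
  Finset.sum_nonneg fun a _ => hx.nonneg n s a

theorem IsFlow.sum_mass {M : MDP S A} {x : ℕ → S → A → ℝ} (hx : M.IsFlow x) (n : ℕ) :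
    ∑ s, mass x n s = 1 := by
  classical
  induction n with
  | zero => simp [hx.mass_zero]
  | succ n ih =>
    rw [← ih]
    unfold mass
    simp only [hx.succ]
    rw [Finset.sum_comm]
    refine Finset.sum_congr rfl fun t _ => ?_
    rw [Finset.sum_comm]
    refine Finset.sum_congr rfl fun b _ => ?_
    rw [← Finset.mul_sum, sum_pr, mul_one]

theorem IsFlow.sum_mass_succ_mul {M : MDP S A} {x : ℕ → S → A → ℝ} (hx : M.IsFlow x) (n : ℕ)
    (f : S → ℝ) :
    ∑ s, mass x (n + 1) s * f s = ∑ t, ∑ b, x n t b * ∑ s, M.pr t b s * f s := by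
  simp only [mass, hx.succ, Finset.sum_mul, Finset.mul_sum, mul_assoc]
  rw [Finset.sum_comm]
  exact Finset.sum_congr rfl fun t _ => Finset.sum_comm

/-- The actions for which a potential drops are taken finitely often in expectation. -/
theorem IsFlow.summable {M : MDP S A} {x : ℕ → S → A → ℝ} (hx : M.IsFlow x) {K : Set S}
    {E : S → A → Prop} {f : S → ℝ} {η : ℝ} (hf : M.Potential K E f η) {s : S} (hs : s ∉ K)
    {a : A} (ha : E s a) : Summable fun n => x n s a := by
  classical
  -- Each use of `a` in `s` costs `η` of the expected potential. Since the potential is nonnegative,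
  -- telescoping bounds the expected number of uses by the initial potential divided by `η`.
  have hstep : ∀ n, ∑ s, mass x (n + 1) s * f s ≤ ∑ s, mass x n s * f s - x n s a * η := by
    intro n
    rw [hx.sum_mass_succ_mul]
    have hterm : ∀ t b, x n t b * ∑ s, M.pr t b s * f s ≤
        x n t b * f t - if t = s then (if b = a then x n t b * η else 0) else 0 := by
      intro t b
      by_cases hb : b ∈ M.avail t
      · by_cases ht : t ∈ K
        · rw [if_neg (by rintro rfl; exact hs ht), sub_zero]
          refine mul_le_mul_of_nonneg_left ?_ (hx.nonneg n t b)
          simp [pr_of_absorbing (hf.absorbing t ht b hb)]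
        · split_ifs with h1 h2
          · subst h1 h2
            rw [← mul_sub]
            exact mul_le_mul_of_nonneg_left (hf.drop t ht b hb ha) (hx.nonneg n t b)
          · rw [sub_zero]
            exact mul_le_mul_of_nonneg_left (hf.le t ht b hb) (hx.nonneg n t b)
          · rw [sub_zero]
            exact mul_le_mul_of_nonneg_left (hf.le t ht b hb) (hx.nonneg n t b)
      · simp [hx.avail n t b hb]
    refine (Finset.sum_le_sum fun t _ => Finset.sum_le_sum fun b _ => hterm t b).trans ?_
    simp only [Finset.sum_sub_distrib]
    simp [mass, Finset.sum_mul, Finset.sum_ite_irrel]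
  have hbound : ∀ N, (∑ n ∈ Finset.range N, x n s a) * η + ∑ s, mass x N s * f s ≤
      ∑ s, mass x 0 s * f s := by
    intro N
    induction N with
    | zero => simp
    | succ N ih =>
      rw [Finset.sum_range_succ, add_mul]
      linarith [hstep N]
  refine summable_of_sum_range_le (c := (∑ s, mass x 0 s * f s) / η) (fun n => hx.nonneg n s a)
    fun N => ?_
  rw [le_div_iff₀ hf.pos]
  have : 0 ≤ ∑ s, mass x N s * f s :=
    Finset.sum_nonneg fun s _ => mul_nonneg (hx.mass_nonneg N s) (hf.nonneg s)
  linarith [hbound N]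

/-- The change of the probability of the class `q`, if the action `b` is taken in `t`. -/
noncomputable def drift {Q : Type*} [DecidableEq Q] (M : MDP S A) (κ : S → Q) (t : S) (b : A)
    (q : Q) : ℝ :=
  (∑ s with κ s = q, M.pr t b s) - if κ t = q then 1 else 0

theorem drift_eq_zero {Q : Type*} [DecidableEq Q] {M : MDP S A} {κ : S → Q} {t : S} {b : A}
    (h : ∀ s, M.pr t b s ≠ 0 → κ s = κ t) (q : Q) : M.drift κ t b q = 0 := by
  rw [drift, sub_eq_zero]
  split_ifs with hq
  · rw [← M.sum_pr t b]
    refine Finset.sum_subset (Finset.filter_subset _ _) fun s _ hs => ?_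
    by_contra hne
    exact hs (Finset.mem_filter.2 ⟨Finset.mem_univ s, (h s hne).trans hq⟩)
  · refine Finset.sum_eq_zero fun s hs => ?_
    by_contra hne
    exact hq ((h s hne).symm.trans (Finset.mem_filter.1 hs).2)

/-- The limit probability of a class of states is its initial probability plus the total drift. -/
theorem IsFlow.tendsto_mass {Q : Type*} [DecidableEq Q] {M : MDP S A} {x : ℕ → S → A → ℝ}
    (hx : M.IsFlow x) (κ : S → Q) {E : S → A → Prop} (hE : ∀ s a, E s a → Summable fun n => x n s a)
    (hκ : ∀ t, ∀ b ∈ M.avail t, ¬ E t b → ∀ s, M.pr t b s ≠ 0 → κ s = κ t)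
    {X : S → A → ℝ} (hX : ∀ s a, E s a → X s a = ∑' n, x n s a) (hX0 : ∀ s a, ¬ E s a → X s a = 0)
    (q : Q) :
    Tendsto (fun n => ∑ s with κ s = q, mass x n s) atTop
      (𝓝 ((if κ M.init = q then 1 else 0) + ∑ t, ∑ b, X t b * M.drift κ t b q)) := by
  classical
  -- The class masses telescope into sums of drifts. Only actions in `E` have a drift, and their
  -- counts are summable.
  have hstep : ∀ n, ∑ s with κ s = q, mass x (n + 1) s = ∑ s with κ s = q, mass x n s +
      ∑ t, ∑ b, x n t b * M.drift κ t b q := by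
    intro n
    simp only [drift, mul_sub, Finset.sum_sub_distrib, Finset.mul_sum]
    have h1 : ∑ s with κ s = q, mass x (n + 1) s =
        ∑ t, ∑ b, ∑ s with κ s = q, x n t b * M.pr t b s := by
      simp only [mass, hx.succ]
      rw [Finset.sum_comm]
      exact Finset.sum_congr rfl fun t _ => Finset.sum_comm
    have h2 : ∑ s with κ s = q, mass x n s =
        ∑ t, ∑ b, x n t b * (if κ t = q then 1 else 0) := by
      rw [Finset.sum_filter]
      simp [mass, Finset.sum_ite_irrel]
    rw [h1, h2]
    ring
  have hsum : ∀ N, ∑ s with κ s = q, mass x N s = (if κ M.init = q then 1 else 0) +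
      ∑ t, ∑ b, (∑ n ∈ Finset.range N, x n t b) * M.drift κ t b q := by
    intro N
    induction N with
    | zero =>
      simp only [hx.mass_zero, Finset.sum_filter, Finset.range_zero, Finset.sum_empty, zero_mul,
        Finset.sum_const_zero, add_zero]
      rw [Finset.sum_eq_single M.init]
      · simp
      · intro s _ hs
        simp [hs]
      · simp
    | succ N ih =>
      simp only [hstep, ih, Finset.sum_range_succ, add_mul, Finset.sum_add_distrib]
      ring
  simp only [hsum]
  refine tendsto_const_nhds.add (tendsto_finsetSum _ fun t _ => tendsto_finsetSum _ fun b _ => ?_)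
  by_cases hb : E t b
  · rw [hX t b hb]
    exact (hE t b hb).hasSum.tendsto_sum_nat.mul_const _
  · by_cases hav : b ∈ M.avail t
    · simp [drift_eq_zero (hκ t b hav hb)]
    · simp [hx.avail _ _ _ hav, hX0 t b hb]

end MDP

open Filter Topology

/-! ### Turning balanced action counts into a flow -/

namespace MDP

variable {S : Type u} {A : Type v} [Fintype S] [Fintype A]

/-- Expected action counts `Y` and stopping masses `θ` that are balanced outside of `K` are realized
by a flow. Stopped mass follows the policy `β` and never leaves `Θ`. -/
theorem Potential.exists_flow {M : MDP S A} {K : Set S} {E : S → A → Prop} {f : S → ℝ} {η : ℝ}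
    (hf : M.Potential K E f η) {Y : S → A → ℝ} {θ : S → ℝ} {β : S → A → ℝ} {Θ : Set S}
    (hY : ∀ s a, 0 ≤ Y s a) (hYav : ∀ s, ∀ a ∉ M.avail s, Y s a = 0) (hYK : ∀ s ∈ K, ∀ a, Y s a = 0)
    (hθ : ∀ s, 0 ≤ θ s) (hθΘ : ∀ s ∉ Θ, θ s = 0) (hΘK : ∀ s ∈ Θ, s ∉ K)
    (hβ : ∀ s a, 0 ≤ β s a) (hβav : ∀ s, ∀ a ∉ M.avail s, β s a = 0)
    (hβ1 : ∀ s ∈ Θ, ∑ a, β s a = 1)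
    (hβΘ : ∀ s ∈ Θ, ∀ a, β s a ≠ 0 → ∀ t, M.pr s a t ≠ 0 → t ∈ Θ) [DecidableEq S]
    (hbal : ∀ s ∉ K, ∑ a, Y s a + θ s =
      (if s = M.init then 1 else 0) + ∑ t, ∑ b, Y t b * M.pr t b s) :
    ∃ x, M.IsFlow x ∧ ∀ s ∈ K, Tendsto (fun n => mass x n s) atTop
      (𝓝 ((if s = M.init then 1 else 0) + ∑ t, ∑ b, Y t b * M.pr t b s)) := by
  classical
  set y : S → ℝ := fun s => ∑ a, Y s a + θ s with hy
  have hYs : ∀ s, 0 ≤ ∑ a, Y s a := fun s => Finset.sum_nonneg fun a _ => hY s a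
  have hy0 : ∀ s, 0 ≤ y s := fun s => add_nonneg (hYs s) (hθ s)
  choose a₀ ha₀ using M.avail_nonempty
  -- `y` is the prescribed number of visits, a stop counting as the end of one. On a visit, action
  -- `a` is taken with probability `π s a` and the mass is stopped with probability `θ' s`. Where no
  -- visit is prescribed, a fixed available action is taken.
  set π : S → A → ℝ := fun s a => if y s = 0 then (if a = a₀ s then 1 else 0) else Y s a / y s
    with hπ
  set θ' : S → ℝ := fun s => if y s = 0 then 0 else θ s / y s with hθ'
  have hπ0 : ∀ s a, 0 ≤ π s a := by
    intro s a
    simp only [hπ]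
    split_ifs
    · exact zero_le_one
    · exact le_rfl
    · exact div_nonneg (hY s a) (hy0 s)
  have hθ'0 : ∀ s, 0 ≤ θ' s := by
    intro s
    simp only [hθ']
    split_ifs
    · exact le_rfl
    · exact div_nonneg (hθ s) (hy0 s)
  have hπθ : ∀ s, ∑ a, π s a + θ' s = 1 := by
    intro s
    simp only [hπ, hθ']
    split_ifs with h
    · simp
    · rw [← Finset.sum_div, ← add_div]
      exact div_self h
  have hYz : ∀ s, y s = 0 → (∀ a, Y s a = 0) ∧ θ s = 0 := by
    intro s h
    have h1 : ∑ a, Y s a = 0 := by linarith [hYs s, hθ s, show ∑ a, Y s a + θ s = 0 from h]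
    have h2 : θ s = 0 := by linarith [hYs s, hθ s, show ∑ a, Y s a + θ s = 0 from h]
    exact ⟨fun a => (Finset.sum_eq_zero_iff_of_nonneg fun a _ => hY s a).1 h1 a
      (Finset.mem_univ a), h2⟩
  have hyπ : ∀ s a, y s * π s a = Y s a := by
    intro s a
    simp only [hπ]
    split_ifs with h h'
    · rw [h, (hYz s h).1 a, zero_mul]
    · rw [(hYz s h).1 a, mul_zero]
    · field_simp
  have hπav : ∀ s, ∀ a ∉ M.avail s, π s a = 0 := by
    intro s a ha
    simp only [hπ]
    split_ifs with h h'
    · exact (ha (h' ▸ ha₀ s)).elim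
    · rfl
    · rw [hYav s a ha, zero_div]
  have hθK : ∀ s ∈ K, θ s = 0 := fun s hs => hθΘ s fun h => hΘK s h hs
  have hyK : ∀ s ∈ K, y s = 0 := by
    intro s hs
    simp [hy, hYK s hs, hθK s hs]
  set P : S → S → ℝ := fun t s => ∑ b, π t b * M.pr t b s with hPdef
  have hP0 : ∀ t s, 0 ≤ P t s := fun t s =>
    Finset.sum_nonneg fun b _ => mul_nonneg (hπ0 t b) (M.pr_nonneg t b s)
  -- No visits are prescribed on `K`, so the default available action applies there, and it is
  -- absorbing.
  have hPK : ∀ t ∈ K, ∀ s, P t s = if s = t then 1 else 0 := by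
    intro t ht s
    simp only [hPdef, hπ, hyK t ht, if_true]
    rw [Finset.sum_eq_single (a₀ t)]
    · rw [if_pos rfl, one_mul, pr_of_absorbing (hf.absorbing t ht _ (ha₀ t))]
    · intro b _ hb
      rw [if_neg hb, zero_mul]
    · simp
  -- the mass that has not been stopped
  obtain ⟨l, hl0, hlS⟩ : ∃ l : ℕ → S → ℝ, (∀ s, l 0 s = if s = M.init then 1 else 0) ∧
      ∀ n s, l (n + 1) s = ∑ t, l n t * P t s :=
    ⟨fun n => Nat.rec (fun s => if s = M.init then 1 else 0) (fun _ r s => ∑ t, r t * P t s) n,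
      fun _ => rfl, fun _ _ => rfl⟩
  have hln : ∀ n s, 0 ≤ l n s := by
    intro n
    induction n with
    | zero =>
      intro s
      rw [hl0]
      split_ifs
      · exact zero_le_one
      · exact le_rfl
    | succ n ih =>
      intro s
      rw [hlS]
      exact Finset.sum_nonneg fun t _ => mul_nonneg (ih t) (hP0 t s)
  -- the stopped mass
  obtain ⟨k, hk0, hkS⟩ : ∃ k : ℕ → S → ℝ, (∀ s, k 0 s = 0) ∧
      ∀ n s, k (n + 1) s = ∑ t, ∑ b, (k n t + l n t * θ' t) * β t b * M.pr t b s :=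
    ⟨fun n => Nat.rec (fun _ => 0)
      (fun n r s => ∑ t, ∑ b, (r t + l n t * θ' t) * β t b * M.pr t b s) n,
      fun _ => rfl, fun _ _ => rfl⟩
  have hkn : ∀ n s, 0 ≤ k n s := by
    intro n
    induction n with
    | zero => exact fun s => (hk0 s).ge
    | succ n ih =>
      intro s
      rw [hkS]
      exact Finset.sum_nonneg fun t _ => Finset.sum_nonneg fun b _ =>
        mul_nonneg (mul_nonneg (add_nonneg (ih t) (mul_nonneg (hln n t) (hθ'0 t))) (hβ t b))
          (M.pr_nonneg t b s)
  have hθ'Θ : ∀ s ∉ Θ, θ' s = 0 := by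
    intro s hs
    simp only [hθ', hθΘ s hs, zero_div, ite_self]
  have hkΘ : ∀ n, ∀ s ∉ Θ, k n s = 0 := by
    intro n
    induction n with
    | zero => exact fun s _ => hk0 s
    | succ n ih =>
      intro s hs
      rw [hkS]
      refine Finset.sum_eq_zero fun t _ => Finset.sum_eq_zero fun b _ => ?_
      by_cases ht : t ∈ Θ
      · by_cases hb : β t b = 0
        · simp [hb]
        · have : M.pr t b s = 0 := by
            by_contra hne
            exact hs (hβΘ t ht b hb s hne)
          rw [this, mul_zero]
      · simp [ih t ht, hθ'Θ t ht]
  -- Unstopped mass acts by `π`; mass stopped earlier or right now acts by `β`.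
  set x : ℕ → S → A → ℝ := fun n s a => l n s * π s a + (k n s + l n s * θ' s) * β s a with hx
  have hmass : ∀ n s, mass x n s = l n s + k n s := by
    intro n s
    simp only [mass, hx, Finset.sum_add_distrib, ← Finset.mul_sum]
    by_cases hs : s ∈ Θ
    · rw [hβ1 s hs]
      linear_combination l n s * hπθ s
    · have h1 := hπθ s
      rw [hθ'Θ s hs, add_zero] at h1
      rw [hkΘ n s hs, hθ'Θ s hs, h1]
      ring
  have hflow : M.IsFlow x := by
    refine ⟨?_, ?_, ?_, ?_, ?_⟩
    · exact fun n s a => add_nonneg (mul_nonneg (hln n s) (hπ0 s a))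
        (mul_nonneg (add_nonneg (hkn n s) (mul_nonneg (hln n s) (hθ'0 s))) (hβ s a))
    · intro n s a ha
      simp only [hx, hπav s a ha, hβav s a ha, mul_zero, add_zero]
    · intro s hs
      refine (hmass 0 s).trans ?_
      rw [hl0, hk0, if_neg hs, add_zero]
    · refine (hmass 0 M.init).trans ?_
      rw [hl0, hk0, if_pos rfl, add_zero]
    · intro n s
      refine (hmass (n + 1) s).trans ?_
      rw [hlS, hkS, ← Finset.sum_add_distrib]
      refine Finset.sum_congr rfl fun t _ => ?_
      rw [hPdef, Finset.mul_sum, ← Finset.sum_add_distrib]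
      refine Finset.sum_congr rfl fun b _ => ?_
      simp only [hx]
      ring
  refine ⟨x, hflow, ?_⟩
  -- the expected numbers of visits outside of `K`
  set P' : S → S → ℝ := fun t s => if t ∈ K ∨ s ∈ K then 0 else P t s with hP'
  set l' : ℕ → S → ℝ := fun n s => if s ∈ K then 0 else l n s with hl'
  -- `g t` is the guaranteed expected drop of the potential in `t`. It is positive exactly if `π`
  -- uses some action of `E` in `t`; elsewhere `y` may contain cycles that the flow never enters.
  set g : S → ℝ := fun t => if t ∈ K then 0 else ∑ b, π t b * (if E t b then η else 0) with hg
  have hvis := hasSum_visits (P := P') (v := l' 0) (y := y) (f := f) (g := g) (l := l')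
    (by
      intro t s
      simp only [hP']
      split_ifs
      · exact le_rfl
      · exact hP0 t s)
    (by
      intro s
      simp only [hl']
      split_ifs
      · exact le_rfl
      · exact hln 0 s)
    hy0
    (by
      intro s
      simp only [hl', hP']
      split_ifs with hs
      · simp [hyK s hs, hs]
      · rw [hl0]
        refine (hbal s hs).trans ?_
        congr 1
        refine Finset.sum_congr rfl fun t _ => ?_
        by_cases ht : t ∈ K
        · simp [ht, hYK t ht]
        · simp only [ht, hs, or_self, if_false, hPdef, Finset.mul_sum, ← mul_assoc, hyπ])
    (by
      intro t
      simp only [hg]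
      split_ifs
      · exact le_rfl
      · refine Finset.sum_nonneg fun b _ => mul_nonneg (hπ0 t b) ?_
        split_ifs
        · exact hf.pos.le
        · exact le_rfl)
    (by
      intro t
      simp only [hg, hP']
      by_cases ht : t ∈ K
      · simp [ht, hf.zero t ht]
      · simp only [ht, false_or, if_false]
        have h1 : ∑ s, (if s ∈ K then 0 else P t s) * f s = ∑ b, π t b * ∑ s, M.pr t b s * f s := by
          have h2 : ∀ s, (if s ∈ K then 0 else P t s) * f s = P t s * f s := by
            intro s
            split_ifs with hs
            · simp [hf.zero s hs]
            · rfl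
          simp only [h2]
          simp only [hPdef, Finset.sum_mul, Finset.mul_sum, mul_assoc]
          rw [Finset.sum_comm]
        rw [h1]
        have h3 : ∀ b, π t b * ∑ s, M.pr t b s * f s ≤
            π t b * f t - π t b * (if E t b then η else 0) := by
          intro b
          by_cases hb : b ∈ M.avail t
          · rw [← mul_sub]
            refine mul_le_mul_of_nonneg_left ?_ (hπ0 t b)
            split_ifs with hE
            · exact hf.drop t ht b hb hE
            · rw [sub_zero]
              exact hf.le t ht b hb
          · simp [hπav t b hb]
        refine (Finset.sum_le_sum fun b _ => h3 b).trans ?_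
        rw [Finset.sum_sub_distrib, ← Finset.sum_mul]
        have h4 : ∑ b, π t b ≤ 1 := by linarith [hπθ t, hθ'0 t]
        linarith [mul_le_mul_of_nonneg_right h4 (hf.nonneg t)])
    (fun s => rfl)
    (by
      intro n s
      simp only [hl', hP']
      split_ifs with hs
      · simp [hs]
      · rw [hlS]
        refine Finset.sum_congr rfl fun t _ => ?_
        by_cases ht : t ∈ K
        · rw [hPK t ht, if_neg (by rintro rfl; exact hs ht)]
          simp [ht]
        · simp [ht, hs])
  intro s hs
  have hsΘ : s ∉ Θ := fun h => hΘK s h hs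
  have hm : ∀ n, mass x n s = l n s := fun n => by rw [hmass, hkΘ n s hsΘ, add_zero]
  simp only [hm]
  -- Mass in an absorbing state is its initial mass plus all the inflow so far.
  have hl_eq : ∀ N, l N s = (if s = M.init then 1 else 0) +
      ∑ t, ∑ b, (∑ n ∈ Finset.range N, l' n t * π t b) * M.pr t b s := by
    intro N
    induction N with
    | zero => simp [hl0]
    | succ N ih =>
      have h1 : l (N + 1) s = l N s + ∑ t, ∑ b, l' N t * π t b * M.pr t b s := by
        rw [hlS, ← Finset.sum_erase_add _ _ (Finset.mem_univ s), hPK s hs, if_pos rfl, mul_one,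
          add_comm, ← Finset.sum_erase_add (a := s) Finset.univ (fun t => ∑ b, _)
          (Finset.mem_univ s)]
        congr 1
        rw [show ∑ b, l' N s * π s b * M.pr s b s = 0 from
          Finset.sum_eq_zero fun b _ => by simp [hl', hs], add_zero]
        refine Finset.sum_congr rfl fun t ht => ?_
        by_cases htK : t ∈ K
        · rw [hPK t htK, if_neg (Finset.ne_of_mem_erase ht).symm]
          simp [hl', htK]
        · simp only [hPdef, hl', htK, if_false, Finset.mul_sum, mul_assoc]
      rw [h1, ih, add_assoc, ← Finset.sum_add_distrib]
      congr 1
      refine Finset.sum_congr rfl fun t _ => ?_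
      rw [← Finset.sum_add_distrib]
      refine Finset.sum_congr rfl fun b _ => ?_
      rw [Finset.sum_range_succ, add_mul]
  simp only [hl_eq]
  refine tendsto_const_nhds.add (tendsto_finsetSum _ fun t _ => tendsto_finsetSum _ fun b _ => ?_)
  by_cases htK : t ∈ K
  · simp [hl', htK, hYK t htK]
  by_cases hb : b ∈ M.avail t
  · by_cases hpr : M.pr t b s = 0
    · simp [hpr]
    -- By `avoid`, mass enters `K` only through actions of `E`. In states that use one, `g` is
    -- positive, and so the true visit counts are the prescribed ones.
    · have hE : E t b := by
        by_contra hE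
        exact hpr (hf.avoid t htK b hb hE s hs)
      refine Tendsto.mul_const _ ?_
      by_cases hπz : π t b = 0
      · have : Y t b = 0 := by rw [← hyπ, hπz, mul_zero]
        simp [hπz, this]
      · have hgt : 0 < g t := by
          simp only [hg, htK, if_false]
          refine lt_of_lt_of_le (mul_pos (lt_of_le_of_ne (hπ0 t b) (Ne.symm hπz)) hf.pos) ?_
          have := Finset.single_le_sum (f := fun b => π t b * (if E t b then η else 0))
            (fun b _ => mul_nonneg (hπ0 t b) (by
              split_ifs
              · exact hf.pos.le
              · exact le_rfl)) (Finset.mem_univ b)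
          simpa [hE] using this
        have h1 := (hvis.2 t hgt).mul_right (π t b)
        rw [hyπ] at h1
        exact h1.tendsto_sum_nat
  · simp [hYav t b hb, hπav t b hb]

/-! ## Existence of potentials -/

/-- If no nonempty set of states outside of `K` can be kept forever, then there is a potential that
drops for all actions outside of `K`. -/
theorem exists_potential (M : MDP S A) (K : Set S)
    (hK : ∀ s ∈ K, ∀ a ∈ M.avail s, M.δ s a s = 1)
    (htrap : ∀ Y : Set S, Y.Nonempty → Disjoint Y K →
      ∃ s ∈ Y, ∀ a ∈ M.avail s, ∃ t ∉ Y, M.pr s a t ≠ 0) :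
    ∃ f η, M.Potential K (fun _ _ => True) f η := by
  classical
  -- A potential is built state by state: on `R` it is below `1` and, outside of `K`, strictly
  -- decreasing in expectation; off `R` it still has the value `1`.
  let Good (R : Set S) : Prop := K ⊆ R ∧ ∃ f : S → ℝ, (∀ s, 0 ≤ f s) ∧ (∀ s ∈ K, f s = 0) ∧
    (∀ s ∈ R, f s < 1) ∧ (∀ s ∉ R, f s = 1) ∧
    ∀ s ∈ R, s ∉ K → ∀ a ∈ M.avail s, ∑ t, M.pr s a t * f t < f s
  have h0 : Good K := by
    refine ⟨le_rfl, fun s => if s ∈ K then 0 else 1, ?_, ?_, ?_, ?_, ?_⟩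
    · intro s
      dsimp only
      split_ifs <;> norm_num
    · intro s hs
      simp [hs]
    · intro s hs
      simp [hs]
    · intro s hs
      simp [hs]
    · exact fun s hs hs' => (hs' hs).elim
  obtain ⟨R, hR⟩ := (Set.toFinite {R : Set S | Good R}).exists_maximal ⟨K, h0⟩
  have hRu : R = Set.univ := by
    by_contra hne
    obtain ⟨hKR, f, hf0, hfK, hfR, hf1, hfs⟩ := hR.prop
    -- The complement of a maximal `R` is no trap, so some `q` outside of `R` enters `R` with
    -- positive probability under every action.
    obtain ⟨q, hq, hqa⟩ := htrap Rᶜ (Set.nonempty_compl.2 hne)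
      (Set.disjoint_left.2 fun s hs hs' => hs (hKR hs'))
    have hle1 : ∀ s, f s ≤ 1 := fun s => by
      by_cases hs : s ∈ R
      · exact (hfR s hs).le
      · exact (hf1 s hs).le
    have hlt : ∀ a ∈ M.avail q, ∑ t, M.pr q a t * f t < 1 := by
      intro a ha
      obtain ⟨t, ht, hpt⟩ := hqa a ha
      rw [← M.sum_pr q a]
      refine Finset.sum_lt_sum (fun s _ => mul_le_of_le_one_right (M.pr_nonneg _ _ _) (hle1 s))
        ⟨t, Finset.mem_univ t, ?_⟩
      exact mul_lt_of_lt_one_right (lt_of_le_of_ne (M.pr_nonneg _ _ _) (Ne.symm hpt))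
        (hfR t (not_not.1 ht))
    -- The new value at `q` is the midpoint of `1` and the largest expected value after one action.
    -- Lowering the potential at `q` only lowers the expected values at other states, so their
    -- strict decrease persists.
    obtain ⟨c, hc0, hc1, hc⟩ : ∃ c : ℝ, 0 ≤ c ∧ c < 1 ∧
        ∀ a ∈ M.avail q, ∑ t, M.pr q a t * f t < c := by
      obtain ⟨b, hb, hbm⟩ := (Set.toFinite (M.avail q)).exists_maximalFor
        (fun a => ∑ t, M.pr q a t * f t) _ (M.avail_nonempty q)
      have hb0 : 0 ≤ ∑ t, M.pr q b t * f t :=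
        Finset.sum_nonneg fun t _ => mul_nonneg (M.pr_nonneg _ _ _) (hf0 t)
      refine ⟨(∑ t, M.pr q b t * f t + 1) / 2, by linarith, by linarith [hlt b hb], ?_⟩
      intro a ha
      have h1 : ∑ t, M.pr q a t * f t ≤ ∑ t, M.pr q b t * f t := by
        by_contra hcon
        exact hcon (hbm ha (not_le.1 hcon).le)
      linarith [hlt b hb]
    have hqK : q ∉ K := fun h => hq (hKR h)
    have hle : ∀ s, Function.update f q c s ≤ f s := by
      intro s
      by_cases hs : s = q
      · subst hs
        rw [Function.update_self, hf1 s hq]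
        exact hc1.le
      · rw [Function.update_of_ne hs]
    have hEle : ∀ s a, ∑ t, M.pr s a t * Function.update f q c t ≤ ∑ t, M.pr s a t * f t :=
      fun s a => Finset.sum_le_sum fun t _ => mul_le_mul_of_nonneg_left (hle t) (M.pr_nonneg _ _ _)
    have hgood : Good (insert q R) := by
      refine ⟨hKR.trans (Set.subset_insert q R), Function.update f q c, ?_, ?_, ?_, ?_, ?_⟩
      · intro s
        by_cases hs : s = q
        · subst hs
          rwa [Function.update_self]
        · rw [Function.update_of_ne hs]
          exact hf0 s
      · intro s hs
        rw [Function.update_of_ne (by rintro rfl; exact hqK hs)]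
        exact hfK s hs
      · intro s hs
        by_cases hsq : s = q
        · subst hsq
          rwa [Function.update_self]
        · rw [Function.update_of_ne hsq]
          exact hfR s (hs.resolve_left hsq)
      · intro s hs
        rw [Function.update_of_ne (by rintro rfl; exact hs (Set.mem_insert _ _))]
        exact hf1 s fun h => hs (Set.mem_insert_of_mem _ h)
      · intro s hs hsK a ha
        refine (hEle s a).trans_lt ?_
        by_cases hsq : s = q
        · subst hsq
          rw [Function.update_self]
          exact hc a ha
        · rw [Function.update_of_ne hsq]
          exact hfs s (hs.resolve_left hsq) hsK a ha
    exact hq (hR.le_of_ge hgood (Set.subset_insert q R) (Set.mem_insert q R))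
  obtain ⟨-, f, hf0, hfK, -, -, hfs⟩ := hR.prop
  have hfs' : ∀ s ∉ K, ∀ a ∈ M.avail s, ∑ t, M.pr s a t * f t < f s :=
    fun s hs a ha => hfs s (hRu ▸ Set.mem_univ s) hs a ha
  obtain ⟨η, hη, hηle⟩ : ∃ η : ℝ, 0 < η ∧ ∀ s ∉ K, ∀ a ∈ M.avail s,
      η ≤ f s - ∑ t, M.pr s a t * f t := by
    rcases {p : S × A | p.1 ∉ K ∧ p.2 ∈ M.avail p.1}.eq_empty_or_nonempty with he | hne
    · refine ⟨1, one_pos, fun s hs a ha => ?_⟩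
      have : (s, a) ∈ {p : S × A | p.1 ∉ K ∧ p.2 ∈ M.avail p.1} := ⟨hs, ha⟩
      rw [he] at this
      exact this.elim
    · obtain ⟨p, hp, hpm⟩ := (Set.toFinite {p : S × A | p.1 ∉ K ∧ p.2 ∈ M.avail p.1}).exists_minimalFor
        (fun p => f p.1 - ∑ t, M.pr p.1 p.2 t * f t) _ hne
      refine ⟨_, sub_pos.2 (hfs' p.1 hp.1 p.2 hp.2), fun s hs a ha => ?_⟩
      by_contra hcon
      exact hcon (hpm (j := (s, a)) ⟨hs, ha⟩ (not_le.1 hcon).le)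
  exact ⟨f, η, hη, hf0, hfK, hK, fun s hs a ha => (hfs' s hs a ha).le,
    fun s hs a ha _ => by linarith [hηle s hs a ha], fun s hs a ha h => (h trivial).elim⟩

end MDP

/-! ## Circulations in irreducible chains -/

/-- In an irreducible stochastic matrix, every balanced demand is met by nonnegative visits. -/
theorem exists_circulation {ι : Type*} [Fintype ι] {P : ι → ι → ℝ} (hP : ∀ i j, 0 ≤ P i j)
    (hP1 : ∀ i, ∑ j, P i j = 1) (hirr : ∀ i j, Relation.TransGen (fun i j => 0 < P i j) i j)
    {d : ι → ℝ} (hd : ∑ i, d i = 0) :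
    ∃ w : ι → ℝ, (∀ i, 0 ≤ w i) ∧ ∀ j, w j - ∑ i, w i * P i j = d j := by
  classical
  rcases isEmpty_or_nonempty ι with hι | hι
  · exact ⟨fun _ => 0, fun _ => le_rfl, fun j => (IsEmpty.false j).elim⟩
  let D : (ι → ℝ) →ₗ[ℝ] (ι → ℝ) :=
    { toFun := fun w j => w j - ∑ i, w i * P i j
      map_add' := by
        intro w w'
        funext j
        simp only [Pi.add_apply, add_mul, Finset.sum_add_distrib]
        ring
      map_smul' := by
        intro r w
        funext j
        simp only [Pi.smul_apply, smul_eq_mul, RingHom.id_apply, mul_sub, Finset.mul_sum,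
          mul_assoc] }
  have hDapp : ∀ w j, D w j = w j - ∑ i, w i * P i j := fun w j => rfl
  have hsum : ∀ w, ∑ j, D w j = 0 := by
    intro w
    simp only [hDapp, Finset.sum_sub_distrib]
    rw [Finset.sum_comm]
    simp only [← Finset.mul_sum, hP1, mul_one, sub_self]
  -- a positive invariant vector
  obtain ⟨p, hp, hpD⟩ : ∃ p : ι → ℝ, (∀ i, 0 < p i) ∧ D p = 0 := by
    -- All values of `D` have sum zero, so the constant vector `1` is not in its range; in finite
    -- dimension `D` is then not injective either.
    have hninj : ¬ Function.Injective D := by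
      intro hinj
      obtain ⟨w, hw⟩ := LinearMap.injective_iff_surjective.1 hinj fun _ => 1
      have := hsum w
      rw [hw] at this
      simp at this
    have hker : LinearMap.ker D ≠ ⊥ := fun h => hninj (LinearMap.ker_eq_bot.1 h)
    obtain ⟨v, hv, hv0⟩ := Submodule.exists_mem_ne_zero_of_ne_bot hker
    have hvP : ∀ j, v j = ∑ i, v i * P i j := fun j => sub_eq_zero.1 (congrFun hv j)
    have hle : ∀ j, |v j| ≤ ∑ i, |v i| * P i j := by
      intro j
      rw [hvP j]
      refine (Finset.abs_sum_le_sum_abs _ _).trans (Finset.sum_le_sum fun i _ => ?_)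
      rw [abs_mul, abs_of_nonneg (hP i j)]
    -- The triangle inequality holds termwise and both sides have the same total, because the rows
    -- of `P` sum to one. So the absolute values of an invariant vector are invariant.
    have heq : ∀ j, |v j| = ∑ i, |v i| * P i j := by
      have h1 : ∑ j, |v j| = ∑ j, ∑ i, |v i| * P i j := by
        rw [Finset.sum_comm]
        simp only [← Finset.mul_sum, hP1, mul_one]
      exact fun j => (Finset.sum_eq_sum_iff_of_le fun j _ => hle j).1 h1 j (Finset.mem_univ j)
    obtain ⟨i, hi⟩ := Function.ne_iff.1 hv0
    have hpos : ∀ j, 0 < |v j| := by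
      intro j
      have hstep : ∀ a b, 0 < P a b → 0 < |v a| → 0 < |v b| := by
        intro a b hab ha
        rw [heq b]
        exact (mul_pos ha hab).trans_le (Finset.single_le_sum (f := fun i => |v i| * P i b)
          (fun i _ => mul_nonneg (abs_nonneg _) (hP i b)) (Finset.mem_univ a))
      induction hirr i j with
      | single h => exact hstep _ _ h (abs_pos.2 hi)
      | tail _ h ih => exact hstep _ _ h ih
    refine ⟨fun j => |v j|, hpos, ?_⟩
    funext j
    rw [hDapp, ← heq j, sub_self]
    rfl
  -- harmonic functions are constant
  have hrange : d ∈ LinearMap.range D := by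
    by_contra hnd
    -- A functional that kills the range of `D` has harmonic coefficients. By the minimum principle
    -- and irreducibility these are constant, so the functional kills every vector of sum zero,
    -- including `d`.
    obtain ⟨φ, hφd, hφ⟩ := Submodule.exists_le_ker_of_notMem hnd
    set h : ι → ℝ := fun i => φ (Pi.single i 1) with hh
    have hφh : ∀ w, φ w = ∑ i, w i * h i := by
      intro w
      conv_lhs => rw [pi_eq_sum_univ' w]
      simp [hh, map_sum]
    have hharm : ∀ i, h i = ∑ j, P i j * h j := by
      intro i
      have h1 : φ (D (Pi.single i 1)) = 0 := hφ ⟨_, rfl⟩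
      rw [hφh] at h1
      simp only [hDapp, sub_mul, Finset.sum_sub_distrib] at h1
      simpa [Pi.single_apply, sub_eq_zero] using h1
    obtain ⟨m, hm⟩ := Finite.exists_min h
    have hconst : ∀ j, h j = h m := by
      intro j
      have hstep : ∀ a b, 0 < P a b → h a = h m → h b = h m := by
        intro a b hab ha
        have h1 : ∑ j, P a j * (h j - h m) = 0 := by
          simp only [mul_sub, Finset.sum_sub_distrib, ← hharm, ← Finset.sum_mul, hP1, ha]
          ring
        have h2 := (Finset.sum_eq_zero_iff_of_nonneg fun j _ =>
          mul_nonneg (hP a j) (sub_nonneg.2 (hm j))).1 h1 b (Finset.mem_univ b)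
        exact sub_eq_zero.1 ((mul_eq_zero.1 h2).resolve_left hab.ne')
      induction hirr m j with
      | single h => exact hstep _ _ h rfl
      | tail _ h ih => exact hstep _ _ h ih
    apply hφd
    rw [hφh]
    simp only [hconst, ← Finset.sum_mul, hd, zero_mul]
  obtain ⟨w, hw⟩ := hrange
  -- A large multiple of the positive invariant vector makes the solution nonnegative without
  -- changing its image under `D`.
  obtain ⟨c, hc⟩ : ∃ c : ℝ, ∀ i, -w i ≤ c * p i := by
    refine ⟨∑ i, |w i| / p i, fun i => ?_⟩
    have h1 := Finset.single_le_sum (f := fun i => |w i| / p i)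
      (fun i _ => div_nonneg (abs_nonneg (w i)) (hp i).le) (Finset.mem_univ i)
    calc -w i ≤ |w i| := neg_le_abs _
      _ = |w i| / p i * p i := by rw [div_mul_cancel₀ _ (hp i).ne']
      _ ≤ _ := mul_le_mul_of_nonneg_right h1 (hp i).le
  refine ⟨w + c • p, fun i => ?_, fun j => ?_⟩
  · simp only [Pi.add_apply, Pi.smul_apply, smul_eq_mul]
    linarith [hc i]
  · rw [← hDapp, map_add, map_smul, hw, hpD, smul_zero, add_zero]

open Filter Topology

/-! ## The MEC quotient is stopping -/

namespace MDP

section Classes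

variable {S : Type u} {A : Type v} (M : MDP S A) (U : Set S)

theorem proj_eq_orig_iff (s t : S) (ht : ∀ C : M.MEC U, t ∉ C.T) :
    M.proj U s = .orig t ht ↔ s = t := by
  constructor
  · intro h
    by_cases hs : ∃ C : M.MEC U, s ∈ C.T
    · obtain ⟨C, hC⟩ := hs
      rw [(M.proj_eq_collapsed_iff U s C).2 hC] at h
      cases h
    · rw [M.proj_of_notMem U s fun C hC => hs ⟨C, hC⟩] at h
      injection h
  · rintro rfl
    exact M.proj_of_notMem U s ht

theorem proj_ne_sink (s : S) : M.proj U s ≠ .sink := by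
  intro h
  by_cases hs : ∃ C : M.MEC U, s ∈ C.T
  · obtain ⟨C, hC⟩ := hs
    rw [(M.proj_eq_collapsed_iff U s C).2 hC] at h
    cases h
  · rw [M.proj_of_notMem U s fun C hC => hs ⟨C, hC⟩] at h
    cases h

theorem exists_proj_eq {q : QState M U} (hq : q ≠ .sink) : ∃ s, M.proj U s = q := by
  cases q with
  | orig s hs => exact ⟨s, M.proj_of_notMem U s hs⟩
  | collapsed C =>
    obtain ⟨s, hs⟩ := C.isEC.states_nonempty
    exact ⟨s, (M.proj_eq_collapsed_iff U s C).2 hs⟩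
  | sink => exact (hq rfl).elim

theorem proj_eq_proj {s t : S} (h : M.proj U s = M.proj U t) :
    s = t ∨ ∃ C : M.MEC U, s ∈ C.T ∧ t ∈ C.T := by
  by_cases hs : ∃ C : M.MEC U, s ∈ C.T
  · obtain ⟨C, hC⟩ := hs
    rw [(M.proj_eq_collapsed_iff U s C).2 hC] at h
    exact Or.inr ⟨C, hC, (M.proj_eq_collapsed_iff U t C).1 h.symm⟩
  · rw [M.proj_of_notMem U s fun C hC => hs ⟨C, hC⟩] at h
    exact Or.inl ((M.proj_eq_orig_iff U t s _).1 h.symm).symm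

theorem proj_eq_of_mem_B {C : M.MEC U} {s : S} {a : A} (h : (s, a) ∈ C.B) {t : S}
    (ht : t ∈ (M.δ s a).support) : M.proj U t = M.proj U s := by
  rw [(M.proj_eq_collapsed_iff U s C).2 (C.isEC.acts_subset _ h).1,
    (M.proj_eq_collapsed_iff U t C).2 (C.isEC.closed _ h ht)]

/-- This treats the three kinds of states uniformly: the sink represents no state, and a state
outside of the components has no pair in any `C.B`. -/
theorem some_mem_avail_iff (q : QState M U) (s : S) (a : A) :
    some (s, a) ∈ (M.mecQuotient U).avail q ↔
      M.proj U s = q ∧ a ∈ M.avail s ∧ ∀ C : M.MEC U, (s, a) ∉ C.B := by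
  cases q with
  | orig t ht =>
    rw [proj_eq_orig_iff]
    constructor
    · rintro ⟨b, hb, e⟩
      simp only [Option.some.injEq, Prod.mk.injEq] at e
      obtain ⟨rfl, rfl⟩ := e
      exact ⟨rfl, hb, fun C hC => ht C (C.isEC.acts_subset _ hC).1⟩
    · rintro ⟨rfl, ha, _⟩
      exact ⟨a, ha, rfl⟩
  | collapsed C =>
    rw [proj_eq_collapsed_iff]
    constructor
    · rintro (⟨t, ht, b, hb, hB, e⟩ | h)
      · simp only [Option.some.injEq, Prod.mk.injEq] at e
        obtain ⟨rfl, rfl⟩ := e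
        refine ⟨ht, hb, fun D hD => ?_⟩
        rw [← C.eq_of_mem D ht (D.isEC.acts_subset _ hD).1] at hD
        exact hB hD
      · cases h
    · rintro ⟨hs, ha, hB⟩
      exact Or.inl ⟨s, hs, a, ha, hB C, rfl⟩
  | sink =>
    constructor
    · intro h
      cases h
    · exact fun h => (M.proj_ne_sink U s h.1).elim

theorem none_mem_avail_iff (q : QState M U) :
    none ∈ (M.mecQuotient U).avail q ↔ ∀ s hs, q ≠ .orig s hs := by
  cases q with
  | orig t ht =>
    refine iff_of_false ?_ fun h => h t ht rfl
    rintro ⟨b, hb, e⟩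
    cases e
  | collapsed C => exact iff_of_true (Or.inr rfl) fun s hs h => by cases h
  | sink => exact iff_of_true rfl fun s hs h => by cases h

/-- Every end component is contained in a maximal one. -/
theorem IsEC.exists_mec [Finite S] [Finite A] {M : MDP S A} {U T : Set S} {B : Set (S × A)}
    (h : M.IsEC T B) (hT : T ⊆ U) : ∃ D : M.MEC U, T ⊆ D.T ∧ B ⊆ D.B := by
  obtain ⟨D, hle, hD⟩ := (Set.toFinite {D : Set S × Set (S × A) | M.IsEC D.1 D.2 ∧ D.1 ⊆ U}).exists_le_maximal
    (a := (T, B)) ⟨h, hT⟩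
  refine ⟨⟨D.1, D.2, hD.prop.1, hD.prop.2, fun T' B' h' hU hT' hB' => ?_⟩, hle.1, hle.2⟩
  have := hD.eq_of_le (y := (T', B')) ⟨h', hU⟩ ⟨hT', hB'⟩
  exact ⟨congrArg Prod.fst this.symm, congrArg Prod.snd this.symm⟩

end Classes

variable {S : Type u} {A : Type v} [Fintype S] [Fintype A] {M : MDP S A} (U : Set S)

theorem mecQuotient_pr_some [DecidableEq (QState M U)] (q : QState M U) (s : S) (a : A)
    (q' : QState M U) :
    (M.mecQuotient U).pr q (some (s, a)) q' = ∑ t with M.proj U t = q', M.pr s a t := by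
  classical
  show ((M.δ s a).map (M.proj U) q').toReal = _
  rw [PMF.map_apply, tsum_fintype, ENNReal.toReal_sum, Finset.sum_filter]
  · refine Finset.sum_congr rfl fun t _ => ?_
    by_cases h : M.proj U t = q'
    · rw [if_pos h, if_pos h.symm, pr]
    · rw [if_neg h, if_neg (Ne.symm h), ENNReal.toReal_zero]
  · intro t _
    split_ifs
    · exact PMF.apply_ne_top _ _
    · exact ENNReal.zero_ne_top

theorem mecQuotient_pr_none [DecidableEq (QState M U)] (q q' : QState M U) :
    (M.mecQuotient U).pr q none q' = if q' = .sink then 1 else 0 := by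
  show (PMF.pure QState.sink q' : ℝ≥0∞).toReal = _
  rw [PMF.pure_apply]
  split_ifs <;> simp

theorem mecQuotient_pr_some_ne_zero (q : QState M U) {s : S} {a : A} {t : S} (h : M.pr s a t ≠ 0) :
    (M.mecQuotient U).pr q (some (s, a)) (M.proj U t) ≠ 0 := by
  classical
  rw [mecQuotient_pr_some]
  refine (lt_of_lt_of_le (lt_of_le_of_ne (M.pr_nonneg s a t) (Ne.symm h)) ?_).ne'
  exact Finset.single_le_sum (f := fun t => M.pr s a t) (fun t _ => M.pr_nonneg s a t)
    (Finset.mem_filter.2 ⟨Finset.mem_univ t, rfl⟩)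

/-- No nonempty set of states of the quotient that avoids the targets and the sink can be kept
forever. -/
theorem mecQuotient_no_trap (Y : Set (QState M U)) (hne : Y.Nonempty)
    (hU : ∀ s, M.proj U s ∈ Y → s ∈ U) (hsink : QState.sink ∉ Y) :
    ∃ q ∈ Y, ∀ α ∈ (M.mecQuotient U).avail q, ∃ q' ∉ Y, (M.mecQuotient U).pr q α q' ≠ 0 := by
  classical
  by_contra hcon
  push Not at hcon
  -- A trap that is minimal under inclusion will turn out to be strongly connected. In a trap `stay`
  -- cannot be the chosen action, since it leads to the sink.
  obtain ⟨Z, hZY, hZ⟩ := (Set.toFinite {Z : Set (QState M U) | Z.Nonempty ∧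
    ∀ q ∈ Z, ∃ α ∈ (M.mecQuotient U).avail q, ∀ q' ∉ Z, (M.mecQuotient U).pr q α q' = 0}).exists_le_minimal
    (a := Y) ⟨hne, hcon⟩
  have hsinkZ : QState.sink ∉ Z := fun h => hsink (hZY h)
  have hch : ∀ q ∈ Z, ∃ s a, M.proj U s = q ∧ a ∈ M.avail s ∧ (∀ C : M.MEC U, (s, a) ∉ C.B) ∧
      ∀ t, M.pr s a t ≠ 0 → M.proj U t ∈ Z := by
    intro q hq
    obtain ⟨α, hα, hαZ⟩ := hZ.prop.2 q hq
    cases α with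
    | none =>
      have := hαZ _ hsinkZ
      rw [mecQuotient_pr_none, if_pos rfl] at this
      exact (one_ne_zero this).elim
    | some x =>
      obtain ⟨s, a⟩ := x
      obtain ⟨h1, h2, h3⟩ := (M.some_mem_avail_iff U q s a).1 hα
      refine ⟨s, a, h1, h2, h3, fun t ht => ?_⟩
      by_contra hn
      exact mecQuotient_pr_some_ne_zero U q ht (hαZ _ hn)
  have : Nonempty S := ⟨M.init⟩
  have : Nonempty A := ⟨(M.avail_nonempty M.init).some⟩
  choose! st act hst hact hnB hcl using hch
  -- The candidate end component combines one trapping exit for each class in `Z` with all actions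
  -- of the components collapsed to states of `Z`. The latter connect the states within a class.
  let B : Set (S × A) := {x | (∃ q ∈ Z, x = (st q, act q)) ∨
    ∃ C : M.MEC U, .collapsed C ∈ Z ∧ x ∈ C.B}
  let G : S → S → Prop := fun x y => ∃ a, (x, a) ∈ B ∧ y ∈ (M.δ x a).support
  have hclass : ∀ s t, M.proj U s ∈ Z → M.proj U s = M.proj U t → Relation.ReflTransGen G s t := by
    intro s t hs hst
    rcases M.proj_eq_proj U hst with rfl | ⟨C, hsC, htC⟩
    · exact Relation.ReflTransGen.refl
    · refine (Relation.TransGen.mono ?_ _ _ (C.isEC.connected s hsC t htC)).to_reflTransGen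
      rintro x y ⟨a, ha, hy⟩
      refine ⟨a, Or.inr ⟨C, ?_, ha⟩, hy⟩
      rwa [← (M.proj_eq_collapsed_iff U s C).2 hsC]
  have hconn : ∀ s, M.proj U s ∈ Z → ∀ t, M.proj U t ∈ Z → Relation.TransGen G s t := by
    intro s hs
    -- The classes of `Z` all of whose states are reachable from `s` form a trap again, so
    -- minimality gives all of `Z`.
    let W : Set (QState M U) := {q | q ∈ Z ∧ ∀ t, M.proj U t = q → Relation.TransGen G s t}
    have hstep : ∀ q ∈ Z, Relation.ReflTransGen G s (st q) → ∀ t, M.pr (st q) (act q) t ≠ 0 →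
        M.proj U t ∈ W := by
      intro q hq hr t ht
      refine ⟨hcl q hq t ht, fun t' ht' => ?_⟩
      have h1 : G (st q) t := ⟨act q, Or.inl ⟨q, hq, rfl⟩, by
        rw [← pr_pos_iff]
        exact lt_of_le_of_ne (M.pr_nonneg _ _ _) (Ne.symm ht)⟩
      exact (Relation.TransGen.tail' hr h1).trans_left (hclass t t' (hcl q hq t ht) ht'.symm)
    have hex : ∀ q, ∃ t, M.pr (st q) (act q) t ≠ 0 := by
      intro q
      by_contra hn
      push Not at hn
      have := M.sum_pr (st q) (act q)
      simp [hn] at this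
    have hWgood : W ∈ {Z : Set (QState M U) | Z.Nonempty ∧
        ∀ q ∈ Z, ∃ α ∈ (M.mecQuotient U).avail q, ∀ q' ∉ Z,
          (M.mecQuotient U).pr q α q' = 0} := by
      constructor
      · obtain ⟨t, ht⟩ := hex (M.proj U s)
        exact ⟨_, hstep _ hs (hclass s _ hs (hst _ hs).symm) t ht⟩
      · rintro q ⟨hq, hqW⟩
        refine ⟨some (st q, act q), (M.some_mem_avail_iff U q _ _).2
          ⟨hst q hq, hact q hq, hnB q hq⟩, fun q' hq' => ?_⟩
        rw [mecQuotient_pr_some]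
        refine Finset.sum_eq_zero fun t ht => ?_
        by_contra hne
        apply hq'
        rw [← (Finset.mem_filter.1 ht).2]
        exact hstep q hq (hqW _ (hst q hq)).to_reflTransGen t hne
    have hle := hZ.le_of_le hWgood fun q hq => hq.1
    exact fun t ht => (hle ht).2 t rfl
  have hEC : M.IsEC {s | M.proj U s ∈ Z} B := by
    obtain ⟨q, hq⟩ := hZ.prop.1
    refine ⟨⟨st q, ?_⟩, ⟨_, Or.inl ⟨q, hq, rfl⟩⟩, ?_, ?_, hconn⟩
    · show M.proj U (st q) ∈ Z
      rwa [hst q hq]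
    · rintro x (⟨q, hq, rfl⟩ | ⟨C, hC, hx⟩)
      · refine ⟨?_, hact q hq⟩
        show M.proj U (st q) ∈ Z
        rwa [hst q hq]
      · have h := C.isEC.acts_subset x hx
        refine ⟨?_, h.2⟩
        show M.proj U x.1 ∈ Z
        rwa [(M.proj_eq_collapsed_iff U _ C).2 h.1]
    · rintro x (⟨q, hq, rfl⟩ | ⟨C, hC, hx⟩) t ht
      · exact hcl q hq t ((M.pr_pos_iff _ _ _).2 ht).ne'
      · show M.proj U t ∈ Z
        rwa [(M.proj_eq_collapsed_iff U _ C).2 (C.isEC.closed x hx ht)]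
  -- The end component lies in a maximal one, which would then contain an action chosen outside of
  -- all of them.
  obtain ⟨D, _, hDB⟩ := hEC.exists_mec (U := U) fun s hs => hU s (hZY hs)
  obtain ⟨q, hq⟩ := hZ.prop.1
  exact hnB q hq D (hDB (Or.inl ⟨q, hq, rfl⟩))

end MDP

namespace MDP

variable {S : Type u} {A : Type v} [Fintype S] [Fintype A] {M : MDP S A} (Φ : WRObjective M)

theorem target_notMem (Φ : WRObjective M) {s : S} (hs : s ∈ Φ.F) (C : M.MEC Φ.Fᶜ) : s ∉ C.T :=
  fun h => C.subset h hs

theorem proj_mem_quotient_F (Φ : WRObjective M) {s : S} :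
    M.proj Φ.Fᶜ s ∈ Φ.quotient.F ↔ s ∈ Φ.F := by
  constructor
  · rintro ⟨t, ht, e, hF⟩
    rw [proj_eq_orig_iff] at e
    rwa [e]
  · exact fun hs => ⟨s, target_notMem Φ hs, M.proj_of_notMem _ s _, hs⟩

theorem eq_of_proj_eq_target (Φ : WRObjective M) {s t : S} (hs : s ∈ Φ.F)
    (h : M.proj Φ.Fᶜ t = M.proj Φ.Fᶜ s) : t = s := by
  rwa [M.proj_of_notMem _ s (target_notMem Φ hs), proj_eq_orig_iff] at h

/-- The targets and the sink of the MEC quotient. -/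
def quotientEnd (Φ : WRObjective M) : Set (QState M Φ.Fᶜ) := Φ.quotient.F ∪ {QState.sink}

theorem proj_mem_quotientEnd (Φ : WRObjective M) {s : S} :
    M.proj Φ.Fᶜ s ∈ quotientEnd Φ ↔ s ∈ Φ.F := by
  rw [quotientEnd, Set.mem_union, proj_mem_quotient_F]
  exact or_iff_left (M.proj_ne_sink _ s)

theorem quotientEnd_absorbing (Φ : WRObjective M) : ∀ q ∈ quotientEnd Φ,
    ∀ α ∈ (M.mecQuotient Φ.Fᶜ).avail q, (M.mecQuotient Φ.Fᶜ).δ q α q = 1 := by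
  rintro q (hq | rfl) α hα
  · exact Φ.quotient.absorbing q hq α hα
  · obtain rfl : α = none := hα
    exact (PMF.apply_eq_one_iff _ _).2 (by simp [mecQuotient])

/-- Targets and sink absorb, and there is no trap besides them, so `exists_potential` applies. -/
theorem mecQuotient_exists_potential [Fintype (QState M Φ.Fᶜ)] :
    ∃ f η, (M.mecQuotient Φ.Fᶜ).Potential (quotientEnd Φ) (fun _ _ => True) f η := by
  refine exists_potential _ _ (quotientEnd_absorbing Φ) fun Y hY hd => ?_
  refine mecQuotient_no_trap Φ.Fᶜ Y hY (fun s hs hF => ?_) fun h => ?_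
  · exact Set.disjoint_left.1 hd hs ((proj_mem_quotientEnd Φ).2 hF)
  · exact Set.disjoint_left.1 hd h (Or.inr rfl)

theorem IsFlow.tendsto_mass_zero {M : MDP S A} {x : ℕ → S → A → ℝ} (hx : M.IsFlow x) {K : Set S}
    {f : S → ℝ} {η : ℝ} (hf : M.Potential K (fun _ _ => True) f η) {s : S} (hs : s ∉ K) :
    Tendsto (fun n => mass x n s) atTop (𝓝 0) := by
  have := tendsto_finsetSum Finset.univ fun a (_ : a ∈ (Finset.univ : Finset A)) =>
    (hx.summable hf hs (a := a) trivial).tendsto_atTop_zero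
  simpa [mass] using this

theorem mecQuotient_isStopping (Φ : WRObjective M) :
    (M.mecQuotient Φ.Fᶜ).IsStopping Φ.quotient QState.sink where
  sink_not_target := by
    rintro ⟨s, hs, e, -⟩
    cases e
  sink_absorbing := quotientEnd_absorbing Φ _ (Or.inr rfl)
  reaches σ := by
    classical
    have := Fintype.ofFinite (QState M Φ.Fᶜ)
    obtain ⟨f, η, hf⟩ := mecQuotient_exists_potential Φ
    have hflow := (M.mecQuotient Φ.Fᶜ).isFlow_marginal σ
    have h1 := (M.mecQuotient Φ.Fᶜ).tendsto_mass σ (quotientEnd Φ) (quotientEnd_absorbing Φ)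
    have h2 : Tendsto (fun n => 1 - ∑ q with q ∉ quotientEnd Φ,
        mass ((M.mecQuotient Φ.Fᶜ).marginal σ) n q) atTop (𝓝 (1 - ∑ q with q ∉ quotientEnd Φ, 0)) :=
      tendsto_const_nhds.sub (tendsto_finsetSum _ fun q hq =>
        hflow.tendsto_mass_zero hf (Finset.mem_filter.1 hq).2)
    have h3 : ∀ n, 1 - ∑ q with q ∉ quotientEnd Φ, mass ((M.mecQuotient Φ.Fᶜ).marginal σ) n q =
        ∑ q with q ∈ quotientEnd Φ, mass ((M.mecQuotient Φ.Fᶜ).marginal σ) n q := by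
      intro n
      rw [← hflow.sum_mass n, ← Finset.sum_filter_add_sum_filter_not Finset.univ
        (fun q => q ∈ quotientEnd Φ)]
      ring
    have h4 := tendsto_nhds_unique h1 (h2.congr h3)
    simp only [Finset.sum_const_zero, sub_zero] at h4
    rw [← ENNReal.toReal_eq_one_iff]
    exact h4

end MDP

open Filter Topology

/-! ## Exit flows -/

namespace MDP

variable {S : Type u} {A : Type v} [Fintype S] [Fintype A] {M : MDP S A} (Φ : WRObjective M)

/-- The available actions of states that are not targets, outside of all end components. -/
def IsExit (Φ : WRObjective M) (s : S) (a : A) : Prop :=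
  s ∉ Φ.F ∧ a ∈ M.avail s ∧ ∀ C : M.MEC Φ.Fᶜ, (s, a) ∉ C.B

theorem IsExit.some_mem_avail {Φ : WRObjective M} {s : S} {a : A} (h : IsExit Φ s a) :
    some (s, a) ∈ (M.mecQuotient Φ.Fᶜ).avail (M.proj Φ.Fᶜ s) :=
  (M.some_mem_avail_iff _ _ s a).2 ⟨rfl, h.2⟩

/-- Actions that are not exits preserve the class of the state. -/
theorem proj_eq_of_not_isExit {Φ : WRObjective M} {t : S} {b : A} (hb : b ∈ M.avail t)
    (h : ¬ IsExit Φ t b) {s : S} (hs : M.pr t b s ≠ 0) : M.proj Φ.Fᶜ s = M.proj Φ.Fᶜ t := by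
  classical
  by_cases ht : t ∈ Φ.F
  · rw [pr_of_absorbing (Φ.absorbing t ht b hb)] at hs
    rw [(ite_ne_right_iff.1 hs).1]
  · simp only [IsExit, ht, hb, not_false_eq_true, true_and, not_forall, not_not] at h
    obtain ⟨C, hC⟩ := h
    refine M.proj_eq_of_mem_B _ hC ?_
    rw [← pr_pos_iff]
    exact lt_of_le_of_ne (M.pr_nonneg _ _ _) (Ne.symm hs)

open Classical in
/-- The limit probability of the class `q`, if `X` counts the exits. -/
noncomputable def exitBalance (Φ : WRObjective M) (X : S → A → ℝ) (q : QState M Φ.Fᶜ) : ℝ :=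
  (if M.proj Φ.Fᶜ M.init = q then 1 else 0) + ∑ t, ∑ b, X t b * M.drift (M.proj Φ.Fᶜ) t b q

/-- Expected numbers of exits that can be realized. -/
structure IsExitFlow (Φ : WRObjective M) (X : S → A → ℝ) : Prop where
  nonneg : ∀ s a, 0 ≤ X s a
  eq_zero : ∀ s a, ¬ IsExit Φ s a → X s a = 0
  orig : ∀ s ∉ Φ.F, ∀ hs, exitBalance Φ X (.orig s hs) = 0
  collapsed : ∀ C, 0 ≤ exitBalance Φ X (.collapsed C)

/-- The potential of the quotient is pulled back along `proj`. An exit acts on classes as an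
available action of the quotient, so the potential drops; other available actions keep the class and
hence the value. In particular they cannot enter a target from outside. -/
theorem exists_potential_isExit (Φ : WRObjective M) :
    ∃ f η, M.Potential Φ.F (IsExit Φ) f η := by
  classical
  have := Fintype.ofFinite (QState M Φ.Fᶜ)
  obtain ⟨f, η, hf⟩ := mecQuotient_exists_potential Φ
  have hsum : ∀ s a, ∑ t, M.pr s a t * f (M.proj Φ.Fᶜ t) =
      ∑ q, (M.mecQuotient Φ.Fᶜ).pr (M.proj Φ.Fᶜ s) (some (s, a)) q * f q := by
    intro s a
    simp only [mecQuotient_pr_some, Finset.sum_mul]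
    rw [← Finset.sum_fiberwise Finset.univ (M.proj Φ.Fᶜ)]
    refine Finset.sum_congr rfl fun q _ => Finset.sum_congr rfl fun t ht => ?_
    rw [(Finset.mem_filter.1 ht).2]
  have hexit : ∀ s a, IsExit Φ s a →
      ∑ t, M.pr s a t * f (M.proj Φ.Fᶜ t) ≤ f (M.proj Φ.Fᶜ s) - η := by
    intro s a h
    rw [hsum]
    exact hf.drop _ (fun h' => h.1 ((proj_mem_quotientEnd Φ).1 h')) _ h.some_mem_avail trivial
  have hstay : ∀ s, ∀ a ∈ M.avail s, ¬ IsExit Φ s a →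
      ∑ t, M.pr s a t * f (M.proj Φ.Fᶜ t) = f (M.proj Φ.Fᶜ s) := by
    intro s a ha h
    have : ∀ t, M.pr s a t * f (M.proj Φ.Fᶜ t) = M.pr s a t * f (M.proj Φ.Fᶜ s) := by
      intro t
      by_cases ht : M.pr s a t = 0
      · rw [ht, zero_mul, zero_mul]
      · rw [proj_eq_of_not_isExit ha h ht]
    simp only [this, ← Finset.sum_mul, sum_pr, one_mul]
  refine ⟨fun s => f (M.proj Φ.Fᶜ s), η, hf.pos, fun s => hf.nonneg _,
    fun s hs => hf.zero _ ((proj_mem_quotientEnd Φ).2 hs), Φ.absorbing, fun s _ a ha => ?_,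
    fun s _ a _ h => hexit s a h, fun s hs a ha h t ht => ?_⟩
  · by_cases h : IsExit Φ s a
    · linarith [hexit s a h, hf.pos]
    · exact (hstay s a ha h).le
  · by_contra hne
    have := proj_eq_of_not_isExit ha h hne
    rw [eq_of_proj_eq_target Φ ht this.symm] at hs
    exact hs ht

theorem sum_filter_of_iff {ι : Type*} [Fintype ι] {p : ι → Prop} [DecidablePred p] {i : ι}
    (h : ∀ j, p j ↔ j = i) (g : ι → ℝ) : ∑ j with p j, g j = g i := by
  rw [Finset.sum_filter, Finset.sum_eq_single i]
  · rw [if_pos ((h i).2 rfl)]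
  · intro j _ hj
    rw [if_neg fun hp => hj ((h j).1 hp)]
  · simp

/-- The exits of a flow of an MDP. -/
theorem IsFlow.exists_isExitFlow {x : ℕ → S → A → ℝ} (hx : M.IsFlow x) :
    ∃ X, IsExitFlow Φ X ∧ ∀ s ∈ Φ.F, Tendsto (fun n => mass x n s) atTop
      (𝓝 (exitBalance Φ X (M.proj Φ.Fᶜ s))) := by
  classical
  obtain ⟨f, η, hf⟩ := exists_potential_isExit Φ
  set X : S → A → ℝ := fun s a => if IsExit Φ s a then ∑' n, x n s a else 0 with hX
  have hsum : ∀ s a, IsExit Φ s a → Summable fun n => x n s a := fun s a h =>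
    hx.summable hf h.1 h
  have hlim : ∀ q, Tendsto (fun n => ∑ s with M.proj Φ.Fᶜ s = q, mass x n s) atTop
      (𝓝 (exitBalance Φ X q)) := fun q =>
    hx.tendsto_mass (M.proj Φ.Fᶜ) hsum (fun t b hb h s hs => proj_eq_of_not_isExit hb h hs)
      (fun s a h => if_pos h) (fun s a h => if_neg h) q
  refine ⟨X, ⟨?_, fun s a h => if_neg h, ?_, ?_⟩, ?_⟩
  · intro s a
    simp only [hX]
    split_ifs
    · exact tsum_nonneg fun n => hx.nonneg n s a
    · exact le_rfl
  · intro s hsF hs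
    refine tendsto_nhds_unique (hlim _) ?_
    simp only [sum_filter_of_iff fun t => M.proj_eq_orig_iff Φ.Fᶜ t s hs]
    -- At a non-target outside of the components every available action is an exit, so its uses are
    -- summable and the mass there dies out.
    have h1 : ∀ a, Tendsto (fun n => x n s a) atTop (𝓝 0) := by
      intro a
      by_cases ha : a ∈ M.avail s
      · exact (hsum s a ⟨hsF, ha, fun C hC => hs C (C.isEC.acts_subset _ hC).1⟩).tendsto_atTop_zero
      · simp [hx.avail _ s a ha]
    simpa [mass] using tendsto_finsetSum Finset.univ fun a _ => h1 a
  · exact fun C => ge_of_tendsto' (hlim _) fun n => Finset.sum_nonneg fun s _ => hx.mass_nonneg n s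
  · intro s hs
    have := hlim (M.proj Φ.Fᶜ s)
    rw [M.proj_of_notMem _ s (target_notMem Φ hs)] at this ⊢
    simpa only [sum_filter_of_iff fun t => M.proj_eq_orig_iff Φ.Fᶜ t s _] using this

theorem sum_option_prod {f : Option (S × A) → ℝ} :
    ∑ α, f α = f none + ∑ s, ∑ a, f (some (s, a)) := by
  rw [Fintype.sum_option, Fintype.sum_prod_type]

theorem drift_id_some [DecidableEq (QState M Φ.Fᶜ)] [Fintype (QState M Φ.Fᶜ)]
    (s : S) (a : A) (q : QState M Φ.Fᶜ) :
    (M.mecQuotient Φ.Fᶜ).drift id (M.proj Φ.Fᶜ s) (some (s, a)) q =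
      M.drift (M.proj Φ.Fᶜ) s a q := by
  simp only [drift, id, Finset.filter_eq', Finset.mem_univ, if_true, Finset.sum_singleton,
    mecQuotient_pr_some]

theorem drift_id_none [DecidableEq (QState M Φ.Fᶜ)] [Fintype (QState M Φ.Fᶜ)]
    (q q' : QState M Φ.Fᶜ) (hq : q ≠ .sink) :
    (M.mecQuotient Φ.Fᶜ).drift id q' none q = if q' = q then -1 else 0 := by
  simp only [drift, id, Finset.filter_eq', Finset.mem_univ, if_true, Finset.sum_singleton,
    mecQuotient_pr_none, if_neg hq]
  split_ifs <;> simp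

/-- The exits of a flow of the MEC quotient. -/
theorem IsFlow.exists_isExitFlow_of_quotient [Fintype (QState M Φ.Fᶜ)]
    {x : ℕ → QState M Φ.Fᶜ → QAction S A → ℝ} (hx : (M.mecQuotient Φ.Fᶜ).IsFlow x) :
    ∃ X, IsExitFlow Φ X ∧ ∀ s ∈ Φ.F, Tendsto (fun n => mass x n (M.proj Φ.Fᶜ s)) atTop
      (𝓝 (exitBalance Φ X (M.proj Φ.Fᶜ s))) := by
  classical
  obtain ⟨f, η, hf⟩ := mecQuotient_exists_potential Φ
  set Z : QState M Φ.Fᶜ → QAction S A → ℝ :=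
    fun q α => if q ∉ quotientEnd Φ then ∑' n, x n q α else 0 with hZ
  have hsum : ∀ q α, q ∉ quotientEnd Φ → Summable fun n => x n q α :=
    fun q α h => hx.summable hf h trivial
  have hZ0 : ∀ q α, 0 ≤ Z q α := by
    intro q α
    simp only [hZ]
    split_ifs
    · exact le_rfl
    · exact tsum_nonneg fun n => hx.nonneg n q α
  have hZav : ∀ q, ∀ α ∉ (M.mecQuotient Φ.Fᶜ).avail q, Z q α = 0 := by
    intro q α h
    simp only [hZ, hx.avail _ q α h, tsum_zero, ite_self]
  set X : S → A → ℝ := fun s a => Z (M.proj Φ.Fᶜ s) (some (s, a)) with hX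
  have hlim : ∀ q, Tendsto (fun n => mass x n q) atTop
      (𝓝 ((if M.proj Φ.Fᶜ M.init = q then 1 else 0) +
        ∑ q', ∑ α, Z q' α * (M.mecQuotient Φ.Fᶜ).drift id q' α q)) := by
    intro q
    have := hx.tendsto_mass id (E := fun q _ => q ∉ quotientEnd Φ) hsum
      (by
        intro t b hb h s hs
        rw [pr_of_absorbing (quotientEnd_absorbing Φ t (not_not.1 h) b hb)] at hs
        exact (ite_ne_right_iff.1 hs).1)
      (X := Z) (fun s a h => if_pos h) (fun s a h => if_neg h) q
    simp only [sum_filter_of_iff fun t => (Iff.rfl : id t = q ↔ t = q)] at this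
    exact this
  -- The drift in the quotient is that of the original actions, except that each use of `stay` in
  -- `q` removes one unit. An original action is available only in the class of its state, so the
  -- sum over states of the quotient collapses.
  have hbal : ∀ q, q ≠ .sink → (if M.proj Φ.Fᶜ M.init = q then 1 else 0) +
      ∑ q', ∑ α, Z q' α * (M.mecQuotient Φ.Fᶜ).drift id q' α q =
      exitBalance Φ X q - Z q none := by
    intro q hq
    rw [exitBalance, add_sub_assoc]
    congr 1
    simp only [sum_option_prod, Finset.sum_add_distrib, drift_id_none Φ q _ hq]
    have h1 : ∑ q', Z q' none * (if q' = q then -1 else 0) = - Z q none := by simp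
    rw [h1, add_comm, ← sub_eq_add_neg]
    congr 1
    rw [Finset.sum_comm]
    refine Finset.sum_congr rfl fun s _ => ?_
    rw [Finset.sum_comm]
    refine Finset.sum_congr rfl fun a _ => ?_
    rw [Finset.sum_eq_single (M.proj Φ.Fᶜ s)]
    · rw [drift_id_some]
    · intro q' _ hne
      rw [hZav, zero_mul]
      exact fun h => hne ((M.some_mem_avail_iff _ q' s a).1 h).1.symm
    · simp
  have hnone : ∀ s hs, Z (.orig s hs) none = 0 := fun s hs =>
    hZav _ _ fun h => (M.none_mem_avail_iff _ _).1 h s hs rfl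
  -- Transient states lose all their mass, so the balance of `q` is the expected number of uses of
  -- `stay` in `q`. This explains both its sign at components and its vanishing at states without
  -- `stay`.
  have hzero : ∀ q ∉ quotientEnd Φ, exitBalance Φ X q = Z q none := by
    intro q hq
    have h1 := tendsto_nhds_unique (hlim q) (hx.tendsto_mass_zero hf hq)
    rw [hbal q fun h => hq (Or.inr h)] at h1
    exact sub_eq_zero.1 h1
  refine ⟨X, ⟨fun s a => hZ0 _ _, ?_, ?_, ?_⟩, ?_⟩
  · intro s a h
    by_cases hs : s ∈ Φ.F
    · exact if_neg (not_not.2 ((proj_mem_quotientEnd Φ).2 hs))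
    · refine hZav _ _ fun h' => h ⟨hs, ((M.some_mem_avail_iff _ _ s a).1 h').2⟩
  · intro s hsF hs
    rw [hzero, hnone]
    rw [← M.proj_of_notMem _ s hs, proj_mem_quotientEnd]
    exact hsF
  · intro C
    rw [hzero]
    · exact hZ0 _ _
    · rintro (⟨s, hs, e, -⟩ | e) <;> cases e
  · intro s hs
    have := hlim (M.proj Φ.Fᶜ s)
    rw [hbal _ (M.proj_ne_sink _ s), M.proj_of_notMem _ s (target_notMem Φ hs), hnone,
      sub_zero] at this
    rw [M.proj_of_notMem _ s (target_notMem Φ hs)]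
    exact this

theorem exitBalance_eq [DecidableEq (QState M Φ.Fᶜ)] (X : S → A → ℝ) (q : QState M Φ.Fᶜ) :
    exitBalance Φ X q = (if M.proj Φ.Fᶜ M.init = q then 1 else 0) +
      ∑ t, ∑ b, X t b * ∑ s with M.proj Φ.Fᶜ s = q, M.pr t b s -
      ∑ t with M.proj Φ.Fᶜ t = q, ∑ b, X t b := by
  rw [exitBalance, add_sub_assoc]
  congr 1
  · congr
  · simp only [drift, mul_sub, Finset.sum_sub_distrib]
    congr 1
    · simp only [Finset.sum_filter]
      congr!
    · rw [Finset.sum_filter]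
      refine Finset.sum_congr rfl fun t _ => ?_
      split_ifs <;> simp

/-- Exit flows are realized in the MEC quotient. -/
theorem IsExitFlow.exists_flow_quotient {Φ : WRObjective M} [Fintype (QState M Φ.Fᶜ)]
    {X : S → A → ℝ} (hX : IsExitFlow Φ X) :
    ∃ x, (M.mecQuotient Φ.Fᶜ).IsFlow x ∧
      ∀ s ∈ Φ.F, Tendsto (fun n => mass x n (M.proj Φ.Fᶜ s)) atTop
        (𝓝 (exitBalance Φ X (M.proj Φ.Fᶜ s))) := by
  classical
  obtain ⟨f, η, hf⟩ := mecQuotient_exists_potential Φ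
  -- `stay` is used in a component as often as its balance requires.
  set Y : QState M Φ.Fᶜ → QAction S A → ℝ := fun q α => match α with
    | some (s, a) => if M.proj Φ.Fᶜ s = q then X s a else 0
    | none => match q with
      | .collapsed C => exitBalance Φ X (.collapsed C)
      | _ => 0 with hY
  have hYs : ∀ q s a, Y q (some (s, a)) = if M.proj Φ.Fᶜ s = q then X s a else 0 :=
    fun _ _ _ => rfl
  have hY0 : ∀ q α, 0 ≤ Y q α := by
    intro q α
    cases α with
    | none =>
      cases q with
      | collapsed C => exact hX.collapsed C
      | orig s hs => exact le_rfl
      | sink => exact le_rfl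
    | some p =>
      rw [hYs]
      split_ifs
      · exact hX.nonneg _ _
      · exact le_rfl
  have hin : ∀ q, q ≠ .sink → ∑ q', ∑ α, Y q' α * (M.mecQuotient Φ.Fᶜ).pr q' α q =
      ∑ t, ∑ b, X t b * ∑ s with M.proj Φ.Fᶜ s = q, M.pr t b s := by
    intro q hq
    simp only [sum_option_prod, mecQuotient_pr_none, if_neg hq, mul_zero, zero_add]
    rw [Finset.sum_comm]
    refine Finset.sum_congr rfl fun s _ => ?_
    rw [Finset.sum_comm]
    refine Finset.sum_congr rfl fun a _ => ?_
    simp only [hYs, mecQuotient_pr_some]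
    simp
  have hbalX : ∀ q, q ≠ .sink → (if M.proj Φ.Fᶜ M.init = q then 1 else 0) +
      ∑ q', ∑ α, Y q' α * (M.mecQuotient Φ.Fᶜ).pr q' α q =
      exitBalance Φ X q + ∑ t with M.proj Φ.Fᶜ t = q, ∑ b, X t b := by
    intro q hq
    rw [hin q hq, exitBalance_eq]
    ring
  have hKX : ∀ q ∈ quotientEnd Φ, ∀ s a, M.proj Φ.Fᶜ s = q → X s a = 0 := by
    rintro q hq s a rfl
    exact hX.eq_zero s a fun h => h.1 ((proj_mem_quotientEnd Φ).1 hq)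
  -- No mass has to be stopped here: whatever remains in a component moves to the sink.
  obtain ⟨x, hx, hlim⟩ := hf.exists_flow (Y := Y) (θ := fun _ => 0) (β := fun _ _ => 0) (Θ := ∅)
    hY0
    (by
      intro q α hα
      cases α with
      | none =>
        cases q with
        | collapsed C => exact (hα (Or.inr rfl)).elim
        | orig s hs => rfl
        | sink => rfl
      | some p =>
        obtain ⟨s, a⟩ := p
        rw [hYs]
        split_ifs with h
        · refine hX.eq_zero s a fun h' => hα ?_
          rw [← h]
          exact h'.some_mem_avail
        · rfl)
    (by
      intro q hq α
      cases α with
      | none =>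
        cases q with
        | collapsed C => rcases hq with ⟨s, hs, e, -⟩ | e <;> cases e
        | orig s hs => rfl
        | sink => rfl
      | some p =>
        rw [hYs]
        split_ifs with h
        · exact hKX q hq _ _ h
        · rfl)
    (fun _ => le_rfl) (fun _ _ => rfl) (fun _ h => h.elim) (fun _ _ => le_rfl) (fun _ _ _ => rfl)
    (fun _ h => h.elim) (fun _ h => h.elim)
    (by
      intro q hq
      have hsink : q ≠ .sink := fun h => hq (Or.inr h)
      have e : (if q = (M.mecQuotient Φ.Fᶜ).init then (1 : ℝ) else 0) =
          if M.proj Φ.Fᶜ M.init = q then 1 else 0 := if_congr eq_comm rfl rfl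
      rw [e, hbalX q hsink, add_zero, sum_option_prod]
      congr 1
      · cases q with
        | collapsed C => rfl
        | orig s hs =>
          refine (hX.orig s (fun h => hq (Or.inl ⟨s, hs, rfl, h⟩)) hs).symm
        | sink => exact (hsink rfl).elim
      · rw [Finset.sum_filter]
        refine Finset.sum_congr rfl fun s _ => ?_
        simp only [hYs, Finset.sum_ite_irrel, Finset.sum_const_zero])
  refine ⟨x, hx, fun s hs => ?_⟩
  have h1 := hlim (M.proj Φ.Fᶜ s) ((proj_mem_quotientEnd Φ).2 hs)
  have e : (if M.proj Φ.Fᶜ s = (M.mecQuotient Φ.Fᶜ).init then (1 : ℝ) else 0) =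
      if M.proj Φ.Fᶜ M.init = M.proj Φ.Fᶜ s then 1 else 0 := if_congr eq_comm rfl rfl
  rw [e, hbalX _ (M.proj_ne_sink _ s)] at h1
  rwa [Finset.sum_eq_zero, add_zero] at h1
  intro t ht
  exact Finset.sum_eq_zero fun b _ =>
    hKX _ ((proj_mem_quotientEnd Φ).2 hs) t b (Finset.mem_filter.1 ht).2

end MDP

open Filter Topology

/-! ### Staying in a component and realizing exit flows in the MDP -/

namespace MDP

variable {S : Type u} {A : Type v} [Fintype S] [Fintype A] {M : MDP S A} {Φ : WRObjective M}

open Classical in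
/-- The uniform policy on the actions of the maximal end components. -/
noncomputable def stayPolicy (M : MDP S A) (U : Set S) (s : S) (a : A) : ℝ :=
  if ∃ C : M.MEC U, (s, a) ∈ C.B then
    ((Finset.univ.filter fun b => ∃ C : M.MEC U, (s, b) ∈ C.B).card : ℝ)⁻¹ else 0

section StayPolicy

variable (M) (U : Set S)

theorem stayPolicy_nonneg (s : S) (a : A) : 0 ≤ M.stayPolicy U s a := by
  unfold stayPolicy
  split_ifs
  · positivity
  · exact le_rfl

theorem stayPolicy_pos_iff (s : S) (a : A) :
    M.stayPolicy U s a ≠ 0 ↔ ∃ C : M.MEC U, (s, a) ∈ C.B := by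
  classical
  unfold stayPolicy
  split_ifs with h
  · refine iff_of_true (inv_ne_zero ?_) h
    exact Nat.cast_ne_zero.2 (Finset.card_ne_zero.2 ⟨a, by simpa using h⟩)
  · exact iff_of_false (not_not.2 rfl) h

theorem sum_stayPolicy {C : M.MEC U} {s : S} (hs : s ∈ C.T) : ∑ a, M.stayPolicy U s a = 1 := by
  classical
  have hex : ∃ a, (s, a) ∈ C.B := by
    obtain ⟨t, ⟨a, ha, _⟩, _⟩ := Relation.TransGen.head'_iff.1 (C.isEC.connected s hs s hs)
    exact ⟨a, ha⟩
  obtain ⟨a, ha⟩ := hex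
  unfold stayPolicy
  rw [← Finset.sum_filter, Finset.sum_const, nsmul_eq_mul, mul_inv_cancel₀]
  exact Nat.cast_ne_zero.2 (Finset.card_ne_zero.2 ⟨a, by simpa using ⟨C, ha⟩⟩)

theorem stayPolicy_closed {C : M.MEC U} {s : S} (hs : s ∈ C.T) {a : A}
    (ha : M.stayPolicy U s a ≠ 0) {t : S} (ht : M.pr s a t ≠ 0) : t ∈ C.T := by
  obtain ⟨D, hD⟩ := (M.stayPolicy_pos_iff U s a).1 ha
  rw [← C.eq_of_mem D hs (D.isEC.acts_subset _ hD).1] at hD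
  refine C.isEC.closed _ hD ?_
  rw [← pr_pos_iff]
  exact lt_of_le_of_ne (M.pr_nonneg _ _ _) (Ne.symm ht)

/-- Within a maximal end component, every balanced demand is met by visits under the uniform
policy. -/
theorem MEC.exists_circulation {M : MDP S A} {U : Set S} (C : M.MEC U)
    [DecidablePred (· ∈ C.T)] {d : S → ℝ} (hd : ∑ s with s ∈ C.T, d s = 0) :
    ∃ w : S → ℝ, (∀ s, 0 ≤ w s) ∧ ∀ s ∈ C.T,
      w s - ∑ t with t ∈ C.T, w t * ∑ b, M.stayPolicy U t b * M.pr t b s = d s := by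
  classical
  have hsub : ∀ g : S → ℝ, ∑ s with s ∈ C.T, g s = ∑ i : C.T, g i := by
    exact fun g => Finset.sum_subtype _ (by simp) g
  set P : C.T → C.T → ℝ := fun i j => ∑ b, M.stayPolicy U i b * M.pr i b j with hP
  have hP0 : ∀ i j, 0 ≤ P i j := fun i j =>
    Finset.sum_nonneg fun b _ => mul_nonneg (M.stayPolicy_nonneg U _ b) (M.pr_nonneg _ _ _)
  have hP1 : ∀ i, ∑ j, P i j = 1 := by
    intro i
    simp only [hP]
    rw [Finset.sum_comm, ← M.sum_stayPolicy U i.2]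
    refine Finset.sum_congr rfl fun b _ => ?_
    rw [← Finset.mul_sum, ← hsub fun s => M.pr i b s]
    by_cases hb : M.stayPolicy U i b = 0
    · rw [hb, zero_mul]
    · rw [Finset.sum_filter_of_ne fun t _ ht => M.stayPolicy_closed U i.2 hb ht, sum_pr, mul_one]
  have hirr : ∀ i j, Relation.TransGen (fun i j => 0 < P i j) i j := by
    intro i j
    have hstep : ∀ (i j : C.T), (∃ a, ((i : S), a) ∈ C.B ∧ (j : S) ∈ (M.δ i a).support) →
        0 < P i j := by
      rintro i j ⟨a, ha, hj⟩
      have h1 : 0 < M.stayPolicy U i a := lt_of_le_of_ne (M.stayPolicy_nonneg U _ _)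
        (Ne.symm ((M.stayPolicy_pos_iff U i a).2 ⟨C, ha⟩))
      exact (mul_pos h1 ((M.pr_pos_iff _ _ _).2 hj)).trans_le
        (Finset.single_le_sum (f := fun b => M.stayPolicy U i b * M.pr i b j)
          (fun b _ => mul_nonneg (M.stayPolicy_nonneg U _ b) (M.pr_nonneg _ _ _))
          (Finset.mem_univ a))
    -- The paths that witness connectivity stay in the component, because every pair of `C.B` starts
    -- in `C.T`; so they lift to the subtype.
    have key : ∀ t, Relation.TransGen (fun x y => ∃ a, (x, a) ∈ C.B ∧ y ∈ (M.δ x a).support) i t →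
        ∀ ht : t ∈ C.T, Relation.TransGen (fun i j => 0 < P i j) i ⟨t, ht⟩ := by
      intro t h
      induction h with
      | single h => exact fun ht => Relation.TransGen.single (hstep i ⟨_, ht⟩ h)
      | tail _ h ih =>
        intro ht
        obtain ⟨a, ha, hy⟩ := h
        have hb := (C.isEC.acts_subset _ ha).1
        exact (ih hb).tail (hstep ⟨_, hb⟩ ⟨_, ht⟩ ⟨a, ha, hy⟩)
    exact key j (C.isEC.connected i i.2 j j.2) j.2
  obtain ⟨w, hw, hwd⟩ := CPTMDP.exists_circulation hP0 hP1 hirr (d := fun i => d i)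
    (by rw [← hsub d, hd])
  refine ⟨fun s => if h : s ∈ C.T then w ⟨s, h⟩ else 0, ?_, ?_⟩
  · intro s
    dsimp only
    split_ifs
    · exact hw _
    · exact le_rfl
  · intro s hs
    dsimp only
    rw [dif_pos hs, ← hwd ⟨s, hs⟩, hsub]
    congr 1
    refine Finset.sum_congr rfl fun i _ => ?_
    rw [dif_pos i.2]

end StayPolicy

/-- Exit flows are realized in the MDP. -/
theorem IsExitFlow.exists_flow {X : S → A → ℝ} (hX : IsExitFlow Φ X) :
    ∃ x, M.IsFlow x ∧ ∀ s ∈ Φ.F, Tendsto (fun n => mass x n s) atTop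
        (𝓝 (exitBalance Φ X (M.proj Φ.Fᶜ s))) := by
  classical
  obtain ⟨f, η, hf⟩ := exists_potential_isExit Φ
  set β := M.stayPolicy Φ.Fᶜ with hβ
  set e : S → ℝ := fun s => if s = M.init then 1 else 0 with he
  set inX : S → ℝ := fun s => ∑ t, ∑ b, X t b * M.pr t b s with hinX
  have hbalance : ∀ q, exitBalance Φ X q =
      ∑ s with M.proj Φ.Fᶜ s = q, (e s + inX s - ∑ a, X s a) := by
    intro q
    rw [exitBalance_eq, Finset.sum_sub_distrib, Finset.sum_add_distrib]
    congr 2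
    · simp [he]
    · simp only [hinX, Finset.mul_sum]
      symm
      rw [Finset.sum_comm]
      refine Finset.sum_congr rfl fun t _ => ?_
      rw [Finset.sum_comm]
  choose root hroot using fun C : M.MEC Φ.Fᶜ => C.isEC.states_nonempty
  -- The mass that remains in a component forever is stopped at one chosen state of it.
  set θ : S → ℝ := fun s => match M.proj Φ.Fᶜ s with
    | .collapsed C => if s = root C then exitBalance Φ X (.collapsed C) else 0
    | _ => 0 with hθ
  have hθC : ∀ C : M.MEC Φ.Fᶜ, ∀ s ∈ C.T,
      θ s = if s = root C then exitBalance Φ X (.collapsed C) else 0 := by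
    intro C s hs
    simp only [hθ, (M.proj_eq_collapsed_iff Φ.Fᶜ s C).2 hs]
  have hθ0 : ∀ s, (∀ C : M.MEC Φ.Fᶜ, s ∉ C.T) → θ s = 0 := by
    intro s hs
    simp only [hθ, M.proj_of_notMem Φ.Fᶜ s hs]
  -- The demand at a state is initial mass plus inflow by exits, minus outflow by exits and stopped
  -- mass. Over the component it sums to zero, because the stopped mass is the balance.
  have hcirc : ∀ C : M.MEC Φ.Fᶜ, ∃ w : S → ℝ, (∀ s, 0 ≤ w s) ∧ ∀ s ∈ C.T,
      w s - ∑ t with t ∈ C.T, w t * ∑ b, β t b * M.pr t b s =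
        e s + inX s - ∑ a, X s a - θ s := by
    intro C
    refine C.exists_circulation ?_
    rw [Finset.sum_sub_distrib, sub_eq_zero]
    have h1 := hbalance (.collapsed C)
    simp only [proj_eq_collapsed_iff] at h1
    rw [← h1, Finset.sum_congr rfl fun s hs => hθC C s (Finset.mem_filter.1 hs).2,
      Finset.sum_ite_eq', if_pos]
    exact Finset.mem_filter.2 ⟨Finset.mem_univ _, hroot C⟩
  choose W hW0 hW using hcirc
  set w : S → ℝ := fun s => match M.proj Φ.Fᶜ s with
    | .collapsed C => W C s
    | _ => 0 with hw
  have hwC : ∀ C : M.MEC Φ.Fᶜ, ∀ s ∈ C.T, w s = W C s := by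
    intro C s hs
    simp only [hw, (M.proj_eq_collapsed_iff Φ.Fᶜ s C).2 hs]
  have hw0 : ∀ s, (∀ C : M.MEC Φ.Fᶜ, s ∉ C.T) → w s = 0 := by
    intro s hs
    simp only [hw, M.proj_of_notMem Φ.Fᶜ s hs]
  have hwn : ∀ s, 0 ≤ w s := by
    intro s
    by_cases hs : ∃ C : M.MEC Φ.Fᶜ, s ∈ C.T
    · obtain ⟨C, hC⟩ := hs
      rw [hwC C s hC]
      exact hW0 C s
    · rw [hw0 s fun C hC => hs ⟨C, hC⟩]
  have hθn : ∀ s, 0 ≤ θ s := by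
    intro s
    by_cases hs : ∃ C : M.MEC Φ.Fᶜ, s ∈ C.T
    · obtain ⟨C, hC⟩ := hs
      rw [hθC C s hC]
      split_ifs
      · exact hX.collapsed C
      · exact le_rfl
    · rw [hθ0 s fun C hC => hs ⟨C, hC⟩]
  have hβF : ∀ s a, β s a ≠ 0 → s ∉ Φ.F ∧ a ∈ M.avail s ∧ ¬ IsExit Φ s a := by
    intro s a h
    obtain ⟨C, hC⟩ := (M.stayPolicy_pos_iff _ s a).1 h
    exact ⟨C.subset (C.isEC.acts_subset _ hC).1, (C.isEC.acts_subset _ hC).2,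
      fun h => h.2.2 C hC⟩
  -- The circulation is added to the exits. It uses only actions inside components, so it affects
  -- neither the flow between classes nor the targets.
  set Y : S → A → ℝ := fun s a => X s a + w s * β s a with hY
  have hYin : ∀ s, ∑ t, ∑ b, Y t b * M.pr t b s = inX s +
      ∑ t with M.proj Φ.Fᶜ t = M.proj Φ.Fᶜ s, w t * ∑ b, β t b * M.pr t b s := by
    intro s
    simp only [hY, add_mul, Finset.sum_add_distrib]
    congr 1
    rw [Finset.sum_filter_of_ne]
    · simp only [Finset.mul_sum, mul_assoc]
    · intro t _ ht
      obtain ⟨b, _, hb⟩ := Finset.exists_ne_zero_of_sum_ne_zero (right_ne_zero_of_mul ht)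
      obtain ⟨_, hav, hE⟩ := hβF t b (left_ne_zero_of_mul hb)
      exact (proj_eq_of_not_isExit hav hE (right_ne_zero_of_mul hb)).symm
  have hYin0 : ∀ s, (∀ C : M.MEC Φ.Fᶜ, s ∉ C.T) → ∑ t, ∑ b, Y t b * M.pr t b s = inX s := by
    intro s hs
    rw [hYin, M.proj_of_notMem Φ.Fᶜ s hs,
      sum_filter_of_iff fun t => M.proj_eq_orig_iff Φ.Fᶜ t s hs, hw0 s hs, zero_mul, add_zero]
  have hbal0 : ∀ s, ∀ hs : (∀ C : M.MEC Φ.Fᶜ, s ∉ C.T),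
      exitBalance Φ X (.orig s hs) = e s + inX s - ∑ a, X s a := by
    intro s hs
    rw [hbalance, sum_filter_of_iff fun t => M.proj_eq_orig_iff Φ.Fᶜ t s hs]
  obtain ⟨x, hx, hlim⟩ := hf.exists_flow (Y := Y) (θ := θ) (β := β)
    (Θ := {s | ∃ C : M.MEC Φ.Fᶜ, s ∈ C.T})
    (fun s a => add_nonneg (hX.nonneg s a) (mul_nonneg (hwn s) (M.stayPolicy_nonneg _ s a)))
    (by
      intro s a ha
      have h1 : β s a = 0 := by
        by_contra h
        exact ha (hβF s a h).2.1
      simp only [hY, h1, mul_zero, add_zero]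
      exact hX.eq_zero s a fun h => ha h.2.1)
    (by
      intro s hs a
      have h1 : β s a = 0 := by
        by_contra h
        exact (hβF s a h).1 hs
      simp only [hY, h1, mul_zero, add_zero]
      exact hX.eq_zero s a fun h => h.1 hs)
    hθn (fun s hs => hθ0 s fun C hC => hs ⟨C, hC⟩) (fun s ⟨C, hC⟩ => C.subset hC)
    (fun s a => M.stayPolicy_nonneg _ s a)
    (by
      intro s a ha
      by_contra h
      exact ha (hβF s a h).2.1)
    (fun s ⟨C, hC⟩ => M.sum_stayPolicy _ hC)
    (fun s ⟨C, hC⟩ a ha t ht => ⟨C, M.stayPolicy_closed _ hC ha ht⟩)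
    (by
      intro s hsF
      by_cases hs : ∃ C : M.MEC Φ.Fᶜ, s ∈ C.T
      · obtain ⟨C, hC⟩ := hs
        have h1 := hW C s hC
        rw [hYin, (M.proj_eq_collapsed_iff Φ.Fᶜ s C).2 hC]
        simp only [proj_eq_collapsed_iff]
        have h2 : ∑ t with t ∈ C.T, w t * ∑ b, β t b * M.pr t b s =
            ∑ t with t ∈ C.T, W C t * ∑ b, β t b * M.pr t b s :=
          Finset.sum_congr rfl fun t ht => by rw [hwC C t (Finset.mem_filter.1 ht).2]
        rw [h2]
        simp only [hY, Finset.sum_add_distrib, ← Finset.mul_sum]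
        rw [M.sum_stayPolicy _ hC, hwC C s hC]
        linarith
      · have hs' : ∀ C : M.MEC Φ.Fᶜ, s ∉ C.T := fun C hC => hs ⟨C, hC⟩
        rw [hYin0 s hs', hθ0 s hs']
        have h1 := hX.orig s hsF hs'
        rw [hbal0] at h1
        simp only [hY, hw0 s hs', zero_mul, add_zero]
        linarith)
  refine ⟨x, hx, fun s hs => ?_⟩
  have h1 := hlim s hs
  have hs' := target_notMem Φ hs
  rw [hYin0 s hs'] at h1
  rw [M.proj_of_notMem _ s hs', hbal0]
  have h2 : ∑ a, X s a = 0 := Finset.sum_eq_zero fun a _ => hX.eq_zero s a fun h => h.1 hs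
  rwa [h2, sub_zero]

/-! ## Prospects and CPT-values -/

section Law

variable {S' : Type*} {A' : Type*} [Fintype S'] [Fintype A'] {M' : MDP S' A'}
  {Φ' : WRObjective M'}

/-- The law of the payoff is determined by the limit probabilities of the targets. -/
theorem payoff_law_eq {σ : Strategy M} {σ' : Strategy M'} (τ : S → S')
    (hτ : Set.BijOn τ Φ.F Φ'.F) (hr : ∀ s ∈ Φ.F, Φ'.r (τ s) = Φ.r s) {L : S → ℝ}
    (h : ∀ s ∈ Φ.F, Tendsto (fun n => mass (M.marginal σ) n s) atTop (𝓝 (L s)))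
    (h' : ∀ s ∈ Φ.F, Tendsto (fun n => mass (M'.marginal σ') n (τ s)) atTop (𝓝 (L s))) (o : ℝ) :
    (M.pathMeasure σ).real {ρ | Φ.payoff ρ = o} = (M'.pathMeasure σ').real {ρ | Φ'.payoff ρ = o} := by
  classical
  -- With `p` selecting the rewards equal to `o` this handles nonzero outcomes; with `p` trivial it
  -- gives the probability of any target, whose complement is the outcome `0`.
  have key : ∀ p : ℚ → Prop,
      (M.pathMeasure σ).real {ρ | ∃ n, (ρ n).state ∈ {s | s ∈ Φ.F ∧ p (Φ.r s)}} =
      (M'.pathMeasure σ').real {ρ | ∃ n, (ρ n).state ∈ {s | s ∈ Φ'.F ∧ p (Φ'.r s)}} := by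
    intro p
    have h1 := M.tendsto_mass σ {s | s ∈ Φ.F ∧ p (Φ.r s)} fun s hs => Φ.absorbing s hs.1
    have h2 := M'.tendsto_mass σ' {s | s ∈ Φ'.F ∧ p (Φ'.r s)} fun s hs => Φ'.absorbing s hs.1
    have h3 : Tendsto (fun n => ∑ s with s ∈ {s | s ∈ Φ.F ∧ p (Φ.r s)}, mass (M.marginal σ) n s)
        atTop (𝓝 (∑ s with s ∈ {s | s ∈ Φ.F ∧ p (Φ.r s)}, L s)) :=
      tendsto_finsetSum _ fun s hs => h s (Finset.mem_filter.1 hs).2.1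
    have h4 : Tendsto (fun n => ∑ s with s ∈ {s | s ∈ Φ.F ∧ p (Φ.r s)},
        mass (M'.marginal σ') n (τ s))
        atTop (𝓝 (∑ s with s ∈ {s | s ∈ Φ.F ∧ p (Φ.r s)}, L s)) :=
      tendsto_finsetSum _ fun s hs => h' s (Finset.mem_filter.1 hs).2.1
    rw [tendsto_nhds_unique h1 h3]
    refine tendsto_nhds_unique (h4.congr fun n => ?_) h2
    refine Finset.sum_bij (fun s _ => τ s) ?_ ?_ ?_ fun _ _ => rfl
    · intro s hs
      have hs := (Finset.mem_filter.1 hs).2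
      exact Finset.mem_filter.2 ⟨Finset.mem_univ _, hτ.mapsTo hs.1, by
        rw [hr s hs.1]
        exact hs.2⟩
    · intro s hs t ht e
      exact hτ.injOn (Finset.mem_filter.1 hs).2.1 (Finset.mem_filter.1 ht).2.1 e
    · intro t ht
      have ht := (Finset.mem_filter.1 ht).2
      obtain ⟨s, hs, rfl⟩ := hτ.surjOn ht.1
      refine ⟨s, Finset.mem_filter.2 ⟨Finset.mem_univ _, hs, ?_⟩, rfl⟩
      rw [← hr s hs]
      exact ht.2
  by_cases ho : o = 0
  · subst ho
    have h1 := key fun _ => True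
    have h2 : {ρ : ℕ → Step S A | Φ.payoff ρ = 0} =
        {ρ | ∃ n, (ρ n).state ∈ {s | s ∈ Φ.F ∧ True}}ᶜ := by
      ext ρ
      simpa using payoff_eq_zero_iff Φ ρ
    have h3 : {ρ : ℕ → Step S' A' | Φ'.payoff ρ = 0} =
        {ρ | ∃ n, (ρ n).state ∈ {s | s ∈ Φ'.F ∧ True}}ᶜ := by
      ext ρ
      simpa using payoff_eq_zero_iff Φ' ρ
    rw [h2, h3, probReal_compl_eq_one_sub (measurableSet_reach _),
      probReal_compl_eq_one_sub (measurableSet_reach _), h1]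
  · have h1 := key fun r => (r : ℝ) = o
    rw [measureReal_congr (s := {ρ | Φ.payoff ρ = o})
      (t := {ρ | ∃ n, (ρ n).state ∈ {s | s ∈ Φ.F ∧ (Φ.r s : ℝ) = o}}),
      measureReal_congr (s := {ρ | Φ'.payoff ρ = o})
      (t := {ρ | ∃ n, (ρ n).state ∈ {s | s ∈ Φ'.F ∧ (Φ'.r s : ℝ) = o}}), h1]
    · filter_upwards [exists_payoff_iff Φ' σ' o ho] with ρ hρ
      exact propext hρ
    · filter_upwards [exists_payoff_iff Φ σ o ho] with ρ hρ
      exact propext hρ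

/-- For `o ≠ 0` the event agrees almost surely with a measurable reachability event, so null
measurability comes directly and suffices for additivity. -/
theorem measurableSet_payoff (Φ : WRObjective M) (σ : Strategy M) (o : ℝ) :
    NullMeasurableSet {ρ | Φ.payoff ρ = o} (M.pathMeasure σ) := by
  by_cases ho : o = 0
  · subst ho
    have h2 : {ρ : ℕ → Step S A | Φ.payoff ρ = 0} = {ρ | ∃ n, (ρ n).state ∈ Φ.F}ᶜ := by
      ext ρ
      simpa using payoff_eq_zero_iff Φ ρ
    rw [h2]
    exact (measurableSet_reach _).compl.nullMeasurableSet
  · refine (measurableSet_reach {s | s ∈ Φ.F ∧ (Φ.r s : ℝ) = o}).nullMeasurableSet.congr ?_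
    filter_upwards [exists_payoff_iff Φ σ o ho] with ρ hρ
    exact propext hρ.symm

theorem measureReal_payoff (Φ : WRObjective M) (σ : Strategy M) (p : ℝ → Prop) [DecidablePred p] :
    (M.pathMeasure σ).real {ρ | p (Φ.payoff ρ)} =
      ∑ o ∈ Φ.outcomes with p o, (M.pathMeasure σ).real {ρ | Φ.payoff ρ = o} := by
  have h : {ρ | p (Φ.payoff ρ)} = ⋃ o ∈ Φ.outcomes.filter p, {ρ | Φ.payoff ρ = o} := by
    ext ρ
    simp [payoff_mem_outcomes]
  rw [h]
  refine measureReal_biUnion_finset₀ ?_ fun o _ => measurableSet_payoff Φ σ o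
  intro x _ y _ hxy
  refine Disjoint.aedisjoint (Set.disjoint_left.2 ?_)
  intro ρ h1 h2
  exact hxy (h1.symm.trans h2)

end Law

theorem outcomes_quotient (Φ : WRObjective M) : Φ.quotient.outcomes = Φ.outcomes := by
  classical
  ext o
  unfold WRObjective.outcomes
  rw [Set.Finite.mem_toFinset, Set.Finite.mem_toFinset]
  refine or_congr Iff.rfl ⟨?_, ?_⟩
  · rintro ⟨q, ⟨s, hs, rfl, hF⟩, rfl⟩
    exact ⟨s, hF, rfl⟩
  · rintro ⟨s, hF, rfl⟩
    exact ⟨.orig s (target_notMem Φ hF), ⟨s, _, rfl, hF⟩, rfl⟩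

theorem payoff_law_quotient [Fintype (QState M Φ.Fᶜ)] {σ : Strategy M}
    {σ' : Strategy (M.mecQuotient Φ.Fᶜ)} {L : S → ℝ}
    (h : ∀ s ∈ Φ.F, Tendsto (fun n => mass (M.marginal σ) n s) atTop (𝓝 (L s)))
    (h' : ∀ s ∈ Φ.F, Tendsto (fun n => mass ((M.mecQuotient Φ.Fᶜ).marginal σ') n (M.proj Φ.Fᶜ s))
      atTop (𝓝 (L s))) (o : ℝ) :
    (M.pathMeasure σ).real {ρ | Φ.payoff ρ = o} =
      ((M.mecQuotient Φ.Fᶜ).pathMeasure σ').real {ρ | Φ.quotient.payoff ρ = o} := by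
  refine payoff_law_eq (Φ' := Φ.quotient) (M.proj Φ.Fᶜ) ⟨?_, ?_, ?_⟩ ?_ h h' o
  · exact fun s hs => (proj_mem_quotient_F Φ).2 hs
  · exact fun s hs t ht e => (eq_of_proj_eq_target Φ hs e.symm).symm
  · rintro q ⟨s, hs, rfl, hF⟩
    exact ⟨s, hF, M.proj_of_notMem _ s hs⟩
  · intro s hs
    rw [M.proj_of_notMem _ s (target_notMem Φ hs)]
    rfl

/-- Strategy, flow, exit flow, flow of the quotient, strategy: every passage keeps the limit masses
of the targets. The converse direction follows the same chain backwards. -/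
theorem exists_strategy_quotient (Φ : WRObjective M) (σ : Strategy M) :
    ∃ σ' : Strategy (M.mecQuotient Φ.Fᶜ), ∀ o : ℝ, (M.pathMeasure σ).real {ρ | Φ.payoff ρ = o} =
      ((M.mecQuotient Φ.Fᶜ).pathMeasure σ').real {ρ | Φ.quotient.payoff ρ = o} := by
  have := Fintype.ofFinite (QState M Φ.Fᶜ)
  obtain ⟨X, hX, hlim⟩ := (M.isFlow_marginal σ).exists_isExitFlow Φ
  obtain ⟨x, hx, hlim'⟩ := hX.exists_flow_quotient
  obtain ⟨σ', rfl⟩ := hx.exists_strategy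
  exact ⟨σ', payoff_law_quotient hlim hlim'⟩

theorem exists_strategy_of_quotient (Φ : WRObjective M) (σ' : Strategy (M.mecQuotient Φ.Fᶜ)) :
    ∃ σ : Strategy M, ∀ o : ℝ, (M.pathMeasure σ).real {ρ | Φ.payoff ρ = o} =
      ((M.mecQuotient Φ.Fᶜ).pathMeasure σ').real {ρ | Φ.quotient.payoff ρ = o} := by
  have := Fintype.ofFinite (QState M Φ.Fᶜ)
  obtain ⟨X, hX, hlim'⟩ := ((M.mecQuotient Φ.Fᶜ).isFlow_marginal σ').exists_isExitFlow_of_quotient Φ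
  obtain ⟨x, hx, hlim⟩ := hX.exists_flow
  obtain ⟨σ, rfl⟩ := hx.exists_strategy
  exact ⟨σ, payoff_law_quotient hlim hlim'⟩

theorem prospect_quotient_eq {σ : Strategy M} {σ' : Strategy (M.mecQuotient Φ.Fᶜ)}
    (h : ∀ o : ℝ, (M.pathMeasure σ).real {ρ | Φ.payoff ρ = o} =
      ((M.mecQuotient Φ.Fᶜ).pathMeasure σ').real {ρ | Φ.quotient.payoff ρ = o}) :
    M.prospect Φ σ = (M.mecQuotient Φ.Fᶜ).prospect Φ.quotient σ' := by
  -- The length and the index types of a prospect depend on the set of outcomes, so equality of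
  -- these sets is substituted with the sets generalized.
  have key : ∀ O O' : Finset ℝ, O = O' →
      (⟨O.card, O.orderEmbOfFin rfl, fun i =>
        (M.pathMeasure σ).real {ρ | Φ.payoff ρ = O.orderEmbOfFin rfl i}⟩ : Prospect) =
      ⟨O'.card, O'.orderEmbOfFin rfl, fun i =>
        (M.pathMeasure σ).real {ρ | Φ.payoff ρ = O'.orderEmbOfFin rfl i}⟩ := by
    rintro O _ rfl
    rfl
  refine (key _ _ (outcomes_quotient Φ).symm).trans ?_
  simp only [h]
  rfl

theorem range_prospect_quotient (Φ : WRObjective M) :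
    Set.range (M.prospect Φ) = Set.range ((M.mecQuotient Φ.Fᶜ).prospect Φ.quotient) := by
  ext x
  constructor
  · rintro ⟨σ, rfl⟩
    obtain ⟨σ', h⟩ := exists_strategy_quotient Φ σ
    exact ⟨σ', (prospect_quotient_eq h).symm⟩
  · rintro ⟨σ', rfl⟩
    obtain ⟨σ, h⟩ := exists_strategy_of_quotient Φ σ'
    exact ⟨σ, prospect_quotient_eq h⟩

theorem cptValProspect_quotient (Φ : WRObjective M) (c : CPTParams) :
    M.cptValProspect Φ c = (M.mecQuotient Φ.Fᶜ).cptValProspect Φ.quotient c := by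
  have h : ∀ {S : Type _} {A : Type _} [Finite S] [Finite A] (M : MDP S A) (Φ : WRObjective M),
      M.cptValProspect Φ c =
        ⨆ x ∈ Set.range (M.prospect Φ), ((Prospect.cpt c x : ℝ) : EReal) := by
    intro S A _ _ M Φ
    rw [iSup_range]
    rfl
  rw [h, range_prospect_quotient]
  unfold cptValProspect
  rw [iSup_range]

theorem cptVal_quotient (Φ : WRObjective M) (c : CPTParams) :
    M.cptVal Φ c = (M.mecQuotient Φ.Fᶜ).cptVal Φ.quotient c := by
  classical
  have := Fintype.ofFinite (QState M Φ.Fᶜ)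
  have key : ∀ (σ : Strategy M) (σ' : Strategy (M.mecQuotient Φ.Fᶜ)),
      (∀ o : ℝ, (M.pathMeasure σ).real {ρ | Φ.payoff ρ = o} =
        ((M.mecQuotient Φ.Fᶜ).pathMeasure σ').real {ρ | Φ.quotient.payoff ρ = o}) →
      ∀ p : ℝ → Prop, (M.pathMeasure σ).real {ρ | p (Φ.payoff ρ)} =
        ((M.mecQuotient Φ.Fᶜ).pathMeasure σ').real {ρ | p (Φ.quotient.payoff ρ)} := by
    intro σ σ' h p
    rw [measureReal_payoff, measureReal_payoff, outcomes_quotient]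
    exact Finset.sum_congr rfl fun o _ => h o
  unfold cptVal
  simp only [outcomes_quotient]
  refine le_antisymm (iSup_le fun σ => ?_) (iSup_le fun σ' => ?_)
  · obtain ⟨σ', h⟩ := exists_strategy_quotient Φ σ
    refine le_iSup_of_le σ' (le_of_eq ?_)
    have h1 := fun o : ℝ => key σ σ' h fun x => o ≤ x
    have h2 := fun o : ℝ => key σ σ' h fun x => o < x
    have h3 := fun o : ℝ => key σ σ' h fun x => x ≤ o
    have h4 := fun o : ℝ => key σ σ' h fun x => x < o
    simp only [h1, h2, h3, h4]
  · obtain ⟨σ, h⟩ := exists_strategy_of_quotient Φ σ'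
    refine le_iSup_of_le σ (le_of_eq ?_)
    have h1 := fun o : ℝ => key σ σ' h fun x => o ≤ x
    have h2 := fun o : ℝ => key σ σ' h fun x => o < x
    have h3 := fun o : ℝ => key σ σ' h fun x => x ≤ o
    have h4 := fun o : ℝ => key σ σ' h fun x => x < o
    simp only [h1, h2, h3, h4]

end MDP

/-! ## Polynomial-time functions -/

theorem eval_le_eval (p : Polynomial ℕ) {m n : ℕ} (h : m ≤ n) : p.eval m ≤ p.eval n := by
  rw [Polynomial.eval_eq_sum, Polynomial.eval_eq_sum]
  exact Finset.sum_le_sum fun i _ => Nat.mul_le_mul_left _ (Nat.pow_le_pow_left h i)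

theorem Data.size_pos (x : Data) : 0 < x.size := by
  cases x <;> simp [Data.size]

/-- Basic operations pay for their input and their output. So polynomial cost forces polynomial
output size, which is what makes polynomial-time computations compose. -/
theorem Prog.Runs.size_le {p : Prog} {x y : Data} {t : ℕ} (h : p.Runs x y t) :
    x.size ≤ t ∧ y.size ≤ t := by
  induction h with
  | op f x => omega
  | pair _ _ ih ih' =>
    simp only [Data.size]
    omega
  | comp _ _ ih ih' => omega
  | ite_true _ _ _ ih ih' => omega
  | ite_false _ _ ih ih' => omega
  | loop_done _ ih => omega
  | loop_step _ _ _ _ ih ih' ih'' => omega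

/-- A quantity is bounded by a polynomial in the size of the data `x i`. -/
def PolyBdd {ι : Type*} (x : ι → Data) (B : ι → ℕ) : Prop :=
  ∃ p : Polynomial ℕ, ∀ i, B i ≤ p.eval (x i).size

namespace PolyBdd

variable {ι : Type*} {x : ι → Data} {B B' : ι → ℕ}

theorem mono (h : PolyBdd x B') (hB : ∀ i, B i ≤ B' i) : PolyBdd x B :=
  let ⟨p, hp⟩ := h
  ⟨p, fun i => (hB i).trans (hp i)⟩

theorem add (h : PolyBdd x B) (h' : PolyBdd x B') : PolyBdd x fun i => B i + B' i :=
  let ⟨p, hp⟩ := h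
  let ⟨q, hq⟩ := h'
  ⟨p + q, fun i => by
    rw [Polynomial.eval_add]
    exact Nat.add_le_add (hp i) (hq i)⟩

theorem mul (h : PolyBdd x B) (h' : PolyBdd x B') : PolyBdd x fun i => B i * B' i :=
  let ⟨p, hp⟩ := h
  let ⟨q, hq⟩ := h'
  ⟨p * q, fun i => by
    rw [Polynomial.eval_mul]
    exact Nat.mul_le_mul (hp i) (hq i)⟩

theorem const (c : ℕ) : PolyBdd x fun _ => c :=
  ⟨Polynomial.C c, fun i => by rw [Polynomial.eval_C]⟩

theorem size : PolyBdd x fun i => (x i).size :=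
  ⟨Polynomial.X, fun i => by rw [Polynomial.eval_X]⟩

theorem poly (p : Polynomial ℕ) (h : PolyBdd x B) : PolyBdd x fun i => p.eval (B i) :=
  let ⟨q, hq⟩ := h
  ⟨p.comp q, fun i => by
    rw [Polynomial.eval_comp]
    exact eval_le_eval p (hq i)⟩

theorem comp {κ : Type*} (h : PolyBdd x B) (f : κ → ι) :
    PolyBdd (fun k => x (f k)) fun k => B (f k) :=
  let ⟨p, hp⟩ := h
  ⟨p, fun k => hp (f k)⟩

end PolyBdd

/-- One program computes `y i` from `x i` in polynomial time, for all `i`. -/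
def PolyData {ι : Type*} (x y : ι → Data) : Prop :=
  ∃ (P : Prog) (B : ι → ℕ), PolyBdd x B ∧ ∀ i, ∃ t, P.Runs (x i) (y i) t ∧ t ≤ B i

namespace PolyData

variable {ι : Type*} {x y z : ι → Data}

theorem polyBdd (h : PolyData x y) : PolyBdd x fun i => (y i).size :=
  let ⟨_, _, hB, h⟩ := h
  hB.mono fun i =>
    let ⟨_, ht, hle⟩ := h i
    ht.size_le.2.trans hle

theorem op (f : Op) (hy : ∀ i, f.apply (x i) = y i) (hB : PolyBdd x fun i => (y i).size) :
    PolyData x y :=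
  ⟨.op f, fun i => (x i).size + (y i).size + 1, (PolyBdd.size.add hB).add (PolyBdd.const 1),
    fun i => ⟨_, hy i ▸ Prog.Runs.op f (x i), by simp only [le_refl]⟩⟩

theorem comp (h : PolyData x y) (h' : PolyData y z) : PolyData x z := by
  have hy := h.polyBdd
  obtain ⟨P, B, hB, h⟩ := h
  obtain ⟨Q, B', ⟨q, hq⟩, h'⟩ := h'
  refine ⟨.comp P Q, fun i => B i + q.eval (y i).size + 1,
    (hB.add (hy.poly q)).add (PolyBdd.const 1), fun i => ?_⟩
  obtain ⟨t, ht, hle⟩ := h i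
  obtain ⟨t', ht', hle'⟩ := h' i
  exact ⟨_, ht.comp ht', by linarith [hq i]⟩

theorem pair (h : PolyData x y) (h' : PolyData x z) : PolyData x fun i => .pair (y i) (z i) := by
  obtain ⟨P, B, hB, h⟩ := h
  obtain ⟨Q, B', hB', h'⟩ := h'
  refine ⟨.pair P Q, fun i => B i + B' i + 1, (hB.add hB').add (PolyBdd.const 1), fun i => ?_⟩
  obtain ⟨t, ht, hle⟩ := h i
  obtain ⟨t', ht', hle'⟩ := h' i
  exact ⟨_, ht.pair ht', by linarith⟩

theorem id : PolyData x x := op .id (fun _ => rfl) PolyBdd.size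

theorem fst (h : PolyData x fun i => .pair (y i) (z i)) : PolyData x y :=
  h.comp (op .fst (fun _ => rfl) (PolyBdd.size.mono fun i => by
    simp only [Data.size]
    omega))

theorem snd (h : PolyData x fun i => .pair (y i) (z i)) : PolyData x z :=
  h.comp (op .snd (fun _ => rfl) (PolyBdd.size.mono fun i => by
    simp only [Data.size]
    omega))

theorem congr (h : PolyData x y) (e : ∀ i, y i = z i) : PolyData x z := by
  rwa [← funext e]

theorem num (n : ℕ) : PolyData x fun _ => .num n := op (.const n) (fun _ => rfl) (PolyBdd.const _)

theorem const (d : Data) : PolyData x fun _ => d := by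
  induction d with
  | num n => exact num n
  | pair a b iha ihb => exact iha.pair ihb

/-- Branching on a number. -/
theorem ite {c : ι → Data} {p : ι → Prop} [DecidablePred p] (hc : PolyData x c)
    (hcp : ∀ i, c i ≠ .num 0 ↔ p i) (h : PolyData x y) (h' : PolyData x z) :
    PolyData x fun i => if p i then y i else z i := by
  obtain ⟨C, B₀, hB₀, hc⟩ := hc
  obtain ⟨P, B, hB, h⟩ := h
  obtain ⟨Q, B', hB', h'⟩ := h'
  refine ⟨.ite C P Q, fun i => B₀ i + (B i + B' i) + 1,
    (hB₀.add (hB.add hB')).add (PolyBdd.const 1), fun i => ?_⟩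
  obtain ⟨t₀, ht₀, hle₀⟩ := hc i
  obtain ⟨t, ht, hle⟩ := h i
  obtain ⟨t', ht', hle'⟩ := h' i
  dsimp only
  by_cases hp : p i
  · rw [if_pos hp]
    exact ⟨_, .ite_true ht₀ ((hcp i).2 hp) ht, by linarith⟩
  · rw [if_neg hp]
    rw [not_ne_iff.1 (mt (hcp i).1 hp)] at ht₀
    exact ⟨_, .ite_false ht₀ ht', by linarith⟩

end PolyData

/-! ### Polynomial-time functions between encoded types -/

/-- Types whose elements are represented by data. -/
class Enc (α : Type*) where
  toData : α → Data

/-- The representation of an element. -/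
abbrev enc {α : Type*} [Enc α] (a : α) : Data := Enc.toData a

instance : Enc Data := ⟨id⟩
instance : Enc ℕ := ⟨.num⟩
instance : Enc Unit := ⟨fun _ => .num 0⟩
instance : Enc Bool := ⟨fun b => .num b.toNat⟩
instance {α β : Type*} [Enc α] [Enc β] : Enc (α × β) := ⟨fun a => .pair (enc a.1) (enc a.2)⟩
instance {α : Type*} [Enc α] : Enc (List α) := ⟨fun l => .list (l.map enc)⟩

/-- The size of the representation. -/
def esize {α : Type*} [Enc α] (a : α) : ℕ := (enc a).size

section Size

variable {α β : Type*} [Enc α] [Enc β]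

theorem esize_prod (a : α) (b : β) : esize (a, b) = esize a + esize b + 1 := rfl

theorem esize_nil : esize ([] : List α) = 1 := by
  simp [esize, enc, Enc.toData, Data.list, Data.size]

theorem esize_cons (a : α) (l : List α) : esize (a :: l) = esize a + esize l + 1 := rfl

theorem esize_pos (a : α) : 0 < esize a := Data.size_pos _

theorem length_le_esize (l : List α) : l.length ≤ esize l := by
  induction l with
  | nil => exact Nat.zero_le _
  | cons a l ih =>
    rw [List.length_cons, esize_cons]
    omega

theorem esize_le_of_mem {a : α} {l : List α} (h : a ∈ l) : esize a ≤ esize l := by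
  induction l with
  | nil => cases h
  | cons b l ih =>
    rw [esize_cons]
    rcases List.mem_cons.1 h with rfl | h
    · omega
    · have := ih h
      omega

theorem esize_list_le {l : List α} {K : ℕ} (h : ∀ a ∈ l, esize a ≤ K) :
    esize l ≤ l.length * (K + 1) + 1 := by
  induction l with
  | nil => simp [esize_nil]
  | cons a l ih =>
    have h1 := h a List.mem_cons_self
    have h2 := ih fun b hb => h b (List.mem_cons_of_mem a hb)
    rw [esize_cons, List.length_cons, Nat.succ_mul]
    omega

theorem esize_nat_le {m n : ℕ} (h : m ≤ n) : esize m ≤ esize n :=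
  Nat.succ_le_succ (Nat.size_le_size h)

theorem esize_nat_le_succ (n : ℕ) : esize n ≤ n + 1 :=
  Nat.succ_le_succ (Nat.size_le.2 n.lt_two_pow_self)

theorem esize_add_le (m n : ℕ) : esize (m + n) ≤ esize m + esize n := by
  have h : Nat.size (m + n) ≤ m.size + n.size + 1 := by
    rw [Nat.size_le, pow_succ, pow_add]
    have hm := Nat.lt_size_self m
    have hn := Nat.lt_size_self n
    have h1 : 1 ≤ 2 ^ m.size := Nat.one_le_two_pow
    have h2 : 1 ≤ 2 ^ n.size := Nat.one_le_two_pow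
    nlinarith
  show Nat.size (m + n) + 1 ≤ (m.size + 1) + (n.size + 1)
  omega

theorem esize_mul_le (m n : ℕ) : esize (m * n) ≤ esize m + esize n := by
  have h : Nat.size (m * n) ≤ m.size + n.size := by
    rw [Nat.size_le, pow_add]
    exact Nat.mul_lt_mul'' (Nat.lt_size_self m) (Nat.lt_size_self n)
  show Nat.size (m * n) + 1 ≤ (m.size + 1) + (n.size + 1)
  omega

theorem esize_bool_le (b : Bool) : esize b ≤ 2 := by
  cases b <;> simp [esize, enc, Enc.toData, Data.size]

end Size

/-- Whether data are the number `0`. -/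
def Data.isZero : Data → Bool
  | .num 0 => true
  | _ => false

/-- Functions that are computed by a program in polynomial time. -/
def PolyTime {α β : Type*} [Enc α] [Enc β] (f : α → β) : Prop :=
  PolyData (enc : α → Data) fun a => enc (f a)

namespace PolyTime

variable {α β γ δ : Type*} [Enc α] [Enc β] [Enc γ] [Enc δ]

theorem polyBdd {f : α → β} (h : PolyTime f) : PolyBdd (enc : α → Data) fun a => esize (f a) :=
  PolyData.polyBdd h

theorem congr {f g : α → β} (h : PolyTime f) (e : ∀ a, f a = g a) : PolyTime g := by
  rwa [← funext e]

theorem comp {f : β → γ} {g : α → β} (hf : PolyTime f) (hg : PolyTime g) :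
    PolyTime fun a => f (g a) := by
  obtain ⟨P, B, hB, h⟩ := hf
  exact PolyData.comp hg ⟨P, fun a => B (g a), hB.comp g, fun a => h (g a)⟩

theorem id : PolyTime fun a : α => a := PolyData.id

theorem const (b : β) : PolyTime fun _ : α => b := PolyData.const _

theorem prodMk {f : α → β} {g : α → γ} (hf : PolyTime f) (hg : PolyTime g) :
    PolyTime fun a => (f a, g a) := PolyData.pair hf hg

theorem fst {f : α → β × γ} (hf : PolyTime f) : PolyTime fun a => (f a).1 := PolyData.fst hf

theorem snd {f : α → β × γ} (hf : PolyTime f) : PolyTime fun a => (f a).2 := PolyData.snd hf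

theorem ite {c : α → Bool} {f g : α → β} (hc : PolyTime c) (hf : PolyTime f) (hg : PolyTime g) :
    PolyTime fun a => if c a = true then f a else g a := by
  have := PolyData.ite (p := fun a => c a = true) hc (fun a => by
    show Data.num (c a).toNat ≠ .num 0 ↔ _
    cases c a <;> simp) hf hg
  refine PolyData.congr this fun a => ?_
  dsimp only
  split_ifs <;> rfl

theorem not {f : α → Bool} (hf : PolyTime f) : PolyTime fun a => !f a := by
  have := hf.ite (const false) (const true)
  refine this.congr fun a => ?_
  cases f a <;> rfl

theorem and {f g : α → Bool} (hf : PolyTime f) (hg : PolyTime g) : PolyTime fun a => f a && g a := by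
  have := hf.ite hg (const false)
  refine this.congr fun a => ?_
  cases f a <;> rfl

theorem or {f g : α → Bool} (hf : PolyTime f) (hg : PolyTime g) : PolyTime fun a => f a || g a := by
  have := hf.ite (const true) hg
  refine this.congr fun a => ?_
  cases f a <;> rfl

theorem natOp (o : Op) (φ : ℕ → ℕ → ℕ)
    (ho : ∀ m n, o.apply (.pair (.num m) (.num n)) = .num (φ m n))
    (hφ : ∀ m n, esize (φ m n) ≤ esize m + esize n) {f g : α → ℕ} (hf : PolyTime f)
    (hg : PolyTime g) : PolyTime fun a => φ (f a) (g a) := by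
  refine PolyData.comp (PolyData.pair hf hg) (PolyData.op o (fun a => ho _ _) ?_)
  refine PolyBdd.size.mono fun a => (hφ _ _).trans ?_
  exact Nat.le_succ _

theorem add {f g : α → ℕ} (hf : PolyTime f) (hg : PolyTime g) : PolyTime fun a => f a + g a :=
  natOp .add (· + ·) (fun _ _ => rfl) esize_add_le hf hg

theorem sub {f g : α → ℕ} (hf : PolyTime f) (hg : PolyTime g) : PolyTime fun a => f a - g a :=
  natOp .sub (· - ·) (fun _ _ => rfl)
    (fun m n => (esize_nat_le (Nat.sub_le m n)).trans (Nat.le_add_right _ _)) hf hg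

theorem mul {f g : α → ℕ} (hf : PolyTime f) (hg : PolyTime g) : PolyTime fun a => f a * g a :=
  natOp .mul (· * ·) (fun _ _ => rfl) esize_mul_le hf hg

theorem div {f g : α → ℕ} (hf : PolyTime f) (hg : PolyTime g) : PolyTime fun a => f a / g a :=
  natOp .div (· / ·) (fun _ _ => rfl)
    (fun m n => (esize_nat_le (Nat.div_le_self m n)).trans (Nat.le_add_right _ _)) hf hg

theorem eq_zero {f : α → ℕ} (hf : PolyTime f) : PolyTime fun a => f a == 0 := by
  have := PolyData.ite (p := fun a => f a ≠ 0) hf (fun a => by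
    show Data.num (f a) ≠ .num 0 ↔ _
    simp) (PolyData.num 0) (PolyData.num 1)
  refine PolyData.congr this fun a => ?_
  dsimp only
  by_cases h : f a = 0
  · rw [h]
    rfl
  · rw [if_pos h, beq_eq_false_iff_ne.2 h]
    rfl

theorem isZero {f : α → Data} (hf : PolyTime f) : PolyTime fun a => (f a).isZero := by
  have := PolyData.ite (p := fun a => (f a).isZero = false) hf (fun a => by
    show f a ≠ .num 0 ↔ _
    cases f a with
    | num n => cases n <;> simp [Data.isZero]
    | pair x y => simp [Data.isZero]) (PolyData.num 0) (PolyData.num 1)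
  refine PolyData.congr this fun a => ?_
  dsimp only
  cases (f a).isZero <;> rfl

/-- Both truncated differences vanish only at equality. -/
theorem beq {f g : α → ℕ} (hf : PolyTime f) (hg : PolyTime g) : PolyTime fun a => f a == g a := by
  have := ((hf.sub hg).add (hg.sub hf)).eq_zero
  refine this.congr fun a => ?_
  rw [Bool.eq_iff_iff, beq_iff_eq, beq_iff_eq]
  omega

theorem ble {f g : α → ℕ} (hf : PolyTime f) (hg : PolyTime g) :
    PolyTime fun a => Nat.ble (f a) (g a) := by
  have := (hf.sub hg).eq_zero
  refine this.congr fun a => ?_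
  rw [Bool.eq_iff_iff, beq_iff_eq, Nat.ble_eq]
  omega

theorem isEmpty {f : α → List β} (hf : PolyTime f) : PolyTime fun a => (f a).isEmpty := by
  have := PolyData.ite (p := fun a => f a ≠ []) hf (fun a => by
    cases f a with
    | nil => simp [enc, Enc.toData, Data.list]
    | cons b l => simp [enc, Enc.toData, Data.list]) (PolyData.num 0) (PolyData.num 1)
  refine PolyData.congr this fun a => ?_
  dsimp only
  cases f a with
  | nil =>
    rw [if_neg (not_not_intro rfl)]
    rfl
  | cons b l =>
    rw [if_pos (List.cons_ne_nil b l)]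
    rfl

theorem cons {f : α → β} {g : α → List β} (hf : PolyTime f) (hg : PolyTime g) :
    PolyTime fun a => f a :: g a := PolyData.pair hf hg

/-! ### Folds -/

/-- The loop carries the parameter, the accumulator and the remaining list. The empty list is
encoded as the number `0`, so the remaining list itself is the loop test. Every intermediate
accumulator is the fold over a prefix; a bound for these bounds the cost of each round. -/
theorem foldl_of_prefix {f : α → List β} {g : α → γ} {h : α → γ → β → γ} (hf : PolyTime f)
    (hg : PolyTime g) (hh : PolyTime fun p : α × γ × β => h p.1 p.2.1 p.2.2) {K : α → ℕ}
    (hK : PolyBdd (enc : α → Data) K)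
    (hle : ∀ a l, l <+: f a → esize (l.foldl (h a) (g a)) ≤ K a) :
    PolyTime fun a => (f a).foldl (h a) (g a) := by
  obtain ⟨b, Bb, ⟨pb, hpb⟩, hb⟩ : PolyData
      (fun i : α × γ × β × List β => enc (i.1, i.2.1, i.2.2.1 :: i.2.2.2))
      (fun i => enc (i.1, h i.1 i.2.1 i.2.2.1, i.2.2.2)) := by
    have hid := PolyData.id
      (x := fun i : α × γ × β × List β => enc (i.1, i.2.1, i.2.2.1 :: i.2.2.2))
    have h1 := hid.fst
    have h2 := hid.snd.fst
    have h3 := hid.snd.snd.fst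
    have h4 := hid.snd.snd.snd
    refine h1.pair (PolyData.pair ?_ h4)
    obtain ⟨P, B, hB, hP⟩ := hh
    exact PolyData.comp (h1.pair (h2.pair h3))
      ⟨P, _, hB.comp fun i : α × γ × β × List β => (i.1, i.2.1, i.2.2.1), fun i => hP (i.1, i.2.1, i.2.2.1)⟩
  obtain ⟨c, Bc, ⟨pc, hpc⟩, hc⟩ : PolyData (fun i : α × γ × List β => enc i)
      (fun i => enc i.2.2) := by
    have hid := PolyData.id (x := fun i : α × γ × List β => enc i)
    exact hid.snd.snd
  -- `N` bounds the size of every loop state. The test is run once more than the body, hence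
  -- `l.length + 1`.
  have hloop : ∀ (a : α) (l : List β) (s : γ) (N : ℕ),
      (∀ l', l' <+: l → esize a + esize (l'.foldl (h a) s) + esize l + 2 ≤ N) →
      ∃ t, (Prog.loop c b).Runs (enc (a, s, l)) (enc (a, l.foldl (h a) s, ([] : List β))) t ∧
        t ≤ (l.length + 1) * (pc.eval N + pb.eval N + 1) := by
    intro a l
    induction l with
    | nil =>
      intro s N hN
      obtain ⟨t, ht, hle⟩ := hc (a, s, [])
      have h1 := hpc (a, s, [])
      have h2 : (enc (a, s, ([] : List β))).size ≤ N := by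
        have h3 := hN [] List.prefix_rfl
        simp only [List.foldl_nil] at h3
        have : esize (a, s, ([] : List β)) = esize a + esize s + esize ([] : List β) + 2 := by
          simp only [esize_prod]
          omega
        exact this.trans_le h3
      refine ⟨_, .loop_done ht, ?_⟩
      have h3 := eval_le_eval pc h2
      simp only [List.length_nil]
      dsimp only at h1
      omega
    | cons x l ih =>
      intro s N hN
      obtain ⟨t, ht, hle⟩ := hc (a, s, x :: l)
      obtain ⟨t', ht', hle'⟩ := hb (a, s, x, l)
      have h1 := hpc (a, s, x :: l)
      have h1' := hpb (a, s, x, l)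
      have h2 : (enc (a, s, x :: l)).size ≤ N := by
        have h3 := hN [] (List.nil_prefix)
        simp only [List.foldl_nil] at h3
        have : esize (a, s, x :: l) = esize a + esize s + esize (x :: l) + 2 := by
          simp only [esize_prod]
          omega
        exact this.trans_le h3
      obtain ⟨t'', ht'', hle''⟩ := ih (h a s x) N (by
        intro l' hl'
        have h3 := hN (x :: l') ((List.prefix_cons_inj x).2 hl')
        simp only [List.foldl_cons, esize_cons] at h3
        omega)
      refine ⟨_, .loop_step ht (by simp [enc, Enc.toData, Data.list]) ht' ht'', ?_⟩
      have h3 := eval_le_eval pc h2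
      have h3' := eval_le_eval pb h2
      rw [List.length_cons, Nat.succ_mul (l.length + 1)]
      dsimp only at h1 h1'
      omega
  have hstart : PolyTime fun a => (a, g a, f a) := id.prodMk (hg.prodMk hf)
  -- The summand `2` counts the two pair nodes of the loop state.
  set N : α → ℕ := fun a => esize a + K a + esize (f a) + 2 with hN
  have hNb : PolyBdd (enc : α → Data) N :=
    ((PolyBdd.size.add hK).add hf.polyBdd).add (PolyBdd.const 2)
  have hmain : PolyData (fun a => enc (a, g a, f a))
      (fun a => enc (a, (f a).foldl (h a) (g a), ([] : List β))) := by
    have hsub : ∀ {B : α → ℕ}, PolyBdd (enc : α → Data) B →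
        PolyBdd (fun a => enc (a, g a, f a)) B := by
      rintro B ⟨p, hp⟩
      refine ⟨p, fun a => (hp a).trans (eval_le_eval p ?_)⟩
      show esize a ≤ esize (a, g a, f a)
      rw [esize_prod]
      omega
    refine ⟨.loop c b, fun a => ((f a).length + 1) * (pc.eval (N a) + pb.eval (N a) + 1),
      hsub (PolyBdd.mul ((hf.polyBdd.mono fun a => length_le_esize _).add (PolyBdd.const 1))
        (((hNb.poly pc).add (hNb.poly pb)).add (PolyBdd.const 1))), fun a => ?_⟩
    refine hloop a (f a) (g a) (N a) fun l' hl' => ?_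
    have := hle a l' hl'
    simp only [hN]
    omega
  exact (PolyData.comp hstart hmain).snd.fst

/-- If a round adds at most `K a` to the size, then the number of rounds, at most the size of the
list, gives a polynomial bound for all prefixes. -/
theorem foldl {f : α → List β} {g : α → γ} {h : α → γ → β → γ} (hf : PolyTime f)
    (hg : PolyTime g) (hh : PolyTime fun p : α × γ × β => h p.1 p.2.1 p.2.2) {K : α → ℕ}
    (hK : PolyBdd (enc : α → Data) K)
    (hle : ∀ a c, ∀ b ∈ f a, esize (h a c b) ≤ esize c + K a) :
    PolyTime fun a => (f a).foldl (h a) (g a) := by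
  refine hf.foldl_of_prefix hg hh (K := fun a => esize (g a) + esize (f a) * K a)
    (hg.polyBdd.add (hf.polyBdd.mul hK)) fun a l hl => ?_
  have key : ∀ l : List β, (∀ b ∈ l, b ∈ f a) → ∀ s,
      esize (l.foldl (h a) s) ≤ esize s + l.length * K a := by
    intro l
    induction l with
    | nil =>
      intro _ s
      simp
    | cons b l ih =>
      intro hl s
      have h1 := ih (fun b hb => hl b (List.mem_cons_of_mem _ hb)) (h a s b)
      have h2 := hle a s b (hl b List.mem_cons_self)
      rw [List.foldl_cons, List.length_cons, Nat.succ_mul]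
      omega
  refine (key l (fun b hb => hl.subset hb) (g a)).trans (Nat.add_le_add_left ?_ _)
  exact Nat.mul_le_mul_right _ (hl.length_le.trans (length_le_esize _))

theorem reverse {f : α → List β} (hf : PolyTime f) : PolyTime fun a => (f a).reverse := by
  have := hf.foldl (g := fun _ => []) (h := fun _ l b => b :: l) (const _)
    (id.snd.snd.cons id.snd.fst) (K := fun a => esize (f a) + 1)
    (hf.polyBdd.add (PolyBdd.const 1)) (fun a c b hb => by
      rw [esize_cons]
      have := esize_le_of_mem hb
      omega)
  refine this.congr fun a => ?_
  simp

theorem polyBdd_of_mem {f : α → List β} {g : α → β → γ} (hf : PolyTime f)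
    (hg : PolyTime fun p : α × β => g p.1 p.2) :
    ∃ K : α → ℕ, PolyBdd (enc : α → Data) K ∧ ∀ a, ∀ b ∈ f a, esize (g a b) ≤ K a := by
  obtain ⟨p, hp⟩ := hg.polyBdd
  refine ⟨fun a => p.eval (esize a + esize (f a) + 1),
    ((PolyBdd.size.add hf.polyBdd).add (PolyBdd.const 1)).poly p, fun a b hb => ?_⟩
  refine (hp (a, b)).trans (eval_le_eval p ?_)
  have := esize_le_of_mem hb
  show esize (a, b) ≤ _
  rw [esize_prod]
  omega

theorem map {f : α → List β} {g : α → β → γ} (hf : PolyTime f)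
    (hg : PolyTime fun p : α × β => g p.1 p.2) : PolyTime fun a => (f a).map (g a) := by
  obtain ⟨K, hK, hle⟩ := polyBdd_of_mem hf hg
  have := (hf.foldl (g := fun _ => []) (h := fun a l b => g a b :: l) (const _)
    ((hg.comp (g := fun p : α × List γ × β => (p.1, p.2.2)) (id.fst.prodMk id.snd.snd)).cons
      id.snd.fst) (K := fun a => K a + 1) (hK.add (PolyBdd.const 1)) (fun a c b hb => by
      rw [esize_cons]
      have := hle a b hb
      omega)).reverse
  refine this.congr fun a => ?_
  have key : ∀ (l : List β) (s : List γ),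
      l.foldl (fun l b => g a b :: l) s = (l.map (g a)).reverse ++ s := by
    intro l
    induction l with
    | nil => simp
    | cons b l ih => simp [ih]
  simp [key]

theorem filter {f : α → List β} {g : α → β → Bool} (hf : PolyTime f)
    (hg : PolyTime fun p : α × β => g p.1 p.2) : PolyTime fun a => (f a).filter (g a) := by
  have := (hf.foldl (g := fun _ => []) (h := fun a l b => if g a b = true then b :: l else l)
    (const _) (ite (hg.comp (g := fun p : α × List β × β => (p.1, p.2.2))
      (id.fst.prodMk id.snd.snd)) (id.snd.snd.cons id.snd.fst) id.snd.fst)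
    (K := fun a => esize (f a) + 1) (hf.polyBdd.add (PolyBdd.const 1)) (fun a c b hb => by
      have := esize_le_of_mem hb
      split_ifs
      · rw [esize_cons]
        omega
      · omega)).reverse
  refine this.congr fun a => ?_
  have key : ∀ (l : List β) (s : List β),
      l.foldl (fun l b => if g a b = true then b :: l else l) s = (l.filter (g a)).reverse ++ s := by
    intro l
    induction l with
    | nil => simp
    | cons b l ih =>
      intro s
      by_cases hb : g a b = true <;> simp [ih, hb]
  simp [key]

theorem any {f : α → List β} {g : α → β → Bool} (hf : PolyTime f)
    (hg : PolyTime fun p : α × β => g p.1 p.2) : PolyTime fun a => (f a).any (g a) := by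
  have := (hf.filter hg).isEmpty.not
  refine this.congr fun a => ?_
  rw [Bool.eq_iff_iff]
  simp

theorem all {f : α → List β} {g : α → β → Bool} (hf : PolyTime f)
    (hg : PolyTime fun p : α × β => g p.1 p.2) : PolyTime fun a => (f a).all (g a) := by
  have := (hf.filter (g := fun a b => !g a b) hg.not).isEmpty
  refine this.congr fun a => ?_
  rw [Bool.eq_iff_iff]
  simp

theorem sum {f : α → List ℕ} (hf : PolyTime f) : PolyTime fun a => (f a).sum := by
  have := hf.foldl (g := fun _ => 0) (h := fun _ s b => s + b) (const _)
    (id.snd.fst.add id.snd.snd) (K := fun a => esize (f a)) hf.polyBdd (fun a c b hb =>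
      (esize_add_le c b).trans (Nat.add_le_add_left (esize_le_of_mem hb) _))
  refine this.congr fun a => ?_
  exact List.sum_eq_foldl.symm

theorem prod {f : α → List ℕ} (hf : PolyTime f) : PolyTime fun a => (f a).prod := by
  have := hf.foldl (g := fun _ => 1) (h := fun _ s b => s * b) (const _)
    (id.snd.fst.mul id.snd.snd) (K := fun a => esize (f a)) hf.polyBdd (fun a c b hb =>
      (esize_mul_le c b).trans (Nat.add_le_add_left (esize_le_of_mem hb) _))
  refine this.congr fun a => ?_
  exact List.prod_eq_foldl.symm

theorem length {f : α → List β} (hf : PolyTime f) : PolyTime fun a => (f a).length := by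
  have := (hf.map (g := fun _ _ => 1) (const 1)).sum
  refine this.congr fun a => ?_
  simp

/-- The list of the indices of a list. -/
theorem range {f : α → List β} (hf : PolyTime f) : PolyTime fun a => List.range (f a).length := by
  have key : ∀ l : List β, l.foldl (fun (s : ℕ × List ℕ) _ => (s.1 + 1, s.1 :: s.2)) (0, []) =
      (l.length, (List.range l.length).reverse) := by
    intro l
    induction l using List.reverseRecOn with
    | nil => rfl
    | append_singleton l b ih => simp [ih, List.range_succ]
  -- Each round appends the counter, whose size depends on the accumulator, so no uniform bound on
  -- the growth per round exists. The accumulator over a prefix is known explicitly and is bounded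
  -- directly.
  have := (hf.foldl_of_prefix (g := fun _ => ((0, []) : ℕ × List ℕ))
    (h := fun _ s _ => (s.1 + 1, s.1 :: s.2)) (const _)
    ((id.snd.fst.fst.add (const 1)).prodMk (id.snd.fst.fst.cons id.snd.fst.snd))
    (K := fun a => (esize (f a) + 1) + (esize (f a) * (esize (f a) + 1 + 1) + 1) + 1)
    (((hf.polyBdd.add (PolyBdd.const 1)).add
      ((hf.polyBdd.mul ((hf.polyBdd.add (PolyBdd.const 1)).add (PolyBdd.const 1))).add (PolyBdd.const 1))).add
        (PolyBdd.const 1)) (fun a l hl => by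
      have hlen : l.length ≤ esize (f a) := hl.length_le.trans (length_le_esize _)
      rw [key, esize_prod]
      have h1 : esize l.length ≤ esize (f a) + 1 :=
        (esize_nat_le_succ _).trans (Nat.succ_le_succ hlen)
      have h2 := esize_list_le (l := (List.range l.length).reverse) (K := esize (f a) + 1)
        (by
          intro k hk
          rw [List.mem_reverse, List.mem_range] at hk
          exact (esize_nat_le hk.le).trans h1)
      rw [List.length_reverse, List.length_range] at h2
      have h3 := Nat.mul_le_mul_right (esize (f a) + 1 + 1) hlen
      omega)).snd.reverse
  refine this.congr fun a => ?_
  simp only [key, List.reverse_reverse]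

theorem getD {f : α → List β} {g : α → ℕ} {d : α → β} (hf : PolyTime f) (hg : PolyTime g)
    (hd : PolyTime d) : PolyTime fun a => (f a).getD (g a) (d a) := by
  -- The counter starts one above the index: the value `1` selects the current entry, and `0`
  -- records that an entry has been selected. If the list is too short, the default survives.
  have key : ∀ (l : List β) (k : ℕ) (d : β), (l.foldl (fun (s : ℕ × β) b =>
      if (s.1 == 1) = true then (0, b) else (s.1 - 1, s.2)) (k + 1, d)).2 = l.getD k d := by
    have h0 : ∀ (l : List β) (d : β), l.foldl (fun (s : ℕ × β) b =>
        if (s.1 == 1) = true then (0, b) else (s.1 - 1, s.2)) (0, d) = (0, d) := by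
      intro l d
      induction l with
      | nil => rfl
      | cons b l ih =>
        rw [List.foldl_cons]
        exact ih
    intro l
    induction l with
    | nil => simp
    | cons b l ih =>
      intro k d
      rw [List.foldl_cons]
      cases k with
      | zero =>
        show (l.foldl _ (0, b)).2 = _
        rw [h0]
        rfl
      | succ k => exact ih k d
  have := (hf.foldl (g := fun a => (g a + 1, d a))
    (h := fun _ s b => if (s.1 == 1) = true then (0, b) else (s.1 - 1, s.2))
    ((hg.add (const 1)).prodMk hd)
    (ite (id.snd.fst.fst.beq (const 1)) ((const 0).prodMk id.snd.snd)
      ((id.snd.fst.fst.sub (const 1)).prodMk id.snd.fst.snd))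
    (K := fun a => esize (f a)) hf.polyBdd (fun a c b hb => by
      have h1 := esize_le_of_mem hb
      obtain ⟨k, e⟩ := c
      dsimp only
      split_ifs
      · rw [esize_prod, esize_prod]
        have := esize_nat_le (Nat.zero_le k)
        have := esize_pos e
        omega
      · rw [esize_prod, esize_prod]
        have := esize_nat_le (Nat.sub_le k 1)
        omega)).snd
  refine this.congr fun a => ?_
  rw [key]

theorem append {f g : α → List β} (hf : PolyTime f) (hg : PolyTime g) :
    PolyTime fun a => f a ++ g a := by
  have := hf.reverse.foldl (g := g) (h := fun _ l b => b :: l) hg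
    (id.snd.snd.cons id.snd.fst) (K := fun a => esize (f a) + 1)
    (hf.polyBdd.add (PolyBdd.const 1)) (fun a c b hb => by
      rw [esize_cons]
      have := esize_le_of_mem (List.mem_reverse.1 hb)
      omega)
  refine this.congr fun a => ?_
  simp

theorem esize_append (l l' : List β) : esize (l ++ l') + 1 = esize l + esize l' := by
  induction l with
  | nil => simp [esize_nil, add_comm]
  | cons b l ih =>
    rw [List.cons_append, esize_cons, esize_cons]
    omega

theorem flatten {f : α → List (List β)} (hf : PolyTime f) : PolyTime fun a => (f a).flatten := by
  have := hf.foldl (g := fun _ => []) (h := fun _ s l => s ++ l) (const _)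
    (id.snd.fst.append id.snd.snd) (K := fun a => esize (f a)) hf.polyBdd (fun a c b hb => by
      have := esize_append c b
      have := esize_le_of_mem hb
      omega)
  refine this.congr fun a => ?_
  have key : ∀ (L : List (List β)) (s : List β), L.foldl (fun s l => s ++ l) s = s ++ L.flatten := by
    intro L
    induction L with
    | nil => simp
    | cons l L ih => simp [ih]
  simp [key]

theorem flatMap {f : α → List β} {g : α → β → List γ} (hf : PolyTime f)
    (hg : PolyTime fun p : α × β => g p.1 p.2) : PolyTime fun a => (f a).flatMap (g a) := by
  have := (hf.map hg).flatten
  refine this.congr fun a => ?_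
  rw [List.flatMap_def]

/-- Reading from the back, a hit resets the index to `0` and any other entry raises it by one, so
the first hit decides. -/
theorem findIdx {f : α → List β} {g : α → β → Bool} (hf : PolyTime f)
    (hg : PolyTime fun p : α × β => g p.1 p.2) : PolyTime fun a => (f a).findIdx (g a) := by
  have := hf.reverse.foldl (g := fun _ => 0)
    (h := fun a k b => if g a b = true then 0 else k + 1) (const _)
    (ite (hg.comp (g := fun p : α × ℕ × β => (p.1, p.2.2)) (id.fst.prodMk id.snd.snd))
      (const 0) (id.snd.fst.add (const 1))) (K := fun a => esize 1) (PolyBdd.const _)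
    (fun a c b hb => by
      split_ifs
      · exact (esize_nat_le (Nat.zero_le c)).trans (Nat.le_add_right _ _)
      · exact esize_add_le c 1)
  refine this.congr fun a => ?_
  rw [List.foldl_reverse]
  induction f a with
  | nil => rfl
  | cons b l ih =>
    rw [List.foldr_cons, ih, List.findIdx_cons]
    cases g a b <;> rfl

end PolyTime

/-! ## Computing the maximal end components by pruning -/

/-- Iterating a function that increases a bounded potential reaches a fixed point. -/
theorem iterate_isFixedPt {β : Type*} {F : β → β} (μ : β → ℕ) {N : ℕ} (hμ : ∀ x, μ x ≤ N)
    (h : ∀ x, F x = x ∨ μ x < μ (F x)) (x : β) : F (F^[N] x) = F^[N] x := by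
  by_contra hne
  -- If the `N`-th iterate is not fixed, neither is an earlier one, and the potential would rise `N
  -- + 1` times.
  have hj : ∀ j ≤ N, F (F^[j] x) ≠ F^[j] x := by
    intro j hj hfix
    apply hne
    obtain ⟨k, rfl⟩ := Nat.exists_eq_add_of_le' hj
    rw [Function.iterate_add_apply, Function.iterate_fixed hfix, hfix]
  have key : ∀ j ≤ N + 1, j ≤ μ (F^[j] x) := by
    intro j
    induction j with
    | zero => exact fun _ => Nat.zero_le _
    | succ j ih =>
      intro hle
      have h1 := ih (by omega)
      have h2 := (h (F^[j] x)).resolve_left (hj j (by omega))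
      rw [Function.iterate_succ_apply']
      omega
  have := key (N + 1) le_rfl
  have := hμ (F^[N + 1] x)
  omega

namespace MDP

variable {S : Type u} {A : Type v} (M : MDP S A) (U : Set S) (L : Set (S × A))

/-- Some action of `L` leads from `s` to `t` with positive probability. -/
def StepRel (s t : S) : Prop := ∃ a, (s, a) ∈ L ∧ t ∈ (M.δ s a).support

/-- The state `t` is reachable from `s` by actions of `L`. -/
def Reach (s t : S) : Prop := Relation.ReflTransGen (M.StepRel L) s t

/-- Extension of a reachability relation by one step at the front. -/
def reachStep (R : Set (S × S)) : Set (S × S) :=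
  {x | x ∈ R ∨ ∃ a, (x.1, a) ∈ L ∧ ∃ u ∈ (M.δ x.1 a).support, (u, x.2) ∈ R}

/-- The pairs of `L` from all of whose successors one can return by `L`. -/
def prune : Set (S × A) := {x ∈ L | ∀ t ∈ (M.δ x.1 x.2).support, M.Reach L t x.1}

/-- The available pairs at states of `U`. -/
def pairs : Set (S × A) := {x | x.1 ∈ U ∧ x.2 ∈ M.avail x.1}

/-- The relation grows inside a set of `|S|²` pairs, so it is stable after that many rounds. A
stable relation that contains the diagonal contains reachability, by adding steps at the front. -/
theorem mem_reachStep_iterate [Finite S] {N : ℕ} (hN : Nat.card S * Nat.card S ≤ N) (s t : S) :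
    (s, t) ∈ (M.reachStep L)^[N] {x | x.1 = x.2} ↔ M.Reach L s t := by
  have hmono : ∀ R, R ⊆ M.reachStep L R := fun R x hx => Or.inl hx
  constructor
  · have key : ∀ k, ∀ x ∈ (M.reachStep L)^[k] {x : S × S | x.1 = x.2}, M.Reach L x.1 x.2 := by
      intro k
      induction k with
      | zero =>
        rintro ⟨s, t⟩ (rfl : s = t)
        exact Relation.ReflTransGen.refl
      | succ k ih =>
        intro x hx
        rw [Function.iterate_succ_apply'] at hx
        obtain hx | ⟨a, ha, u, hu, hx⟩ := hx
        · exact ih x hx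
        · exact Relation.ReflTransGen.head ⟨a, ha, hu⟩ (ih _ hx)
    exact fun h => key N _ h
  · have hfix := iterate_isFixedPt (F := M.reachStep L) Set.ncard (N := N)
      (fun R => (Set.ncard_le_card R).trans (by rwa [Nat.card_prod])) (fun R => by
        by_cases h : M.reachStep L R = R
        · exact Or.inl h
        · exact Or.inr (Set.ncard_lt_ncard ((hmono R).ssubset_of_ne (Ne.symm h))))
      {x | x.1 = x.2}
    intro h
    induction h using Relation.ReflTransGen.head_induction_on with
    | refl =>
      have : ∀ k, (t, t) ∈ (M.reachStep L)^[k] {x : S × S | x.1 = x.2} := by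
        intro k
        induction k with
        | zero => rfl
        | succ k ih =>
          rw [Function.iterate_succ_apply']
          exact hmono _ ih
      exact this N
    | head h _ ih =>
      obtain ⟨a, ha, hu⟩ := h
      rw [← hfix]
      exact Or.inr ⟨a, ha, _, hu, ih⟩

variable {M U L}

/-- Within an end component one can return from every successor by its own actions, so pruning never
removes its pairs. -/
theorem MEC.subset_prune {C : M.MEC U} (h : C.B ⊆ L) : C.B ⊆ M.prune L := by
  rintro ⟨s, a⟩ hx
  refine ⟨h hx, fun t ht => ?_⟩
  refine (Relation.TransGen.mono ?_ _ _ (C.isEC.connected t (C.isEC.closed _ hx ht) s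
    (C.isEC.acts_subset _ hx).1)).to_reflTransGen
  rintro x y ⟨b, hb, hy⟩
  exact ⟨b, h hb, hy⟩

theorem MEC.subset_prune_iterate (C : M.MEC U) (k : ℕ) : C.B ⊆ M.prune^[k] (M.pairs U) := by
  induction k with
  | zero => exact fun x hx => ⟨C.subset (C.isEC.acts_subset x hx).1, (C.isEC.acts_subset x hx).2⟩
  | succ k ih =>
    rw [Function.iterate_succ_apply']
    exact MEC.subset_prune ih

theorem prune_iterate_subset (k : ℕ) : M.prune^[k] (M.pairs U) ⊆ M.pairs U := by
  induction k with
  | zero => exact subset_rfl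
  | succ k ih =>
    rw [Function.iterate_succ_apply']
    exact fun x hx => ih hx.1

/-- Every round that changes something removes a pair, and there are at most `|S| * |A|` of them. -/
theorem prune_iterate_isFixedPt [Finite S] [Finite A] {N : ℕ}
    (hN : Nat.card S * Nat.card A ≤ N) (L : Set (S × A)) :
    M.prune (M.prune^[N] L) = M.prune^[N] L := by
  refine iterate_isFixedPt (fun L => Lᶜ.ncard)
    (fun L => (Set.ncard_le_card Lᶜ).trans (by rwa [Nat.card_prod])) (fun L => ?_) L
  by_cases h : M.prune L = L
  · exact Or.inl h
  · have hss : M.prune L ⊂ L := Set.ssubset_iff_subset_ne.2 ⟨fun x hx => hx.1, h⟩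
    exact Or.inr (Set.ncard_lt_ncard (compl_lt_compl_iff_lt.2 hss))

theorem Reach.symm (hL : M.prune L = L) {s t : S} (h : M.Reach L s t) : M.Reach L t s := by
  induction h with
  | refl => exact Relation.ReflTransGen.refl
  | tail _ h ih =>
    obtain ⟨a, ha, hu⟩ := h
    rw [← hL] at ha
    exact (ha.2 _ hu).trans ih

/-- At a fixed point every step can be undone, so the states reachable from `s`, with their
remaining pairs, form an end component. -/
theorem exists_mec_of_prune_eq [Finite S] [Finite A] (hL : M.prune L = L) (hU : L ⊆ M.pairs U)
    {s : S} {a : A} (h : (s, a) ∈ L) : ∃ C : M.MEC U, (s, a) ∈ C.B := by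
  have hec : M.IsEC {t | M.Reach L s t} {x ∈ L | M.Reach L s x.1} := by
    have hmono : ∀ x y, M.Reach L s x → M.Reach L x y → Relation.ReflTransGen
        (fun x y => ∃ a, (x, a) ∈ {x ∈ L | M.Reach L s x.1} ∧ y ∈ (M.δ x a).support) x y := by
      intro x y hx hxy
      induction hxy with
      | refl => exact Relation.ReflTransGen.refl
      | tail hxy h ih =>
        obtain ⟨b, hb, hu⟩ := h
        exact ih.tail ⟨b, ⟨hb, hx.trans hxy⟩, hu⟩
    refine ⟨⟨s, Relation.ReflTransGen.refl⟩, ⟨(s, a), h, Relation.ReflTransGen.refl⟩,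
      fun x hx => ⟨hx.2, (hU hx.1).2⟩,
      fun x hx t ht => hx.2.tail ⟨x.2, hx.1, ht⟩, fun x hx y hy => ?_⟩
    -- Connectivity asks for a path with at least one step; passing through `s` and its action `a`
    -- provides one.
    obtain ⟨t, ht⟩ := (M.δ s a).support_nonempty
    have hst : M.Reach L s t := Relation.ReflTransGen.single ⟨a, h, ht⟩
    exact ((Relation.TransGen.single ⟨a, ⟨h, Relation.ReflTransGen.refl⟩, ht⟩).trans_left
      (hmono t y hst ((Reach.symm hL hst).trans hy))).trans_right
      (hmono x s hx (Reach.symm hL hx))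
  obtain ⟨C, _, hC⟩ := hec.exists_mec (U := U) (by
    intro t ht
    -- A reachable state other than `s` can return to `s`, so it has a pair in `L` and lies in `U`.
    obtain rfl | ⟨u, ⟨b, hb, _⟩, _⟩ :=
      Relation.ReflTransGen.cases_head (Reach.symm hL ht)
    · exact (hU h).1
    · exact (hU hb).1)
  exact ⟨C, hC ⟨h, Relation.ReflTransGen.refl⟩⟩

/-- The pairs that survive the pruning are those of the maximal end components. -/
theorem mem_prune_iterate [Finite S] [Finite A] {N : ℕ} (hN : Nat.card S * Nat.card A ≤ N) (s : S)
    (a : A) : (s, a) ∈ M.prune^[N] (M.pairs U) ↔ ∃ C : M.MEC U, (s, a) ∈ C.B :=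
  ⟨exists_mec_of_prune_eq (prune_iterate_isFixedPt hN _) (prune_iterate_subset N),
    fun ⟨C, hC⟩ => C.subset_prune_iterate N hC⟩

/-- One step by a surviving pair stays in its component, and each component is connected by its own
pairs. States outside of the components reach only themselves. So the algorithm reads the states of
the quotient off the reachability matrix. -/
theorem reach_prune_iterate [Finite S] [Finite A] {N : ℕ} (hN : Nat.card S * Nat.card A ≤ N)
    (s t : S) : M.Reach (M.prune^[N] (M.pairs U)) s t ↔ M.proj U s = M.proj U t := by
  constructor
  · intro h
    induction h with
    | refl => rfl
    | tail _ h ih =>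
      obtain ⟨a, ha, hu⟩ := h
      obtain ⟨C, hC⟩ := (mem_prune_iterate hN _ _).1 ha
      rw [ih, M.proj_eq_of_mem_B U hC hu]
  · intro h
    obtain rfl | ⟨C, hs, ht⟩ := M.proj_eq_proj U h
    · exact Relation.ReflTransGen.refl
    · refine (Relation.TransGen.mono ?_ _ _ (C.isEC.connected s hs t ht)).to_reflTransGen
      rintro x y ⟨b, hb, hy⟩
      exact ⟨b, C.subset_prune_iterate N hb, hy⟩

/-- A state belongs to a maximal end component if and only if it has an action in one. -/
theorem exists_mem_T_iff (s : S) :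
    (∃ C : M.MEC U, s ∈ C.T) ↔ ∃ a, ∃ C : M.MEC U, (s, a) ∈ C.B := by
  constructor
  · rintro ⟨C, hC⟩
    obtain ⟨t, ⟨a, ha, _⟩, _⟩ := Relation.TransGen.head'_iff.1 (C.isEC.connected s hC s hC)
    exact ⟨a, C, ha⟩
  · rintro ⟨a, C, hC⟩
    exact ⟨C, (C.isEC.acts_subset _ hC).1⟩

end MDP

/-! ## The construction of the MEC quotient as an algorithm on tables -/

namespace Algo

/-- For each state and action, the list of the transition probabilities; it is empty if the action
is not available. -/
abbrev Table := List (List (List (ℕ × ℕ)))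

/-- An entry of a Boolean matrix. -/
def get2 (t : List (List Bool)) (i j : ℕ) : Bool := (t.getD i []).getD j false

/-- The Boolean matrix with given entries. -/
def tab (I J : List ℕ) (f : ℕ → ℕ → Bool) : List (List Bool) := I.map fun i => J.map (f i)

/-- The distribution for a state and an action. -/
def row (T : Table) (i j : ℕ) : List (ℕ × ℕ) := (T.getD i []).getD j []

/-- Whether a state is a possible successor. -/
def supp (T : Table) (i j k : ℕ) : Bool := !(((row T i j).getD k (0, 1)).1 == 0)

/-- The data of the problem: the table, the states and the actions. -/
abbrev Ctx := Table × List ℕ × List ℕ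

/-- One round of extending a reachability matrix. -/
def reachStep (c : Ctx) (L R : List (List Bool)) : List (List Bool) :=
  tab c.2.1 c.2.1 fun s t => get2 R s t ||
    c.2.2.any fun a => get2 L s a && c.2.1.any fun u => supp c.1 s a u && get2 R u t

/-- The reachability matrix of a set of pairs. -/
def reach (c : Ctx) (L : List (List Bool)) : List (List Bool) :=
  -- The list serves only as a counter: its length is the square of the number of states, the number
  -- of rounds after which the matrix is stable.
  (c.2.1.flatMap fun _ => c.2.1).foldl (fun R _ => reachStep c L R)
    (tab c.2.1 c.2.1 fun s t => s == t)

/-- One round of pruning a set of pairs. -/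
def prune (c : Ctx) (L : List (List Bool)) : List (List Bool) :=
  tab c.2.1 c.2.2 fun s a => get2 L s a &&
    c.2.1.all fun t => !supp c.1 s a t || get2 (reach c L) t s

/-- The available pairs at states that are not targets. -/
def start (c : Ctx) (r : List Data) : List (List Bool) :=
  tab c.2.1 c.2.2 fun s a => !(row c.1 s a).isEmpty && (r.getD s (.num 0)).isZero

/-- The pairs of the maximal end components. -/
def mecActs (c : Ctx) (r : List Data) : List (List Bool) :=
  (c.2.1.flatMap fun _ => c.2.2).foldl (fun L _ => prune c L) (start c r)

/-- The least elements of the classes of an equivalence relation. -/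
def reps (I : List ℕ) (R : List (List Bool)) : List ℕ :=
  I.filter fun s => I.all fun t => !get2 R s t || Nat.ble s t

/-- The pairs of a state and an action. -/
def pairList (c : Ctx) : List (ℕ × ℕ) := c.2.1.flatMap fun i => c.2.2.map fun j => (i, j)

/-- The distribution that is concentrated in the sink. -/
def diracSink (reps : List ℕ) : List (ℕ × ℕ) := (1, 1) :: reps.map fun _ => (0, 1)

/-- The product of the denominators. -/
def denom (l : List (ℕ × ℕ)) : ℕ := (l.map fun p => p.2).prod

/-- The numerator of the probability of the class of `t`. -/
def numer (I : List ℕ) (R : List (List Bool)) (l : List (ℕ × ℕ)) (t : ℕ) : ℕ :=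
  (I.map fun u => if get2 R u t = true then
    (l.getD u (0, 1)).1 * (denom l / (l.getD u (0, 1)).2) else 0).sum

/-- The distribution of the successor class. -/
def quotDist (I : List ℕ) (R : List (List Bool)) (reps : List ℕ) (l : List (ℕ × ℕ)) :
    List (ℕ × ℕ) :=
  (0, 1) :: reps.map fun t => (numer I R l t, denom l)

/-- The part of the table for the class of `s`. -/
def quotRow (c : Ctx) (L R : List (List Bool)) (reps : List ℕ) (s : ℕ) : List (List (ℕ × ℕ)) :=
  (if (c.2.2.any fun a => get2 L s a) = true then diracSink reps else []) ::
    (pairList c).map fun p =>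
      if (get2 R p.1 s && (!(row c.1 p.1 p.2).isEmpty && !get2 L p.1 p.2)) = true then
        quotDist c.2.1 R reps (row c.1 p.1 p.2) else []

/-- The encoding of an MDP and an objective: the numbers of states and actions, the initial state,
the table and the rewards. -/
abbrev Input := ℕ × ℕ × ℕ × Table × List Data × Unit

/-- The encoding of the quotient by the classes of `R`, with the pairs of `L` removed. -/
def quotOf (init : ℕ) (rew : List Data) (c : Ctx) (L R : List (List Bool)) (reps : List ℕ) :
    Input :=
  (reps.length + 1, (pairList c).length + 1, reps.findIdx (get2 R init) + 1,
    (diracSink reps :: (pairList c).map fun _ => []) :: reps.map (quotRow c L R reps),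
    Data.num 0 :: reps.map fun s => rew.getD s (.num 0), ())

/-- The states and the actions of a table. -/
def ctx (T : Table) : Ctx :=
  (T, List.range T.length, List.range (T.getD 0 []).length)

/-- The encoding of the MEC quotient, and the index of its sink. -/
def quotient (x : Input) : Input × ℕ :=
  let c := ctx x.2.2.2.1
  let L := mecActs c x.2.2.2.2.1
  let R := reach c L
  (quotOf x.2.2.1 x.2.2.2.2.1 c L R (reps c.2.1 R), 0)

end Algo

/-! ### The algorithm runs in polynomial time -/

namespace PolyTime

open Algo

variable {α : Type*} [Enc α]

theorem get2 {f : α → List (List Bool)} {i j : α → ℕ} (hf : PolyTime f) (hi : PolyTime i)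
    (hj : PolyTime j) : PolyTime fun a => Algo.get2 (f a) (i a) (j a) :=
  (hf.getD hi (const [])).getD hj (const false)

theorem tab {f g : α → List ℕ} {h : α → ℕ → ℕ → Bool} (hf : PolyTime f) (hg : PolyTime g)
    (hh : PolyTime fun p : α × ℕ × ℕ => h p.1 p.2.1 p.2.2) :
    PolyTime fun a => Algo.tab (f a) (g a) (h a) := by
  refine hf.map (g := fun a i => (g a).map (h a i)) ?_
  refine (hg.comp id.fst).map (f := fun p : α × ℕ => g p.1) (g := fun p j => h p.1 p.2 j) ?_
  exact hh.comp (g := fun p : (α × ℕ) × ℕ => (p.1.1, p.1.2, p.2))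
    (id.fst.fst.prodMk (id.fst.snd.prodMk id.snd))

theorem row {f : α → Table} {i j : α → ℕ} (hf : PolyTime f) (hi : PolyTime i)
    (hj : PolyTime j) : PolyTime fun a => Algo.row (f a) (i a) (j a) :=
  (hf.getD hi (const [])).getD hj (const [])

theorem supp {f : α → Table} {i j k : α → ℕ} (hf : PolyTime f) (hi : PolyTime i)
    (hj : PolyTime j) (hk : PolyTime k) : PolyTime fun a => Algo.supp (f a) (i a) (j a) (k a) :=
  ((hf.row hi hj).getD hk (const (0, 1))).fst.eq_zero.not

/-- Boolean entries have bounded size, so a matrix is small whatever its entries are, and iterating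
matrix operations cannot inflate the data. -/
theorem esize_tab_le (I J : List ℕ) (f : ℕ → ℕ → Bool) :
    esize (Algo.tab I J f) ≤ esize I * (esize J * 3 + 2) + 1 := by
  have h1 : ∀ i, esize (J.map (f i)) ≤ esize J * 3 + 1 := fun i => by
    have h := esize_list_le (l := J.map (f i)) (K := 2) fun b _ => esize_bool_le b
    rw [List.length_map] at h
    have := length_le_esize J
    omega
  have h := esize_list_le (l := Algo.tab I J f) (K := esize J * 3 + 1) (by
    intro b hb
    obtain ⟨i, _, rfl⟩ := List.mem_map.1 hb
    exact h1 i)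
  rw [Algo.tab, List.length_map] at h
  exact h.trans (Nat.succ_le_succ (Nat.mul_le_mul_right _ (length_le_esize I)))

theorem reachStep {c : α → Ctx} {L R : α → List (List Bool)} (hc : PolyTime c) (hL : PolyTime L)
    (hR : PolyTime R) : PolyTime fun a => Algo.reachStep (c a) (L a) (R a) := by
  refine tab hc.snd.fst hc.snd.fst (h := fun x s t => Algo.get2 (R x) s t ||
    (c x).2.2.any fun a => Algo.get2 (L x) s a && (c x).2.1.any fun u =>
      Algo.supp (c x).1 s a u && Algo.get2 (R x) u t) ?_
  refine ((hR.comp id.fst).get2 id.snd.fst id.snd.snd).or ?_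
  refine any (hc.comp id.fst).snd.snd (g := fun (p : α × ℕ × ℕ) a => Algo.get2 (L p.1) p.2.1 a &&
    (c p.1).2.1.any fun u => Algo.supp (c p.1).1 p.2.1 a u && Algo.get2 (R p.1) u p.2.2) ?_
  refine ((hL.comp id.fst.fst).get2 id.fst.snd.fst id.snd).and ?_
  refine any (hc.comp id.fst.fst).snd.fst (g := fun (p : (α × ℕ × ℕ) × ℕ) u =>
    Algo.supp (c p.1.1).1 p.1.2.1 p.2 u && Algo.get2 (R p.1.1) u p.1.2.2) ?_
  exact ((hc.comp id.fst.fst.fst).fst.supp id.fst.fst.snd.fst id.fst.snd id.snd).and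
    ((hR.comp id.fst.fst.fst).get2 id.snd id.fst.fst.snd.snd)

/-- For steps whose result is bounded independently of the accumulator, as with Boolean matrices of
fixed dimensions. -/
theorem foldl_of_le {β γ : Type*} [Enc β] [Enc γ] {f : α → List β} {g : α → γ} {h : α → γ → γ}
    (hf : PolyTime f) (hg : PolyTime g) (hh : PolyTime fun p : α × γ => h p.1 p.2) {K : α → ℕ}
    (hK : PolyBdd (enc : α → Data) K) (hle : ∀ a c, esize (h a c) ≤ K a) :
    PolyTime fun a => (f a).foldl (fun c _ => h a c) (g a) :=
  hf.foldl hg (h := fun a c _ => h a c) (hh.comp (id.fst.prodMk id.snd.fst)) hK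
    fun a c _ _ => (hle a c).trans (Nat.le_add_left _ _)

theorem polyBdd_tab {f g : α → List ℕ} (hf : PolyTime f) (hg : PolyTime g) :
    PolyBdd (enc : α → Data) fun a => esize (f a) * (esize (g a) * 3 + 2) + 1 :=
  (hf.polyBdd.mul ((hg.polyBdd.mul (PolyBdd.const 3)).add (PolyBdd.const 2))).add (PolyBdd.const 1)

theorem reach {c : α → Ctx} {L : α → List (List Bool)} (hc : PolyTime c) (hL : PolyTime L) :
    PolyTime fun a => Algo.reach (c a) (L a) := by
  have h1 : PolyTime fun a => (c a).2.1.flatMap fun _ => (c a).2.1 :=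
    hc.snd.fst.flatMap (g := fun a _ => (c a).2.1) (hc.comp id.fst).snd.fst
  have h2 : PolyTime fun a => Algo.tab (c a).2.1 (c a).2.1 fun s t => s == t :=
    hc.snd.fst.tab hc.snd.fst (h := fun _ s t => s == t) (id.snd.fst.beq id.snd.snd)
  have h3 : PolyTime fun p : α × List (List Bool) => Algo.reachStep (c p.1) (L p.1) p.2 :=
    (hc.comp id.fst).reachStep (hL.comp id.fst) id.snd
  exact foldl_of_le (h := fun a R => Algo.reachStep (c a) (L a) R) h1 h2 h3
    (polyBdd_tab hc.snd.fst hc.snd.fst) fun a R => esize_tab_le _ _ _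

theorem prune {c : α → Ctx} {L : α → List (List Bool)} (hc : PolyTime c) (hL : PolyTime L) :
    PolyTime fun a => Algo.prune (c a) (L a) := by
  refine tab hc.snd.fst hc.snd.snd (h := fun x s a => Algo.get2 (L x) s a &&
    (c x).2.1.all fun t => !Algo.supp (c x).1 s a t || Algo.get2 (Algo.reach (c x) (L x)) t s) ?_
  refine ((hL.comp id.fst).get2 id.snd.fst id.snd.snd).and ?_
  refine all (hc.comp id.fst).snd.fst (g := fun (p : α × ℕ × ℕ) t =>
    !Algo.supp (c p.1).1 p.2.1 p.2.2 t ||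
      Algo.get2 (Algo.reach (c p.1) (L p.1)) t p.2.1) ?_
  have h := (hc.reach hL).comp (id (α := (α × ℕ × ℕ) × ℕ)).fst.fst
  exact ((hc.comp id.fst.fst).fst.supp id.fst.snd.fst id.fst.snd.snd id.snd).not.or
    (h.get2 id.snd id.fst.snd.fst)

theorem start {c : α → Ctx} {r : α → List Data} (hc : PolyTime c) (hr : PolyTime r) :
    PolyTime fun a => Algo.start (c a) (r a) := by
  refine tab hc.snd.fst hc.snd.snd (h := fun x s a => !(Algo.row (c x).1 s a).isEmpty &&
    ((r x).getD s (.num 0)).isZero) ?_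
  exact ((hc.comp id.fst).fst.row id.snd.fst id.snd.snd).isEmpty.not.and
    ((hr.comp id.fst).getD id.snd.fst (const _)).isZero

theorem mecActs {c : α → Ctx} {r : α → List Data} (hc : PolyTime c) (hr : PolyTime r) :
    PolyTime fun a => Algo.mecActs (c a) (r a) := by
  have h1 : PolyTime fun a => (c a).2.1.flatMap fun _ => (c a).2.2 :=
    hc.snd.fst.flatMap (g := fun a _ => (c a).2.2) (hc.comp id.fst).snd.snd
  have h2 : PolyTime fun p : α × List (List Bool) => Algo.prune (c p.1) p.2 :=
    (hc.comp id.fst).prune id.snd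
  exact foldl_of_le (h := fun a L => Algo.prune (c a) L) h1 (hc.start hr) h2
    (polyBdd_tab hc.snd.fst hc.snd.snd) fun a R => esize_tab_le _ _ _

theorem reps {I : α → List ℕ} {R : α → List (List Bool)} (hI : PolyTime I) (hR : PolyTime R) :
    PolyTime fun a => Algo.reps (I a) (R a) := by
  refine hI.filter (g := fun a s => (I a).all fun t => !Algo.get2 (R a) s t || Nat.ble s t) ?_
  refine (hI.comp id.fst).all (g := fun p t => !Algo.get2 (R p.1) p.2 t || Nat.ble p.2 t) ?_
  exact ((hR.comp id.fst.fst).get2 id.fst.snd id.snd).not.or (id.fst.snd.ble id.snd)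

theorem pairList {c : α → Ctx} (hc : PolyTime c) : PolyTime fun a => Algo.pairList (c a) := by
  refine hc.snd.fst.flatMap (g := fun a i => (c a).2.2.map fun j => (i, j)) ?_
  exact (hc.comp (id (α := α × ℕ)).fst).snd.snd.map (g := fun p j => (p.2, j)) (id.fst.snd.prodMk id.snd)

theorem diracSink {f : α → List ℕ} (hf : PolyTime f) :
    PolyTime fun a => Algo.diracSink (f a) :=
  (const (1, 1)).cons (hf.map (g := fun _ _ => (0, 1)) (const _))

theorem denom {f : α → List (ℕ × ℕ)} (hf : PolyTime f) : PolyTime fun a => Algo.denom (f a) :=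
  (hf.map (g := fun _ (p : ℕ × ℕ) => p.2) id.snd.snd).prod

theorem numer {I : α → List ℕ} {R : α → List (List Bool)} {l : α → List (ℕ × ℕ)} {t : α → ℕ}
    (hI : PolyTime I) (hR : PolyTime R) (hl : PolyTime l) (ht : PolyTime t) :
    PolyTime fun a => Algo.numer (I a) (R a) (l a) (t a) := by
  refine (hI.map (g := fun a u => if Algo.get2 (R a) u (t a) = true then
    ((l a).getD u (0, 1)).1 * (Algo.denom (l a) / ((l a).getD u (0, 1)).2) else 0) ?_).sum
  have h := (hl.comp id.fst).getD id.snd (const (α := α × ℕ) (0, 1))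
  exact ite ((hR.comp id.fst).get2 id.snd (ht.comp id.fst))
    (h.fst.mul ((hl.comp id.fst).denom.div h.snd)) (const 0)

theorem quotDist {I : α → List ℕ} {R : α → List (List Bool)} {r : α → List ℕ}
    {l : α → List (ℕ × ℕ)} (hI : PolyTime I) (hR : PolyTime R) (hr : PolyTime r)
    (hl : PolyTime l) : PolyTime fun a => Algo.quotDist (I a) (R a) (r a) (l a) := by
  refine (const (0, 1)).cons (hr.map
    (g := fun a t => (Algo.numer (I a) (R a) (l a) t, Algo.denom (l a))) ?_)
  exact (numer (hI.comp id.fst) (hR.comp id.fst) (hl.comp id.fst) id.snd).prodMk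
    (hl.comp id.fst).denom

theorem quotRow {c : α → Ctx} {L R : α → List (List Bool)} {r : α → List ℕ} {s : α → ℕ}
    (hc : PolyTime c) (hL : PolyTime L) (hR : PolyTime R) (hr : PolyTime r) (hs : PolyTime s) :
    PolyTime fun a => Algo.quotRow (c a) (L a) (R a) (r a) (s a) := by
  refine (ite (hc.snd.snd.any (g := fun x a => Algo.get2 (L x) (s x) a)
    ((hL.comp id.fst).get2 (hs.comp id.fst) id.snd)) hr.diracSink (const [])).cons ?_
  refine hc.pairList.map (g := fun x p => if (Algo.get2 (R x) p.1 (s x) &&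
    (!(Algo.row (c x).1 p.1 p.2).isEmpty && !Algo.get2 (L x) p.1 p.2)) = true then
      Algo.quotDist (c x).2.1 (R x) (r x) (Algo.row (c x).1 p.1 p.2) else []) ?_
  have h := (hc.comp id.fst).fst.row id.snd.fst (id (α := α × ℕ × ℕ)).snd.snd
  exact ite (((hR.comp id.fst).get2 id.snd.fst (hs.comp id.fst)).and
    (h.isEmpty.not.and ((hL.comp id.fst).get2 id.snd.fst id.snd.snd).not))
    (quotDist (hc.comp id.fst).snd.fst (hR.comp id.fst) (hr.comp id.fst) h) (const [])

theorem quotOf {i : α → ℕ} {d : α → List Data} {c : α → Ctx} {L R : α → List (List Bool)}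
    {r : α → List ℕ} (hi : PolyTime i) (hd : PolyTime d) (hc : PolyTime c) (hL : PolyTime L)
    (hR : PolyTime R) (hr : PolyTime r) :
    PolyTime fun a => Algo.quotOf (i a) (d a) (c a) (L a) (R a) (r a) := by
  refine (hr.length.add (const 1)).prodMk ((hc.pairList.length.add (const 1)).prodMk
    (((hr.findIdx (g := fun a s => Algo.get2 (R a) (i a) s) ?_).add (const 1)).prodMk
    (((hr.diracSink.cons (hc.pairList.map (g := fun _ _ => []) (const _))).cons
      (hr.map (g := fun a s => Algo.quotRow (c a) (L a) (R a) (r a) s) ?_)).prodMk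
    (((const (Data.num 0)).cons (hr.map (g := fun a s => (d a).getD s (.num 0)) ?_)).prodMk
      (const ())))))
  · exact (hR.comp id.fst).get2 (hi.comp id.fst) id.snd
  · exact quotRow (hc.comp id.fst) (hL.comp id.fst) (hR.comp id.fst) (hr.comp id.fst) id.snd
  · exact (hd.comp id.fst).getD id.snd (const _)

theorem quotient : PolyTime Algo.quotient := by
  have hT : PolyTime fun x : Input => x.2.2.2.1 := id.snd.snd.snd.fst
  have hd : PolyTime fun x : Input => x.2.2.2.2.1 := id.snd.snd.snd.snd.fst
  have hc : PolyTime fun x : Input => ctx x.2.2.2.1 :=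
    hT.prodMk (hT.range.prodMk (hT.getD (const 0) (const [])).range)
  have hL := hc.mecActs hd
  have hR := hc.reach hL
  exact (quotOf id.snd.snd.fst hd hc hL hR (hc.snd.fst.reps hR)).prodMk (const 0)

end PolyTime

/-! ## Correctness of the algorithm -/

/-! ### Enumerations -/

section Enum

variable {α β : Type*} {n m : ℕ}

/-- The list of all elements in the order of an enumeration. -/
def enum (e : α ≃ Fin n) : List α := List.ofFn e.symm

theorem mem_enum (e : α ≃ Fin n) (a : α) : a ∈ enum e :=
  List.mem_ofFn.2 ⟨e a, e.symm_apply_apply a⟩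

theorem nodup_enum (e : α ≃ Fin n) : (enum e).Nodup :=
  List.nodup_ofFn.2 e.symm.injective

theorem length_enum (e : α ≃ Fin n) : (enum e).length = n := List.length_ofFn

theorem range_eq_map_enum (e : α ≃ Fin n) : List.range n = (enum e).map fun a => (e a : ℕ) := by
  rw [enum, List.map_ofFn]
  apply List.ext_getElem
  · simp
  · intro i h1 h2
    simp

theorem ofFn_eq_map_enum (e : α ≃ Fin n) (f : α → β) :
    (List.ofFn fun i => f (e.symm i)) = (enum e).map f := by
  rw [enum, List.map_ofFn]
  rfl

theorem sum_enum [Fintype α] {β : Type*} [AddCommMonoid β] (e : α ≃ Fin n) (f : α → β) :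
    ((enum e).map f).sum = ∑ a, f a := by
  rw [← ofFn_eq_map_enum, List.sum_ofFn]
  exact Equiv.sum_comp e.symm f

theorem getD_enum (e : α ≃ Fin n) (f : α → β) (a : α) (d : β) :
    ((enum e).map f).getD (e a) d = f a := by
  rw [← ofFn_eq_map_enum, List.getD_eq_getElem _ _ (by simp)]
  simp

theorem any_range (e : α ≃ Fin n) (p : ℕ → Bool) :
    (List.range n).any p = true ↔ ∃ a, p (e a) = true := by
  rw [range_eq_map_enum e]
  simp [mem_enum]

theorem all_range (e : α ≃ Fin n) (p : ℕ → Bool) :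
    (List.range n).all p = true ↔ ∀ a, p (e a) = true := by
  rw [range_eq_map_enum e]
  simp [mem_enum]

open Classical in
/-- The enumeration given by a list without repetitions. -/
noncomputable def listEquiv (l : List α) (hl : l.Nodup) (h : ∀ a, a ∈ l) : α ≃ Fin l.length :=
  (List.Nodup.getEquivOfForallMemList l hl h).symm

theorem enum_listEquiv (l : List α) (hl : l.Nodup) (h : ∀ a, a ∈ l) :
    enum (listEquiv l hl h) = l := by
  apply List.ext_getElem
  · simp [enum]
  · intro i h1 h2
    simp [enum, listEquiv]

theorem listEquiv_eq (l : List α) (hl : l.Nodup) (h : ∀ a, a ∈ l) {i : ℕ} (hi : i < l.length)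
    {a : α} (ha : l[i] = a) : (listEquiv l hl h a : ℕ) = i := by
  subst ha
  have : listEquiv l hl h l[i] = ⟨i, hi⟩ := by
    rw [← Equiv.eq_symm_apply]
    rfl
  rw [this]

/-- A Boolean matrix represents a relation. -/
def Represents (e : α ≃ Fin n) (e' : β ≃ Fin m) (t : List (List Bool)) (R : Set (α × β)) : Prop :=
  ∀ a b, Algo.get2 t (e a) (e' b) = true ↔ (a, b) ∈ R

theorem represents_tab (e : α ≃ Fin n) (e' : β ≃ Fin m) {f : ℕ → ℕ → Bool} {R : Set (α × β)}
    (h : ∀ a b, f (e a) (e' b) = true ↔ (a, b) ∈ R) :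
    Represents e e' (Algo.tab (List.range n) (List.range m) f) R := by
  intro a b
  rw [← h, Algo.get2, Algo.tab, range_eq_map_enum e, List.map_map, getD_enum,
    range_eq_map_enum e']
  simp only [Function.comp_apply]
  rw [List.map_map, getD_enum]
  rfl

theorem length_flatMap_const {γ δ : Type*} (l : List γ) (l' : List δ) :
    (l.flatMap fun _ => l').length = l.length * l'.length := by
  simp [List.length_flatMap]

end Enum

/-! ### The tables represent the MDP, its reachability and its pruning -/

namespace MDP

open Algo

variable {S : Type u} {A : Type v} {n m : ℕ}

open Classical in
/-- The typed version of the encoding. -/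
noncomputable def input (eS : S ≃ Fin n) (eA : A ≃ Fin m) (M : MDP S A) (Φ : WRObjective M)
    (frac : S → A → S → ℕ × ℕ) : Input :=
  (n, m, eS M.init,
    (enum eS).map fun s => (enum eA).map fun a =>
      if a ∈ M.avail s then (enum eS).map (frac s a) else [],
    (enum eS).map fun s => if s ∈ Φ.F then Data.ofRat (Φ.r s) else .num 0, ())

/-- An unavailable action has the empty row in the typed version; the empty list is encoded as the
number `0`, which is the mark used in `encode`. Available rows are never empty, since there is a
state. -/
theorem enc_input (eS : S ≃ Fin n) (eA : A ≃ Fin m) (M : MDP S A) (Φ : WRObjective M)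
    (frac : S → A → S → ℕ × ℕ) : enc (input eS eA M Φ frac) = encode eS eA M Φ frac := by
  classical
  have h1 : ∀ i : Fin n, ∀ j : Fin m, enc (if eA.symm j ∈ M.avail (eS.symm i) then
      (enum eS).map (frac (eS.symm i) (eA.symm j)) else []) =
      if eA.symm j ∈ M.avail (eS.symm i) then
        .list (List.ofFn fun k : Fin n =>
          let f := frac (eS.symm i) (eA.symm j) (eS.symm k)
          .pair (.num f.1) (.num f.2))
      else .num 0 := by
    intro i j
    split_ifs
    · show Data.list (((enum eS).map _).map enc) = _
      rw [← ofFn_eq_map_enum, List.map_ofFn]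
      rfl
    · rfl
  unfold encode
  simp only [← h1]
  unfold input
  rw [← ofFn_eq_map_enum, ← ofFn_eq_map_enum]
  show Data.list [_, _, _, .list (List.map enc (List.ofFn _)), .list (List.map enc (List.ofFn _))] = _
  rw [List.map_ofFn, List.map_ofFn]
  simp only [← ofFn_eq_map_enum eA]
  have h2 : ∀ i : Fin n, enc (List.ofFn fun j : Fin m =>
      if eA.symm j ∈ M.avail (eS.symm i) then (enum eS).map (frac (eS.symm i) (eA.symm j))
      else []) = .list (List.ofFn fun j : Fin m => enc (
        if eA.symm j ∈ M.avail (eS.symm i) then (enum eS).map (frac (eS.symm i) (eA.symm j))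
        else [])) := by
    intro i
    show Data.list (List.map enc _) = _
    rw [List.map_ofFn]
    rfl
  simp only [← h2]
  rfl

/-- The fractions `frac` are the transition probabilities of `M`. -/
def HasFractions (M : MDP S A) (frac : S → A → S → ℕ × ℕ) : Prop :=
  ∀ s, ∀ a ∈ M.avail s, ∀ t, 0 < (frac s a t).2 ∧
    (M.δ s a t).toReal = ((frac s a t).1 : ℝ) / ((frac s a t).2 : ℝ)

section Tables

variable [Finite S] [Finite A] (eS : S ≃ Fin n) (eA : A ≃ Fin m) (M : MDP S A)
  (Φ : WRObjective M) (frac : S → A → S → ℕ × ℕ)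

open Classical in
/-- The table of an MDP. -/
noncomputable def table : Table :=
  (enum eS).map fun s => (enum eA).map fun a =>
    if a ∈ M.avail s then (enum eS).map (frac s a) else []

open Classical in
/-- The list of the rewards. -/
noncomputable def rewards : List Data :=
  (enum eS).map fun s => if s ∈ Φ.F then Data.ofRat (Φ.r s) else .num 0

open Classical in
theorem row_table (s : S) (a : A) : row (M.table eS eA frac) (eS s) (eA a) =
    if a ∈ M.avail s then (enum eS).map (frac s a) else [] := by
  rw [row, table, getD_enum, getD_enum]

theorem isEmpty_row (s : S) (a : A) :
    (!(row (M.table eS eA frac) (eS s) (eA a)).isEmpty) = true ↔ a ∈ M.avail s := by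
  rw [row_table]
  split_ifs with h
  · have := List.ne_nil_of_mem (mem_enum eS s)
    simp [h, this]
  · simp [h]

theorem isZero_rewards (s : S) :
    ((M.rewards eS Φ).getD (eS s) (.num 0)).isZero = true ↔ s ∉ Φ.F := by
  rw [rewards, getD_enum]
  split_ifs with h
  · simp [h, Data.ofRat, Data.isZero]
  · simp [h, Data.isZero]

theorem ctx_table : ctx (M.table eS eA frac) =
    (M.table eS eA frac, List.range n, List.range m) := by
  have h1 : (M.table eS eA frac).length = n := by
    rw [table, List.length_map, length_enum]
  have h2 : ((M.table eS eA frac).getD 0 []).length = m := by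
    -- The number of actions is read off row `0`, which exists because of the initial state.
    have : (0 : ℕ) = (eS (eS.symm ⟨0, (Fin.pos (eS M.init))⟩) : ℕ) := by simp
    rw [this, table, getD_enum, List.length_map, length_enum]
  rw [ctx, h1, h2]

variable {frac}

/-- Denominators are positive, so positivity is decided by the numerator. The fractions mean
something for available actions only, which is why availability is carried along for the sets of
pairs below. -/
theorem supp_table (hfrac : M.HasFractions frac) {s : S} {a : A} (ha : a ∈ M.avail s) (t : S) :
    supp (M.table eS eA frac) (eS s) (eA a) (eS t) = true ↔ t ∈ (M.δ s a).support := by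
  rw [supp, row_table, if_pos ha, getD_enum, ← M.pr_pos_iff]
  obtain ⟨h1, h2⟩ := hfrac s a ha t
  show _ ↔ 0 < (M.δ s a t).toReal
  rw [h2, div_pos_iff_of_pos_right (by exact_mod_cast h1)]
  simp [Nat.pos_iff_ne_zero]

theorem represents_reachStep (hfrac : M.HasFractions frac) {L R : List (List Bool)}
    {L' : Set (S × A)} {R' : Set (S × S)}
    (hL : Represents eS eA L L') (hR : Represents eS eS R R')
    (hL' : ∀ s a, (s, a) ∈ L' → a ∈ M.avail s) :
    Represents eS eS (Algo.reachStep (M.table eS eA frac, List.range n, List.range m) L R)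
      (M.reachStep L' R') := by
  refine represents_tab eS eS fun s t => ?_
  simp only [Bool.or_eq_true, any_range eA, any_range eS, Bool.and_eq_true, hR s t, hL s _,
    hR _ t]
  refine or_congr Iff.rfl (exists_congr fun a => and_congr_right fun ha => exists_congr fun u => ?_)
  rw [M.supp_table eS eA hfrac (hL' s a ha)]

theorem represents_reach (hfrac : M.HasFractions frac) {L : List (List Bool)} {L' : Set (S × A)}
    (hL : Represents eS eA L L') (hL' : ∀ s a, (s, a) ∈ L' → a ∈ M.avail s) :
    Represents eS eS (reach (M.table eS eA frac, List.range n, List.range m) L)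
      {x | M.Reach L' x.1 x.2} := by
  intro s t
  rw [reach, List.foldl_const, length_flatMap_const]
  have hn : Nat.card S = n := by rw [Nat.card_congr eS, Nat.card_fin]
  show _ ↔ M.Reach L' s t
  rw [← M.mem_reachStep_iterate L' (N := n * n) (by rw [hn])]
  simp only [List.length_range]
  have key : ∀ k, Represents eS eS
      ((Algo.reachStep (M.table eS eA frac, List.range n, List.range m) L)^[k]
        (tab (List.range n) (List.range n) fun s t => s == t))
      ((M.reachStep L')^[k] {x | x.1 = x.2}) := by
    intro k
    induction k with
    | zero =>
      refine represents_tab eS eS fun s t => ?_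
      simp [Fin.val_inj]
    | succ k ih =>
      rw [Function.iterate_succ_apply', Function.iterate_succ_apply']
      exact M.represents_reachStep eS eA hfrac hL ih hL'
  exact key _ s t

theorem represents_prune (hfrac : M.HasFractions frac) {L : List (List Bool)} {L' : Set (S × A)}
    (hL : Represents eS eA L L') (hL' : ∀ s a, (s, a) ∈ L' → a ∈ M.avail s) :
    Represents eS eA (Algo.prune (M.table eS eA frac, List.range n, List.range m) L) (M.prune L') := by
  have hR := M.represents_reach eS eA hfrac hL hL'
  refine represents_tab eS eA fun s a => ?_
  simp only [Bool.and_eq_true, all_range eS, hL s a, Bool.or_eq_true, hR _ s]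
  refine and_congr_right fun ha => forall_congr' fun t => ?_
  rw [← M.supp_table eS eA hfrac (hL' s a ha)]
  cases supp (M.table eS eA frac) (eS s) (eA a) (eS t) <;> simp

theorem represents_mecActs (hfrac : M.HasFractions frac) :
    Represents eS eA
      (mecActs (M.table eS eA frac, List.range n, List.range m) (M.rewards eS Φ))
      (M.prune^[n * m] (M.pairs Φ.Fᶜ)) := by
  rw [mecActs, List.foldl_const, length_flatMap_const]
  simp only [List.length_range]
  generalize n * m = k
  induction k with
  | zero =>
    refine represents_tab eS eA fun s a => ?_
    rw [Bool.and_eq_true, M.isEmpty_row, M.isZero_rewards, and_comm]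
    rfl
  | succ k ih =>
    rw [Function.iterate_succ_apply', Function.iterate_succ_apply']
    exact M.represents_prune eS eA hfrac ih fun s a h => (prune_iterate_subset k h).2

end Tables

end MDP

/-! ### The output is an encoding of the MEC quotient -/

namespace MDP

open Algo

variable {S : Type u} {A : Type v} {n m : ℕ} [Finite S] [Finite A] (eS : S ≃ Fin n)
  (eA : A ≃ Fin m) (M : MDP S A) (U : Set S) (Φ : WRObjective M) (frac : S → A → S → ℕ × ℕ)

open Classical in
/-- The first states of the classes that are represented by one state of the quotient. -/
noncomputable def classReps : List S :=
  (enum eS).filter fun s => ∀ t, M.proj U s = M.proj U t → eS s ≤ eS t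

theorem mem_classReps (s : S) :
    s ∈ M.classReps eS U ↔ ∀ t, M.proj U s = M.proj U t → eS s ≤ eS t := by
  simp [classReps, mem_enum]

theorem exists_mem_classReps (s : S) : ∃ t ∈ M.classReps eS U, M.proj U t = M.proj U s := by
  obtain ⟨t, ht, hmin⟩ := Set.exists_min_image {t | M.proj U t = M.proj U s} eS (Set.toFinite _)
    ⟨s, rfl⟩
  exact ⟨t, (M.mem_classReps eS U t).2 fun u hu => hmin u (hu.symm.trans ht), ht⟩

/-- The list of the states of the quotient. -/
noncomputable def quotStates : List (QState M U) := .sink :: (M.classReps eS U).map (M.proj U)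

theorem nodup_quotStates : (M.quotStates eS U).Nodup := by
  refine List.nodup_cons.2 ⟨fun h => ?_, ?_⟩
  · obtain ⟨s, _, hs⟩ := List.mem_map.1 h
    exact M.proj_ne_sink U s hs
  · refine List.Nodup.map_on (fun s hs t ht h => ?_) ((nodup_enum eS).filter _)
    exact eS.injective (le_antisymm ((M.mem_classReps eS U s).1 hs t h)
      ((M.mem_classReps eS U t).1 ht s h.symm))

theorem mem_quotStates (q : QState M U) : q ∈ M.quotStates eS U := by
  by_cases hq : q = .sink
  · exact hq ▸ List.mem_cons_self
  · obtain ⟨s, rfl⟩ := M.exists_proj_eq U hq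
    obtain ⟨t, ht, h⟩ := M.exists_mem_classReps eS U s
    exact List.mem_cons_of_mem _ (List.mem_map.2 ⟨t, ht, h⟩)

/-- The list of the actions of the quotient. -/
def quotActs : List (QAction S A) := none :: (enum eS ×ˢ enum eA).map some

theorem nodup_quotActs : (quotActs eS eA).Nodup := by
  refine List.nodup_cons.2 ⟨by simp, ?_⟩
  exact ((nodup_enum eS).product (nodup_enum eA)).map (Option.some_injective _)

theorem mem_quotActs (x : QAction S A) : x ∈ quotActs eS eA := by
  cases x with
  | none => exact List.mem_cons_self
  | some p =>
    exact List.mem_cons_of_mem _ (List.mem_map.2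
      ⟨p, List.pair_mem_product.2 ⟨mem_enum eS p.1, mem_enum eA p.2⟩, rfl⟩)

/-- The enumeration of the states of the quotient. -/
noncomputable def quotStateEquiv : QState M U ≃ Fin (M.quotStates eS U).length :=
  listEquiv _ (M.nodup_quotStates eS U) (M.mem_quotStates eS U)

/-- The enumeration of the actions of the quotient. -/
noncomputable def quotActEquiv : QAction S A ≃ Fin (quotActs eS eA).length :=
  listEquiv _ (nodup_quotActs eS eA) (mem_quotActs eS eA)

/-- The product of the denominators of the probabilities of a distribution. -/
def commonDenom (s : S) (a : A) : ℕ := ((enum eS).map fun u => (frac s a u).2).prod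

open Classical in
/-- The transition probabilities of the quotient as fractions. -/
noncomputable def quotFrac (_ : QState M U) : QAction S A → QState M U → ℕ × ℕ
  | none, q => if q = .sink then (1, 1) else (0, 1)
  | some (s, a), q => if q = .sink then (0, 1) else
      (((enum eS).map fun u => if M.proj U u = q then
        (frac s a u).1 * (commonDenom eS frac s a / (frac s a u).2) else 0).sum,
        commonDenom eS frac s a)

-- Over the product of all denominators each fraction has an integral numerator, as its denominator
-- divides the product, so the probabilities of a class add up as integers. Lowest terms are not
-- required, and the product has polynomial bit size.
variable {frac} in
theorem hasFractions_quotFrac (h : M.HasFractions frac) :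
    (M.mecQuotient U).HasFractions (M.quotFrac eS U frac) := by
  classical
  have := Fintype.ofFinite S
  have := Fintype.ofFinite A
  rintro q (_ | ⟨s, a⟩) hx q'
  · have := M.mecQuotient_pr_none U q q'
    rw [pr] at this
    rw [this, quotFrac]
    split_ifs <;> simp
  · have ha := ((M.some_mem_avail_iff U q s a).1 hx).2.1
    have h1 := M.mecQuotient_pr_some U q s a q'
    rw [pr] at h1
    rw [h1, quotFrac]
    split_ifs with hq
    · subst hq
      rw [Finset.filter_eq_empty_iff.2 fun t _ => M.proj_ne_sink U t]
      simp
    · have hD : 0 < commonDenom eS frac s a := by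
        refine Nat.pos_of_ne_zero (List.prod_ne_zero fun h0 => ?_)
        obtain ⟨u, _, hu⟩ := List.mem_map.1 h0
        exact (h s a ha u).1.ne' hu
      refine ⟨hD, ?_⟩
      have hD' : (commonDenom eS frac s a : ℝ) ≠ 0 := by exact_mod_cast hD.ne'
      rw [sum_enum, eq_div_iff hD', Finset.sum_filter, Finset.sum_mul, Nat.cast_sum]
      refine Finset.sum_congr rfl fun u _ => ?_
      split_ifs
      · obtain ⟨h2, h3⟩ := h s a ha u
        have hdvd : (frac s a u).2 ∣ commonDenom eS frac s a :=
          List.dvd_prod (List.mem_map.2 ⟨u, mem_enum eS u, rfl⟩)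
        have h2' : ((frac s a u).2 : ℝ) ≠ 0 := by exact_mod_cast h2.ne'
        rw [pr, h3, Nat.cast_mul, Nat.cast_div hdvd h2']
        field_simp
      · simp

/-! ### The parts of the output -/

theorem pairList_eq (T : Table) : pairList (T, List.range n, List.range m) =
    (enum eS ×ˢ enum eA).map fun p => ((eS p.1 : ℕ), (eA p.2 : ℕ)) := by
  show ((List.range n).flatMap fun i => (List.range m).map fun j => (i, j)) = _
  rw [range_eq_map_enum eS, range_eq_map_enum eA]
  show _ = ((enum eS).flatMap fun s => (enum eA).map (Prod.mk s)).map _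
  rw [List.map_flatMap, List.flatMap_map]
  simp [Function.comp_def]

section

variable {eS eA M U frac} {L R : List (List Bool)}

theorem reps_eq (hR : Represents eS eS R {x | M.proj U x.1 = M.proj U x.2}) :
    reps (List.range n) R = (M.classReps eS U).map fun s => (eS s : ℕ) := by
  classical
  rw [reps, classReps]
  conv_lhs => rw [range_eq_map_enum eS, List.filter_map, ← range_eq_map_enum eS]
  congr 1
  refine List.filter_congr fun s _ => ?_
  rw [Bool.eq_iff_iff, Function.comp_apply, all_range eS, decide_eq_true_iff]
  refine forall_congr' fun t => ?_
  have := hR s t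
  rw [Bool.or_eq_true, Nat.ble_eq, Fin.val_fin_le]
  show _ ↔ ((s, t) ∈ {x : S × S | M.proj U x.1 = M.proj U x.2} → _)
  rw [← this]
  cases get2 R (eS s) (eS t) <;> simp

variable (U frac) in
theorem map_quotFrac_none (q : QState M U) :
    (M.quotStates eS U).map (M.quotFrac eS U frac q none) =
      diracSink ((M.classReps eS U).map fun s => (eS s : ℕ)) := by
  rw [quotStates, diracSink, List.map_cons, List.map_map, List.map_map]
  exact congrArg₂ _ (if_pos rfl)
    (List.map_congr_left fun s _ => if_neg (M.proj_ne_sink U s))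

theorem map_quotFrac_some (hR : Represents eS eS R {x | M.proj U x.1 = M.proj U x.2})
    (q : QState M U) (s : S) (a : A) :
    (M.quotStates eS U).map (M.quotFrac eS U frac q (some (s, a))) =
      quotDist (List.range n) R ((M.classReps eS U).map fun s => (eS s : ℕ))
        ((enum eS).map (frac s a)) := by
  have hD : denom ((enum eS).map (frac s a)) = commonDenom eS frac s a := by
    rw [denom, commonDenom, List.map_map]
    rfl
  rw [quotStates, quotDist, List.map_cons, List.map_map, List.map_map]
  classical
  refine congrArg₂ _ (if_pos rfl) (List.map_congr_left fun t _ => ?_)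
  refine (if_neg (M.proj_ne_sink U t)).trans ?_
  rw [Function.comp_apply, hD]
  congr 1
  rw [numer, range_eq_map_enum eS, List.map_map]
  congr 1
  refine List.map_congr_left fun u _ => ?_
  rw [Function.comp_apply, getD_enum, hD]
  exact if_congr (hR u t).symm rfl rfl

theorem input_quotient (hL : Represents eS eA L {x | ∃ C : M.MEC Φ.Fᶜ, x ∈ C.B})
    (hR : Represents eS eS R {x | M.proj Φ.Fᶜ x.1 = M.proj Φ.Fᶜ x.2}) :
    input (M.quotStateEquiv eS Φ.Fᶜ) (quotActEquiv eS eA) (M.mecQuotient Φ.Fᶜ) Φ.quotient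
      (M.quotFrac eS Φ.Fᶜ frac) =
    quotOf (eS M.init) (M.rewards eS Φ) (M.table eS eA frac, List.range n, List.range m) L R
      (reps (List.range n) R) := by
  classical
  have hlen : (M.quotStates eS Φ.Fᶜ).length =
      ((M.classReps eS Φ.Fᶜ).map fun s => (eS s : ℕ)).length + 1 := by
    rw [quotStates, List.length_cons, List.length_map, List.length_map]
  have hlen' : (quotActs eS eA).length =
      (pairList (M.table eS eA frac, List.range n, List.range m)).length + 1 := by
    rw [pairList_eq eS eA, quotActs, List.length_cons, List.length_map, List.length_map]
  -- A state lies in a component if and only if it has a surviving pair (`exists_mem_T_iff`), and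
  -- exactly the classes of such states have `stay` among the non-sink states.
  have hstay : ∀ s, (List.range m).any (fun a => get2 L (eS s) a) = true ↔
      none ∈ (M.mecQuotient Φ.Fᶜ).avail (M.proj Φ.Fᶜ s) := by
    intro s
    rw [any_range eA, none_mem_avail_iff]
    have h1 : (∃ a : A, get2 L (eS s) (eA a) = true) ↔ ∃ C : M.MEC Φ.Fᶜ, s ∈ C.T := by
      rw [exists_mem_T_iff]
      exact exists_congr fun a => hL s a
    rw [h1]
    constructor
    · rintro ⟨C, hC⟩ t ht h
      rw [(M.proj_eq_collapsed_iff Φ.Fᶜ s C).2 hC] at h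
      cases h
    · intro h
      by_contra hs
      exact h s _ (M.proj_of_notMem Φ.Fᶜ s fun C hC => hs ⟨C, hC⟩)
  have hmove : ∀ s t a, (get2 R (eS t) (eS s) &&
      (!(row (M.table eS eA frac) (eS t) (eA a)).isEmpty && !get2 L (eS t) (eA a))) = true ↔
      some (t, a) ∈ (M.mecQuotient Φ.Fᶜ).avail (M.proj Φ.Fᶜ s) := by
    intro s t a
    rw [some_mem_avail_iff, Bool.and_eq_true, Bool.and_eq_true, M.isEmpty_row, hR t s]
    refine and_congr Iff.rfl (and_congr Iff.rfl ?_)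
    rw [Bool.not_eq_true', Bool.eq_false_iff, Ne, hL t a]
    simp
  unfold input quotOf
  rw [reps_eq hR]
  -- The first representative equivalent to the initial state is the only one; the index is shifted
  -- by one because the sink comes first.
  have hinit : ((M.quotStateEquiv eS Φ.Fᶜ (M.mecQuotient Φ.Fᶜ).init : Fin _) : ℕ) =
      ((M.classReps eS Φ.Fᶜ).map fun s => (eS s : ℕ)).findIdx (get2 R (eS M.init)) + 1 := by
    obtain ⟨t, ht, h⟩ := M.exists_mem_classReps eS Φ.Fᶜ M.init
    have hlt : ((M.classReps eS Φ.Fᶜ).map fun s => (eS s : ℕ)).findIdx (get2 R (eS M.init)) <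
        ((M.classReps eS Φ.Fᶜ).map fun s => (eS s : ℕ)).length :=
      List.findIdx_lt_length_of_exists ⟨eS t, List.mem_map.2 ⟨t, ht, rfl⟩, (hR _ _).2 h.symm⟩
    have hget := List.findIdx_getElem (w := hlt)
    rw [List.getElem_map, hR] at hget
    refine listEquiv_eq _ _ _ (by rw [hlen]; omega) ?_
    simp only [quotStates, List.getElem_cons_succ, List.getElem_map]
    exact hget.symm
  rw [hinit, quotStateEquiv, quotActEquiv, enum_listEquiv, enum_listEquiv, hlen, hlen']
  refine congrArg _ (congrArg _ (congrArg _ (Prod.ext ?_ (Prod.ext ?_ rfl))))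
  · dsimp only
    rw [quotStates, List.map_cons]
    congr 1
    · rw [quotActs, List.map_cons, if_pos (show none ∈ (M.mecQuotient Φ.Fᶜ).avail .sink from rfl),
        ← quotStates, map_quotFrac_none, List.map_map, pairList_eq eS eA, List.map_map]
      congr 1
      refine List.map_congr_left fun p _ => ?_
      refine if_neg fun h => ?_
      exact M.proj_ne_sink Φ.Fᶜ _ ((M.some_mem_avail_iff Φ.Fᶜ _ p.1 p.2).1 h).1
    · rw [List.map_map, List.map_map]
      refine List.map_congr_left fun s _ => ?_
      rw [Function.comp_apply, Function.comp_apply, quotRow, quotActs, List.map_cons,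
        ← quotStates, map_quotFrac_none, List.map_map, pairList_eq eS eA, List.map_map]
      refine congrArg₂ _ (if_congr (hstay s).symm rfl rfl) ?_
      refine List.map_congr_left fun p _ => ?_
      refine Eq.trans ?_ (if_congr (hmove s p.1 p.2).symm rfl rfl)
      show (if some (p.1, p.2) ∈ _ then _ else _) = _
      split_ifs with h
      · have ha := ((M.some_mem_avail_iff Φ.Fᶜ _ p.1 p.2).1 h).2.1
        rw [row_table, if_pos ha, ← map_quotFrac_some hR]
      · rfl
  · dsimp only
    rw [quotStates, List.map_cons, List.map_map, List.map_map]
    refine congrArg₂ _ (if_neg ?_) (List.map_congr_left fun s _ => ?_)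
    · rintro ⟨t, ht, h, _⟩
      cases h
    rw [Function.comp_apply, Function.comp_apply, rewards, getD_enum]
    by_cases hs : s ∈ Φ.F
    · have h1 : ∀ C : M.MEC Φ.Fᶜ, s ∉ C.T := fun C hC => C.subset hC hs
      rw [M.proj_of_notMem Φ.Fᶜ s h1, if_pos hs]
      exact if_pos ⟨s, h1, rfl, hs⟩
    · rw [if_neg hs]
      refine if_neg ?_
      rintro ⟨t, ht, h, hF⟩
      rw [proj_eq_orig_iff] at h
      exact hs (h ▸ hF)

end

/-- The algorithm maps encodings to encodings of the MEC quotient. -/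
theorem quotient_input (h : M.HasFractions frac) :
    Algo.quotient (input eS eA M Φ frac) =
      (input (M.quotStateEquiv eS Φ.Fᶜ) (quotActEquiv eS eA) (M.mecQuotient Φ.Fᶜ) Φ.quotient
        (M.quotFrac eS Φ.Fᶜ frac), 0) := by
  have hcard : Nat.card S * Nat.card A ≤ n * m := by
    rw [Nat.card_congr eS, Nat.card_congr eA, Nat.card_fin, Nat.card_fin]
  have hL := M.represents_mecActs eS eA Φ h
  have hR := M.represents_reach eS eA h hL fun s a hs => (prune_iterate_subset _ hs).2
  rw [input_quotient (L := mecActs (M.table eS eA frac, List.range n, List.range m)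
    (M.rewards eS Φ)) (R := Algo.reach (M.table eS eA frac, List.range n, List.range m)
    (mecActs (M.table eS eA frac, List.range n, List.range m) (M.rewards eS Φ)))
    Φ
    (fun s a => (hL s a).trans (mem_prune_iterate hcard s a))
    (fun s t => (hR s t).trans (reach_prune_iterate hcard s t))]
  rw [← M.ctx_table]
  have h2 : (ctx (M.table eS eA frac)).2.1 = List.range n := by rw [M.ctx_table]
  rw [← h2]
  rfl

end MDP

end CPTMDP

/-! ### The main theorem -/

theorem mainTheorem7 :
    ∃ (P : Prog) (f : Polynomial ℕ),
      ∀ (S : Type*) (A : Type*) [Finite S] [Finite A] (M : MDP S A) (Φ : WRObjective M),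
        -- The MEC quotient is stopping.
        (M.mecQuotient Φ.Fᶜ).IsStopping Φ.quotient QState.sink ∧
        -- It has the same induced prospects and the same CPT-value.
        Set.range (M.prospect Φ) = Set.range ((M.mecQuotient Φ.Fᶜ).prospect Φ.quotient) ∧
        (∀ c : CPTParams,
          M.cptVal Φ c = (M.mecQuotient Φ.Fᶜ).cptVal Φ.quotient c ∧
          M.cptValProspect Φ c = (M.mecQuotient Φ.Fᶜ).cptValProspect Φ.quotient c) ∧
        -- The program `P` constructs it, together with its sink, in polynomial time.
        ∀ (n m : ℕ) (eS : S ≃ Fin n) (eA : A ≃ Fin m) (d : Data), IsEncoding eS eA M Φ d →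
          ∃ (n' m' : ℕ) (eS' : QState M Φ.Fᶜ ≃ Fin n') (eA' : QAction S A ≃ Fin m') (d' : Data)
            (t : ℕ), IsEncoding eS' eA' (M.mecQuotient Φ.Fᶜ) Φ.quotient d' ∧
            P.Runs d (Data.pair d' (Data.num (eS' QState.sink))) t ∧ t ≤ f.eval d.size := by
  obtain ⟨P, f, hP⟩ : ∃ (P : Prog) (f : Polynomial ℕ),
      ∀ (S : Type _) (A : Type _) [Finite S] [Finite A] (M : MDP S A) (Φ : WRObjective M)
        (n m : ℕ) (eS : S ≃ Fin n) (eA : A ≃ Fin m) (d : Data), IsEncoding eS eA M Φ d →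
          ∃ (n' m' : ℕ) (eS' : QState M Φ.Fᶜ ≃ Fin n') (eA' : QAction S A ≃ Fin m') (d' : Data)
            (t : ℕ), IsEncoding eS' eA' (M.mecQuotient Φ.Fᶜ) Φ.quotient d' ∧
            P.Runs d (Data.pair d' (Data.num (eS' QState.sink))) t ∧ t ≤ f.eval d.size := by
    -- The algorithm works on tables of numbers that do not mention `S` or `A`, so one program and
    -- one polynomial serve all MDPs.
    obtain ⟨P, B, ⟨f, hf⟩, hP⟩ := PolyTime.quotient
    refine ⟨P, f, ?_⟩
    rintro S A _ _ M Φ n m eS eA d ⟨frac, hfrac, rfl⟩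
    obtain ⟨t, ht, hle⟩ := hP (M.input eS eA Φ frac)
    dsimp only at ht
    rw [M.quotient_input eS eA Φ frac hfrac] at ht
    have hle' := hle.trans (hf _)
    rw [MDP.enc_input] at ht hle'
    -- The sink heads the list of the states of the quotient, so the constant `0` returned by the
    -- algorithm is its index.
    have hsink : (M.quotStateEquiv eS Φ.Fᶜ QState.sink : ℕ) = 0 :=
      listEquiv_eq _ _ _ (Nat.succ_pos _) rfl
    refine ⟨_, _, M.quotStateEquiv eS Φ.Fᶜ, MDP.quotActEquiv eS eA, _, t,
      ⟨M.quotFrac eS Φ.Fᶜ frac, M.hasFractions_quotFrac eS Φ.Fᶜ hfrac, rfl⟩, ?_, hle'⟩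
    rw [hsink, ← MDP.enc_input (M.quotStateEquiv eS Φ.Fᶜ)]
    exact ht
  refine ⟨P, f, fun S A _ _ M Φ => ?_⟩
  have := Fintype.ofFinite S
  have := Fintype.ofFinite A
  exact ⟨MDP.mecQuotient_isStopping Φ, MDP.range_prospect_quotient Φ,
    fun c => ⟨MDP.cptVal_quotient Φ c, MDP.cptValProspect_quotient Φ c⟩, hP S A M Φ⟩
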